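/- Let $(X,g,\xi)$ be a connected Sasakian manifold of dimension $2m+1$, $m\ge 1$: $g$ is a $C^\infty$ Riemannian metric with Levi-Civita connection $\nabla$, and $\xi$ is a Killing vector field of length one such that $\Phi(v)=-\nabla_v\xi$ satisfies $(\nabla_v\Phi)(w)=g(v,w)\,\xi-g(\xi,w)\,v$. Put $F=\xi^\perp$, $F^{1,0}=\{v-\sqrt{-1}\,\Phi(v)\mid v\in F\}$, $F^{0,1}=\overline{F^{1,0}}$ and $\mathcal F^{0,1}=F^{0,1}\oplus\mathbb C\xi\subset TX\otimes\mathbb C$. Using $TX\otimes\mathbb C=F^{1,0}\oplus F^{0,1}\oplus\mathbb C\xi$, regard $(F^{1,0})^*$ as the subbundle of $(TX)^*\otimes\mathbb C$ of the forms that vanish on $\mathcal F^{0,1}$. The bundle $F^{1,0}$ carries the partial connection along $\mathcal F^{0,1}$ for which $\bar\partial_v w$ is the $F^{1,0}$-component of $[v,w]$. Let $H$ be a complex Lie group, and let $p:E_H\to X$ be a $C^\infty$ principal $H$-bundle (right action). A partial connection on $E_H$ in the direction of a (real or complex) distribution on $X$ is an $H$-invariant $C^\infty$ distribution on $E_H$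 which $dp$ maps isomorphically, fiber by fiber, onto the given one; for the distribution $TX$ it is a usual connection. Suppose that $E_H$ is a holomorphic principal $H$-bundle on $(X,g,\xi)$, that is, it is equipped with: * a $C^\infty$ complex structure $J_E$ on $\ker(dp)$ which makes the fibers of $p$ complex manifolds on which $H$ acts holomorphically (the action maps $p^{-1}(x)\times H\to p^{-1}(x)$ are holomorphic); put $\mathbb K^{1,0}=\{k-\sqrt{-1}\,J_E(k)\mid k\in\ker(dp)\}$ and $\mathbb K^{0,1}=\overline{\mathbb K^{1,0}}$; * a partial connection $\widetilde\xi\subset TE_H$ in the direction of $\mathbb R\xi$ such that the Lie derivative of $J_E$ along the lift of $\xi$ to $\widetilde\xi$ vanishes; * a partial connection $\widetilde{\mathcal F}\subset TE_H\otimes\mathbb C$ in the direction of $\mathcal F^{0,1}$, containing $\widetilde\xi$, such that $\widetilde{\mathcal F}$ and $\widetilde{\mathcal F}\oplus\mathbb K^{0,1}$ are integrable (their smooth local sections are closed under the Lie bracket). Let $\mathbb F\subset\widetilde{\mathcal F}$ be the part that corresponds to $F^{0,1}$ under $dp$, and let $\mathbb T=\mathbb K^{1,0}\oplus\overline{\mathbb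 F}$. The Atiyah bundle is $\mathrm{At}(E_H)=\mathbb T/H$, it contains $\mathrm{ad}(E_H)=\mathbb K^{1,0}/H$, and $dp$ induces $d'p:\mathrm{At}(E_H)\to F^{1,0}$. It carries the partial connection along $\mathcal F^{0,1}$ for which $\bar\partial_v s$ is the $\mathbb T$-component of $[\widetilde v,s]$ with respect to $TE_H\otimes\mathbb C=\mathbb T\oplus(\widetilde{\mathcal F}\oplus\mathbb K^{0,1})$, where $\widetilde v$ is the lift of $v$ to $\widetilde{\mathcal F}$ and sections of $\mathrm{At}(E_H)$ are viewed as $H$-invariant sections of $\mathbb T$. A holomorphic connection on $E_H$ is a $C^\infty$ homomorphism $D:F^{1,0}\to\mathrm{At}(E_H)$ of complex vector bundles such that $D(\bar\partial_v w)=\bar\partial_v(D(w))$ for all local $C^\infty$ sections $v$ of $\mathcal F^{0,1}$ and $w$ of $F^{1,0}$, and $d'p\circ D=\mathrm{Id}_{F^{1,0}}$. **Lemma.** Let $D$ be a holomorphic connection on $E_H$. Then $D$ and $\widetilde\xi$ define a usual $C^\infty$ connection $\widetilde D$ on the principal $H$-bundle $E_H$: there is exactly one connection $\widetilde D\subset TE_H$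 such that $\widetilde\xi\subset\widetilde D$ and such that, for every $e\in E_H$ and every $v\in F^{1,0}_{p(e)}$, the value at $e$ of $D(v)$ lies in $\widetilde D_e\otimes\mathbb C$. The curvature of $\widetilde D$, identified with a complex bilinear form on $TX\otimes\mathbb C$ with values in $\mathrm{ad}(E_H)$ through the complex linear isomorphism $k\mapsto\frac12(k-\sqrt{-1}\,J_E(k))$ from $\ker(dp)/H$ to $\mathrm{ad}(E_H)$, is a $C^\infty$ section of $\mathrm{ad}(E_H)\otimes\bigwedge^2(F^{1,0})^*$. -/

import Mathlib

open scoped Manifold ContDiff TensorProduct Topology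

noncomputable section

namespace Sasaki

/-! ### Complexification of a real vector space

Elements of `ℂ ⊗[ℝ] V` are written `1 ⊗ₜ a + I ⊗ₜ b`, that is, `a + √-1 b`. -/

section Complexification

variable {V : Type*} [AddCommGroup V] [Module ℝ V]

/-- Real part of a complexified vector. -/
def cre : ℂ ⊗[ℝ] V →ₗ[ℝ] V :=
  (TensorProduct.lid ℝ V).toLinearMap ∘ₗ Complex.reLm.rTensor V

/-- Imaginary part of a complexified vector. -/
def cim : ℂ ⊗[ℝ] V →ₗ[ℝ] V :=
  (TensorProduct.lid ℝ V).toLinearMap ∘ₗ Complex.imLm.rTensor V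

/-- The vector `a + √-1 b`. -/
def cvec (a b : V) : ℂ ⊗[ℝ] V := (1 : ℂ) ⊗ₜ[ℝ] a + Complex.I ⊗ₜ[ℝ] b

/-- Complex conjugation `a + √-1 b ↦ a - √-1 b`. -/
def cconj : ℂ ⊗[ℝ] V →ₗ[ℝ] ℂ ⊗[ℝ] V := Complex.conjAe.toLinearMap.rTensor V

theorem cconj_smul (c : ℂ) (z : ℂ ⊗[ℝ] V) :
    cconj (c • z) = (starRingEnd ℂ c) • cconj z := by
  induction z with
  | zero => simp
  | tmul a v => simp [cconj, TensorProduct.smul_tmul']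
  | add x y hx hy => simp only [smul_add, map_add, hx, hy]

/-- The conjugate of a complex subspace. -/
def conjSub (S : Submodule ℂ (ℂ ⊗[ℝ] V)) : Submodule ℂ (ℂ ⊗[ℝ] V) where
  carrier := {z | cconj z ∈ S}
  add_mem' := by
    intro a b ha hb
    simp only [Set.mem_ofPred_eq, map_add] at *
    exact S.add_mem ha hb
  zero_mem' := by simp
  smul_mem' := by
    intro c z hz
    simp only [Set.mem_ofPred_eq, cconj_smul] at *
    exact S.smul_mem _ hz

/-- The complexification of a real subspace. -/
def cplxSub (S : Submodule ℝ V) : Submodule ℂ (ℂ ⊗[ℝ] V) := S.baseChange ℂ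

end Complexification

/-! ### Vector fields and distributions on a smooth manifold -/

section Manifold

variable {EM : Type*} [NormedAddCommGroup EM] [NormedSpace ℝ EM]
  {M : Type*} [TopologicalSpace M] [ChartedSpace EM M]

variable (EM) in
/-- The real tangent space. -/
abbrev Tan (x : M) : Type _ := TangentSpace 𝓘(ℝ, EM) x

variable (EM) in
/-- The complexified tangent space `T_x M ⊗ ℂ`. -/
abbrev CTan (x : M) : Type _ := ℂ ⊗[ℝ] TangentSpace 𝓘(ℝ, EM) x

/-- The Lie bracket of complex vector fields, the complex bilinear extension of the Lie bracket. -/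
def cBracket (V W : ∀ x : M, CTan EM x) (x : M) : CTan EM x :=
  cvec
    (VectorField.mlieBracket 𝓘(ℝ, EM) (fun y => cre (V y)) (fun y => cre (W y)) x
      - VectorField.mlieBracket 𝓘(ℝ, EM) (fun y => cim (V y)) (fun y => cim (W y)) x)
    (VectorField.mlieBracket 𝓘(ℝ, EM) (fun y => cre (V y)) (fun y => cim (W y)) x
      + VectorField.mlieBracket 𝓘(ℝ, EM) (fun y => cim (V y)) (fun y => cre (W y)) x)

variable [IsManifold 𝓘(ℝ, EM) ∞ M]

/-- The vector field `V` is `C^∞` on the set `U`. -/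
def SmoothFieldOn (V : ∀ x : M, Tan EM x) (U : Set M) : Prop :=
  ContMDiffOn 𝓘(ℝ, EM) 𝓘(ℝ, EM).tangent ∞
    (fun x => (⟨x, V x⟩ : TangentBundle 𝓘(ℝ, EM) M)) U

/-- The complex vector field `V` is `C^∞` on the set `U`. -/
def CSmoothFieldOn (V : ∀ x : M, CTan EM x) (U : Set M) : Prop :=
  SmoothFieldOn (fun x => cre (V x)) U ∧ SmoothFieldOn (fun x => cim (V x)) U

/-- `S` is a `C^∞` real distribution of rank `r` (a subbundle of `TM`): it has smooth local
frames. -/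
def IsDistribution (S : ∀ x : M, Submodule ℝ (Tan EM x)) (r : ℕ) : Prop :=
  ∀ x₀ : M, ∃ U : Set M, IsOpen U ∧ x₀ ∈ U ∧ ∃ V : Fin r → ∀ x : M, Tan EM x,
    (∀ i, SmoothFieldOn (V i) U) ∧
    ∀ x ∈ U, LinearIndependent ℝ (fun i => V i x) ∧
      Submodule.span ℝ (Set.range fun i => V i x) = S x

/-- `S` is a `C^∞` complex distribution of rank `r` (a subbundle of `TM ⊗ ℂ`). -/
def IsCDistribution (S : ∀ x : M, Submodule ℂ (CTan EM x)) (r : ℕ) : Prop :=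
  ∀ x₀ : M, ∃ U : Set M, IsOpen U ∧ x₀ ∈ U ∧ ∃ V : Fin r → ∀ x : M, CTan EM x,
    (∀ i, CSmoothFieldOn (V i) U) ∧
    ∀ x ∈ U, LinearIndependent ℂ (fun i => V i x) ∧
      Submodule.span ℂ (Set.range fun i => V i x) = S x

/-- Integrability of a complex distribution: its smooth local sections are closed under the Lie
bracket. -/
def IsIntegrable (S : ∀ x : M, Submodule ℂ (CTan EM x)) : Prop :=
  ∀ U : Set M, IsOpen U → ∀ V W : ∀ x : M, CTan EM x,
    CSmoothFieldOn V U → CSmoothFieldOn W U →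
    (∀ x ∈ U, V x ∈ S x) → (∀ x ∈ U, W x ∈ S x) → ∀ x ∈ U, cBracket V W x ∈ S x

end Manifold

/-! ### Sasakian manifolds -/

section Sasakian

variable {EX : Type*} [NormedAddCommGroup EX] [NormedSpace ℝ EX] [FiniteDimensional ℝ EX]
  {X : Type*} [TopologicalSpace X] [ChartedSpace EX X] [IsManifold 𝓘(ℝ, EX) ∞ X]

/-- `nabla` is the Levi-Civita connection of the Riemannian metric `g`: the smooth torsion-free
connection on the tangent bundle compatible with `g`. Here `nabla W x v` is `∇_v W`. -/
structure IsLeviCivita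
    (g : Bundle.ContMDiffRiemannianMetric 𝓘(ℝ, EX) ∞ EX
      (fun x : X => TangentSpace 𝓘(ℝ, EX) x))
    (nabla : CovariantDerivative 𝓘(ℝ, EX) EX (fun x : X => TangentSpace 𝓘(ℝ, EX) x)) :
    Prop where
  smooth : ∀ U : Set X, IsOpen U → ∀ V W : ∀ x : X, Tan EX x, SmoothFieldOn V U →
    SmoothFieldOn W U → SmoothFieldOn (fun x => nabla W x (V x)) U
  torsion_free : nabla.torsion = 0
  metric : ∀ U : Set X, IsOpen U → ∀ V W : ∀ x : X, Tan EX x, SmoothFieldOn V U →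
    SmoothFieldOn W U → ∀ x ∈ U, ∀ v : Tan EX x,
      mvfderiv 𝓘(ℝ, EX) (fun y => g.inner y (V y) (W y)) x v
        = g.inner x (nabla V x v) (W x) + g.inner x (V x) (nabla W x v)

variable (EX X) in
/-- A Sasakian structure on the manifold `X`: a Riemannian metric `g` and a Killing vector field
`ξ` of length one such that `Φ(v) = -∇_v ξ` satisfies
`(∇_v Φ)(w) = g(v, w) ξ - g(ξ, w) v`. -/
structure SasakianStructure where
  /-- The Riemannian metric. -/
  g : Bundle.ContMDiffRiemannianMetric 𝓘(ℝ, EX) ∞ EX (fun x : X => TangentSpace 𝓘(ℝ, EX) x)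
  /-- The Levi-Civita connection. -/
  nabla : CovariantDerivative 𝓘(ℝ, EX) EX (fun x : X => TangentSpace 𝓘(ℝ, EX) x)
  isLeviCivita : IsLeviCivita g nabla
  /-- The Reeb vector field. -/
  xi : ∀ x : X, Tan EX x
  xi_smooth : SmoothFieldOn xi Set.univ
  xi_unit : ∀ x, g.inner x (xi x) (xi x) = 1
  /-- Killing's equation. -/
  xi_killing : ∀ (x : X) (v w : Tan EX x),
    g.inner x (nabla xi x v) w + g.inner x v (nabla xi x w) = 0
  /-- `∇_v (Φ W) - Φ (∇_v W) = g(v, W) ξ - g(ξ, W) v`, where `Φ = -∇ξ`. -/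
  sasaki : ∀ U : Set X, IsOpen U → ∀ W : ∀ x : X, Tan EX x, SmoothFieldOn W U →
    ∀ x ∈ U, ∀ v : Tan EX x,
      nabla (fun y => -(nabla xi y (W y))) x v - (-(nabla xi x (nabla W x v)))
        = g.inner x v (W x) • xi x - g.inner x (xi x) (W x) • v

namespace SasakianStructure

variable (S : SasakianStructure EX X)

/-- The endomorphism `Φ(v) = -∇_v ξ` of `TX`. -/
def Phi (x : X) : Tan EX x →L[ℝ] Tan EX x := -(S.nabla S.xi x)

/-- The distribution `F = ξ^⊥`. -/
def F (x : X) : Submodule ℝ (Tan EX x) := LinearMap.ker (S.g.inner x (S.xi x)).toLinearMap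

/-- `F^{0,1} = {v + √-1 Φ(v) | v ∈ F}`. -/
def F01 (x : X) : Submodule ℂ (CTan EX x) :=
  Submodule.span ℂ {z | ∃ v ∈ S.F x, z = cvec v (S.Phi x v)}

/-- `F^{1,0} = {v - √-1 Φ(v) | v ∈ F}`. -/
def F10 (x : X) : Submodule ℂ (CTan EX x) :=
  Submodule.span ℂ {z | ∃ v ∈ S.F x, z = cvec v (-(S.Phi x v))}

/-- `𝓕^{0,1} = F^{0,1} ⊕ ℂ ξ`. -/
def calF01 (x : X) : Submodule ℂ (CTan EX x) := S.F01 x ⊔ cplxSub (Submodule.span ℝ {S.xi x})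

/-- The holomorphic structure of the bundle `F^{1,0}`: on `U`, the section `u` of `F^{1,0}` is the
derivative `∂̄_v w` of the section `w` along the section `v` of `𝓕^{0,1}`, that is, the
`F^{1,0}`-component of `[v, w]` with respect to `TX ⊗ ℂ = F^{1,0} ⊕ 𝓕^{0,1}`. -/
def IsDbarF10 (U : Set X) (v : ∀ x : X, CTan EX x) (w u : ∀ x : X, S.F10 x) : Prop :=
  ∀ x ∈ U, cBracket v (fun y => (w y : CTan EX y)) x - (u x : CTan EX x) ∈ S.calF01 x

end SasakianStructure

end Sasakian

/-! ### Principal bundles -/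

section Principal

variable (EX : Type*) [NormedAddCommGroup EX] [NormedSpace ℝ EX]
  (X : Type*) [TopologicalSpace X] [ChartedSpace EX X]
  (EH : Type*) [NormedAddCommGroup EH] [NormedSpace ℂ EH]
  (H : Type*) [TopologicalSpace H] [ChartedSpace EH H] [Group H]
  (EE : Type*) [NormedAddCommGroup EE] [NormedSpace ℝ EE]
  (E : Type*) [TopologicalSpace E] [ChartedSpace EE E]

/-- A `C^∞` principal `H`-bundle `p : E → X`, with `H` acting on the right. -/
structure SmoothPrincipalBundle where
  /-- The projection. -/
  p : E → X
  /-- The right action, `act e h = e h`. -/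
  act : E → H → E
  act_one : ∀ e, act e 1 = e
  act_mul : ∀ e h k, act e (h * k) = act (act e h) k
  p_smooth : ContMDiff 𝓘(ℝ, EE) 𝓘(ℝ, EX) ∞ p
  act_smooth : ContMDiff (𝓘(ℝ, EE).prod 𝓘(ℝ, EH)) 𝓘(ℝ, EE) ∞ (fun z : E × H => act z.1 z.2)
  p_act : ∀ e h, p (act e h) = p e
  /-- Equivariant smooth local triviality. -/
  locally_trivial : ∀ x₀ : X, ∃ U : Set X, IsOpen U ∧ x₀ ∈ U ∧
    ∃ φ : OpenPartialHomeomorph E (X × H),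
      φ.source = p ⁻¹' U ∧ φ.target = U ×ˢ Set.univ ∧
      ContMDiffOn 𝓘(ℝ, EE) (𝓘(ℝ, EX).prod 𝓘(ℝ, EH)) ∞ φ φ.source ∧
      ContMDiffOn (𝓘(ℝ, EX).prod 𝓘(ℝ, EH)) 𝓘(ℝ, EE) ∞ φ.symm φ.target ∧
      ∀ e ∈ φ.source, (φ e).1 = p e ∧ ∀ h, φ (act e h) = ((φ e).1, (φ e).2 * h)

end Principal

section Bundles

variable {EX : Type*} [NormedAddCommGroup EX] [NormedSpace ℝ EX]
  {X : Type*} [TopologicalSpace X] [ChartedSpace EX X]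
  {EH : Type*} [NormedAddCommGroup EH] [NormedSpace ℂ EH]
  {H : Type*} [TopologicalSpace H] [ChartedSpace EH H] [Group H]
  {EE : Type*} [NormedAddCommGroup EE] [NormedSpace ℝ EE]
  {E : Type*} [TopologicalSpace E] [ChartedSpace EE E]

namespace SmoothPrincipalBundle

variable (P : SmoothPrincipalBundle EX X EH H EE E)

/-- The differential of the projection. -/
def dp (e : E) : Tan EE e →ₗ[ℝ] (Tan EX (P.p e) : Type _) :=
  (mfderiv 𝓘(ℝ, EE) 𝓘(ℝ, EX) P.p e).toLinearMap

/-- The complexified differential of the projection. -/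
def cdp (e : E) : CTan EE e →ₗ[ℂ] CTan EX (P.p e) := (P.dp e).baseChange ℂ

/-- The differential at `e` of the action of `h`. -/
def dR (h : H) (e : E) : Tan EE e →ₗ[ℝ] (Tan EE (P.act e h) : Type _) :=
  (mfderiv 𝓘(ℝ, EE) 𝓘(ℝ, EE) (fun e' => P.act e' h) e).toLinearMap

/-- The complexified differential of the action of `h`. -/
def cdR (h : H) (e : E) : CTan EE e →ₗ[ℂ] CTan EE (P.act e h) := (P.dR h e).baseChange ℂ

/-- The differential at `h` of the orbit map `h ↦ e h`. -/
def dOrb (e : E) (h : H) : EH →ₗ[ℝ] (Tan EE (P.act e h) : Type _) :=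
  (mfderiv 𝓘(ℝ, EH) 𝓘(ℝ, EE) (fun h' => P.act e h') h).toLinearMap

/-- The vertical tangent space, the kernel of `dp`. -/
def vert (e : E) : Submodule ℝ (Tan EE e) := LinearMap.ker (P.dp e)

/-- For an `H`-invariant complex distribution `T` on `E`, the fiber over `x` of the complex vector
bundle `T/H` on `X`. A point of `T/H` over `x` is an `H`-orbit in the restriction of `T` to
`p⁻¹(x)`, that is, an `H`-invariant section of `T` along `p⁻¹(x)`. -/
def quot (T : ∀ e : E, Submodule ℂ (CTan EE e)) (x : X) :
    Submodule ℂ (∀ e : {e : E // P.p e = x}, CTan EE e.1) where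
  carrier := {s | (∀ e, s e ∈ T e.1) ∧
    ∀ (e : {e : E // P.p e = x}) (h : H),
      s ⟨P.act e.1 h, (P.p_act e.1 h).trans e.2⟩ = P.cdR h e.1 (s e)}
  add_mem' := by
    rintro a b ⟨ha, ha'⟩ ⟨hb, hb'⟩
    refine ⟨fun e => (T e.1).add_mem (ha e) (hb e), fun e h => ?_⟩
    simp only [Pi.add_apply, map_add, ha', hb']
  zero_mem' := ⟨fun e => (T e.1).zero_mem, fun e h => by simp⟩
  smul_mem' := by
    rintro c a ⟨ha, ha'⟩
    refine ⟨fun e => (T e.1).smul_mem c (ha e), fun e h => ?_⟩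
    simp only [Pi.smul_apply, map_smul, ha']

/-- The `H`-invariant complex vector field on `E` given by a section of `T/H`. -/
def field {T : ∀ e : E, Submodule ℂ (CTan EE e)} (s : ∀ x : X, P.quot T x) (e : E) : CTan EE e :=
  (s (P.p e)).1 ⟨e, rfl⟩

variable [IsManifold 𝓘(ℝ, EE) ∞ E]

/-- A partial connection on the bundle `P` in the direction of a real distribution `S` of rank `r`
on the base. -/
structure IsPartialConnection (S : ∀ x : X, Submodule ℝ (Tan EX x)) (r : ℕ)
    (T : ∀ e : E, Submodule ℝ (Tan EE e)) : Prop where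
  isDistribution : IsDistribution T r
  invariant : ∀ (e : E) (h : H), (T e).map (P.dR h e) = T (P.act e h)
  map_eq : ∀ e, (T e).map (P.dp e) = S (P.p e)
  injective : ∀ e, ∀ v ∈ T e, P.dp e v = 0 → v = 0

/-- A partial connection in the direction of a complex distribution. -/
structure IsCPartialConnection (S : ∀ x : X, Submodule ℂ (CTan EX x)) (r : ℕ)
    (T : ∀ e : E, Submodule ℂ (CTan EE e)) : Prop where
  isCDistribution : IsCDistribution T r
  invariant : ∀ (e : E) (h : H), (T e).map (P.cdR h e) = T (P.act e h)
  map_eq : ∀ e, (T e).map (P.cdp e) = S (P.p e)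
  injective : ∀ e, ∀ v ∈ T e, P.cdp e v = 0 → v = 0

/-- A usual `C^∞` connection on the principal bundle: a partial connection in the direction of the
whole tangent bundle. -/
def IsConnection (T : ∀ e : E, Submodule ℝ (Tan EE e)) : Prop :=
  P.IsPartialConnection (fun _ => ⊤) (Module.finrank ℝ EX) T

/-- `K^{0,1} = {v + √-1 J(v)}` for an endomorphism `J` of the vertical bundle. -/
def K01 (J : ∀ e : E, P.vert e →ₗ[ℝ] P.vert e) (e : E) : Submodule ℂ (CTan EE e) :=
  Submodule.span ℂ {z | ∃ k : P.vert e, z = cvec k.1 (J e k).1}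

/-- `K^{1,0} = {v - √-1 J(v)}` for an endomorphism `J` of the vertical bundle. -/
def K10 (J : ∀ e : E, P.vert e →ₗ[ℝ] P.vert e) (e : E) : Submodule ℂ (CTan EE e) :=
  Submodule.span ℂ {z | ∃ k : P.vert e, z = cvec k.1 (-(J e k).1)}

/-- `J` makes the fibers of the bundle complex manifolds on which the complex Lie group `H` acts
holomorphically. -/
structure IsFiberComplexStructure (J : ∀ e : E, P.vert e →ₗ[ℝ] P.vert e) : Prop where
  smooth : ∀ U : Set E, IsOpen U → ∀ V : ∀ e : E, P.vert e,
    SmoothFieldOn (fun e => (V e : Tan EE e)) U → SmoothFieldOn (fun e => (J e (V e) : Tan EE e)) U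
  sq : ∀ e k, J e (J e k) = -k
  /-- Integrability of the almost complex structure on each fiber. -/
  integrable : IsIntegrable (P.K01 J)
  /-- The map `(e, h) ↦ e h` is holomorphic in the variable `e` in a fiber. -/
  holomorphic_left : ∀ (e : E) (h : H) (k : P.vert e) (k' : P.vert (P.act e h)),
    (k' : Tan EE (P.act e h)) = P.dR h e k →
      (J (P.act e h) k' : Tan EE (P.act e h)) = P.dR h e (J e k)
  /-- The map `(e, h) ↦ e h` is holomorphic in the variable `h`. -/
  holomorphic_right : ∀ (e : E) (h : H) (a : EH) (k : P.vert (P.act e h)),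
    (k : Tan EE (P.act e h)) = P.dOrb e h a →
      (J (P.act e h) k : Tan EE (P.act e h)) = P.dOrb e h (Complex.I • a)

end SmoothPrincipalBundle

variable [FiniteDimensional ℝ EX] [IsManifold 𝓘(ℝ, EX) ∞ X] [IsManifold 𝓘(ℝ, EE) ∞ E]

variable (EH H EE E) in
/-- A complex principal `H`-bundle on a Sasakian manifold. -/
structure ComplexPrincipalBundle (S : SasakianStructure EX X) extends
    SmoothPrincipalBundle EX X EH H EE E where
  /-- The complex structure on the fibers. -/
  J : ∀ e : E, toSmoothPrincipalBundle.vert e →ₗ[ℝ] toSmoothPrincipalBundle.vert e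
  isFiberComplex : toSmoothPrincipalBundle.IsFiberComplexStructure J
  /-- The partial connection along the Reeb vector field. -/
  xiT : ∀ e : E, Submodule ℝ (Tan EE e)
  isPartialConnection_xiT :
    toSmoothPrincipalBundle.IsPartialConnection (fun x => Submodule.span ℝ {S.xi x}) 1 xiT
  /-- The Lie derivative of `J` along the lift `ξ̂` of `ξ` vanishes: `[ξ̂, J V] = J [ξ̂, V]` for
  vertical vector fields `V`. -/
  lie_J : ∀ xiHat : ∀ e : E, Tan EE e,
    (∀ e, xiHat e ∈ xiT e ∧ toSmoothPrincipalBundle.dp e (xiHat e) = S.xi (p e)) →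
    ∀ U : Set E, IsOpen U → ∀ V : ∀ e : E, toSmoothPrincipalBundle.vert e,
      SmoothFieldOn (fun e => (V e : Tan EE e)) U → ∀ e ∈ U,
      ∀ k : toSmoothPrincipalBundle.vert e,
        (k : Tan EE e) = VectorField.mlieBracket 𝓘(ℝ, EE) xiHat (fun e' => (V e' : Tan EE e')) e →
        VectorField.mlieBracket 𝓘(ℝ, EE) xiHat (fun e' => (J e' (V e') : Tan EE e')) e
          = (J e k : Tan EE e)

variable (EH H EE E) in
/-- A holomorphic principal `H`-bundle on a Sasakian manifold of dimension `2 m + 1`. -/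
structure HolomorphicPrincipalBundle (m : ℕ) (S : SasakianStructure EX X) extends
    ComplexPrincipalBundle EH H EE E S where
  /-- The holomorphic structure. -/
  FT : ∀ e : E, Submodule ℂ (CTan EE e)
  isCPartialConnection_FT : toSmoothPrincipalBundle.IsCPartialConnection S.calF01 (m + 1) FT
  integrable_FT : IsIntegrable FT
  xiT_le : ∀ e, cplxSub (xiT e) ≤ FT e
  integrable_FT_K01 : IsIntegrable (fun e => FT e ⊔ toSmoothPrincipalBundle.K01 J e)

namespace HolomorphicPrincipalBundle

variable {m : ℕ} {S : SasakianStructure EX X} (P : HolomorphicPrincipalBundle EH H EE E m S)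

/-- The part of `FT` that corresponds to `F^{0,1}` under `dp ⊗ ℂ`. -/
def FF (e : E) : Submodule ℂ (CTan EE e) := P.FT e ⊓ (S.F01 (P.p e)).comap (P.cdp e)

/-- The distribution `K^{1,0} ⊕ conj(FF)` on the total space. -/
def TT (e : E) : Submodule ℂ (CTan EE e) := P.K10 P.J e ⊔ conjSub (P.FF e)

/-- The fiber over `x` of the adjoint bundle `ad(E) = K^{1,0}/H`. -/
abbrev Ad (x : X) : Submodule ℂ (∀ e : {e : E // P.p e = x}, CTan EE e.1) :=
  P.quot (P.K10 P.J) x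

/-- The fiber over `x` of the Atiyah bundle `At(E) = TT/H`. -/
abbrev At (x : X) : Submodule ℂ (∀ e : {e : E // P.p e = x}, CTan EE e.1) := P.quot P.TT x

/-- The holomorphic structure of the Atiyah bundle: on `U`, the section `t` is the derivative
`∂̄_v s` of the section `s` along the section `v` of `𝓕^{0,1}`, that is, the `TT`-component of
`[ṽ, s]` with respect to `TE ⊗ ℂ = TT ⊕ (FT ⊕ K^{0,1})`, where `ṽ` is the lift of `v`
to `FT`. -/
def IsDbarAt (U : Set X) (v : ∀ x : X, CTan EX x) (s t : ∀ x : X, P.At x) : Prop :=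
  ∀ vT : ∀ e : E, CTan EE e, CSmoothFieldOn vT (P.p ⁻¹' U) →
    (∀ e ∈ P.p ⁻¹' U, vT e ∈ P.FT e ∧ P.cdp e (vT e) = v (P.p e)) →
    ∀ e ∈ P.p ⁻¹' U, cBracket vT (P.field s) e - P.field t e ∈ P.FT e ⊔ P.K01 P.J e

/-- A holomorphic connection: a homomorphism `D : F^{1,0} → At(E)` of holomorphic vector bundles
that splits the projection `d'p : At(E) → F^{1,0}` induced by `dp ⊗ ℂ`. -/
structure HolomorphicConnection where
  /-- The fiberwise complex linear map. -/
  D : ∀ x : X, S.F10 x →ₗ[ℂ] P.At x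
  smooth : ∀ U : Set X, IsOpen U → ∀ w : ∀ x : X, S.F10 x,
    CSmoothFieldOn (fun x => (w x : CTan EX x)) U →
      CSmoothFieldOn (P.field fun x => D x (w x)) (P.p ⁻¹' U)
  /-- `D` intertwines the partial connections along `𝓕^{0,1}`. -/
  holomorphic : ∀ U : Set X, IsOpen U → ∀ v : ∀ x : X, CTan EX x, CSmoothFieldOn v U →
    (∀ x ∈ U, v x ∈ S.calF01 x) → ∀ w u : ∀ x : X, S.F10 x,
    CSmoothFieldOn (fun x => (w x : CTan EX x)) U → S.IsDbarF10 U v w u →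
      P.IsDbarAt U v (fun x => D x (w x)) (fun x => D x (u x))
  split : ∀ (e : E) (v : S.F10 (P.p e)),
    P.cdp e ((D (P.p e) v).1 ⟨e, rfl⟩) = (v : CTan EX (P.p e))

/-- `T` is the usual connection given by `D` and the partial connection along `ξ`: it contains
the latter, and its complexification contains the lifts `D(v)` of the vectors `v` of `F^{1,0}`. -/
structure IsInducedConnection (D : P.HolomorphicConnection)
    (T : ∀ e : E, Submodule ℝ (Tan EE e)) : Prop where
  isConnection : P.IsConnection T
  xiT_le : ∀ e, P.xiT e ≤ T e
  D_mem : ∀ (e : E) (v : S.F10 (P.p e)), (D.D (P.p e) v).1 ⟨e, rfl⟩ ∈ cplxSub (T e)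

/-- The isomorphism `k ↦ (k - √-1 J(k)) / 2` from the vertical bundle, with the complex
structure `J`, to `K^{1,0}`. -/
def toK10 (e : E) (k : P.vert e) : CTan EE e := (1 / 2 : ℂ) • cvec k.1 (-(P.J e k).1)

/-- `Om` is the curvature of the connection `T`: for horizontal lifts `uT`, `vT` of vector fields
`u`, `v` on an open subset of the base, `Om(u, v)` is minus the vertical component of `[uT, vT]`,
regarded as an element of `ad(E) = K^{1,0}/H`. As `ad(E)` is a complex bundle, `Om` is extended
complex bilinearly to `TX ⊗ ℂ`. -/
def IsCurvature (T : ∀ e : E, Submodule ℝ (Tan EE e))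
    (Om : ∀ x : X, CTan EX x [⋀^Fin 2]→ₗ[ℂ] P.Ad x) : Prop :=
  ∀ U : Set X, IsOpen U → ∀ u v : ∀ x : X, Tan EX x, SmoothFieldOn u U → SmoothFieldOn v U →
    ∀ uT vT : ∀ e : E, Tan EE e,
    SmoothFieldOn uT (P.p ⁻¹' U) → SmoothFieldOn vT (P.p ⁻¹' U) →
    (∀ e ∈ P.p ⁻¹' U, uT e ∈ T e ∧ P.dp e (uT e) = u (P.p e)) →
    (∀ e ∈ P.p ⁻¹' U, vT e ∈ T e ∧ P.dp e (vT e) = v (P.p e)) →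
    ∀ e ∈ P.p ⁻¹' U, ∀ k : P.vert e,
      VectorField.mlieBracket 𝓘(ℝ, EE) uT vT e + (k : Tan EE e) ∈ T e →
      (Om (P.p e) ![cvec (u (P.p e)) 0, cvec (v (P.p e)) 0]).1 ⟨e, rfl⟩ = P.toK10 e k

/-- `Om` is a `C^∞` section of `ad(E) ⊗ Λ²(TX ⊗ ℂ)^*`. -/
def IsSmoothForm (Om : ∀ x : X, CTan EX x [⋀^Fin 2]→ₗ[ℂ] P.Ad x) : Prop :=
  ∀ U : Set X, IsOpen U → ∀ v w : ∀ x : X, CTan EX x, CSmoothFieldOn v U → CSmoothFieldOn w U →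
    CSmoothFieldOn (P.field fun x => Om x ![v x, w x]) (P.p ⁻¹' U)

/-- `Om` takes values in `ad(E) ⊗ Λ²(F^{1,0})^*`. Here `(F^{1,0})^*` is the subbundle of
`(TX ⊗ ℂ)^*` of the forms that vanish on `𝓕^{0,1} = F^{0,1} ⊕ ℂ ξ`. -/
def IsTwoZero (Om : ∀ x : X, CTan EX x [⋀^Fin 2]→ₗ[ℂ] P.Ad x) : Prop :=
  ∀ (x : X) (v w : CTan EX x), v ∈ S.calF01 x → Om x ![v, w] = 0

end HolomorphicPrincipalBundle

end Bundles

end Sasaki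

end

/-! Write a tangent vector of `X` as `v = v_F + η(v) ξ`, with `η = g(ξ, ·)`. The Sasakian identities
give `Φ ξ = 0` and `Φ² = -1` on `F`, so `v_F - √-1 Φ v` lies in `F^{1,0}`. The real part of its
image under `D`, plus `η(v)` times the lift of `ξ`, is the only possible horizontal lift of `v`
(`hor`, `eq_horSub`). Complex linearity of `D` then says that the complexified lift `horC` restricts
to `D` on `F^{1,0}` (`D_eq_horC`).

For the type of the curvature, let `prK10` take the `K^{1,0}`-component of the vertical part of a
complex vector. The complexified curvature is minus `prK10` of the bracket of horizontal lifts
(`prK10_cBracket`). On `F^{0,1}` the horizontal lift is the conjugate of `D`. Since `D` takes values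
in `K^{1,0}` plus the conjugate of `FF`, a section `v` of `𝓕^{0,1}` has horizontal lift `ṽ + κ`,
with `ṽ` its lift to `FT` and `κ` in `K^{0,1}` (`horC_cdp_of_mem_FT`). Consequently `prK10` vanishes
on `FT ⊕ K^{0,1}` (`prK10_of_mem`).

If both arguments lie in `𝓕^{0,1}`, integrability of `FT ⊕ K^{0,1}` gives zero. If the second one is
a section `w` of `F^{1,0}`, then `[ṽ, D w]` agrees with the horizontal field `D(∂̄_v w)` modulo `FT
⊕ K^{0,1}`, because `D` is holomorphic, and `[κ, D w]` stays in `K^{0,1}`. This last fact is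
`mlieBracket_vert`: an invariant field commutes with the fundamental fields, so bracketing with it
only differentiates the coefficients of a vertical field in a frame of fundamental fields, and on
these `J` is multiplication by `√-1` in the Lie algebra. -/

noncomputable section

namespace Sasaki

/-! ### Real and imaginary parts in a complexified vector space. -/

section Complexification

variable {V W : Type*} [AddCommGroup V] [Module ℝ V] [AddCommGroup W] [Module ℝ W]

@[simp] theorem cre_tmul (c : ℂ) (v : V) : cre (c ⊗ₜ[ℝ] v) = c.re • v := by simp [cre]

@[simp] theorem cim_tmul (c : ℂ) (v : V) : cim (c ⊗ₜ[ℝ] v) = c.im • v := by simp [cim]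

@[simp] theorem cre_cvec (a b : V) : cre (cvec a b) = a := by simp [cvec]

@[simp] theorem cim_cvec (a b : V) : cim (cvec a b) = b := by simp [cvec]

theorem cvec_cre_cim (z : ℂ ⊗[ℝ] V) : cvec (cre z) (cim z) = z := by
  induction z with
  | zero => simp [cvec]
  | add x y hx hy =>
    conv_rhs => rw [← hx, ← hy]
    simp only [cvec, map_add, TensorProduct.tmul_add]
    abel
  | tmul c v =>
    rw [cre_tmul, cim_tmul, cvec, TensorProduct.tmul_smul, TensorProduct.tmul_smul,
      TensorProduct.smul_tmul', TensorProduct.smul_tmul', ← TensorProduct.add_tmul]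
    congr 1
    simp

/-- Every later identity between complexified vectors is reduced by this to two real ones, which the
simp lemmas for `cre` and `cim` evaluate. -/
theorem ctensor_ext {z w : ℂ ⊗[ℝ] V} (h₁ : cre z = cre w) (h₂ : cim z = cim w) : z = w := by
  rw [← cvec_cre_cim z, ← cvec_cre_cim w, h₁, h₂]

theorem cvec_add (a b c d : V) : cvec a b + cvec c d = cvec (a + c) (b + d) :=
  ctensor_ext (by simp) (by simp)

@[simp] theorem cvec_zero : cvec (0 : V) 0 = 0 := ctensor_ext (by simp) (by simp)

@[simp] theorem cre_smul (c : ℂ) (z : ℂ ⊗[ℝ] V) : cre (c • z) = c.re • cre z - c.im • cim z := by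
  induction z with
  | zero => simp
  | add x y hx hy => simp only [smul_add, map_add, hx, hy]; abel
  | tmul a v => simp [TensorProduct.smul_tmul', sub_smul, mul_smul]

@[simp] theorem cim_smul (c : ℂ) (z : ℂ ⊗[ℝ] V) : cim (c • z) = c.re • cim z + c.im • cre z := by
  induction z with
  | zero => simp
  | add x y hx hy => simp only [smul_add, map_add, hx, hy]; abel
  | tmul a v => simp [TensorProduct.smul_tmul', add_smul, mul_smul]

@[simp] theorem cre_cconj (z : ℂ ⊗[ℝ] V) : cre (cconj z) = cre z := by
  induction z with
  | zero => simp
  | add x y hx hy => simp only [map_add, hx, hy]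
  | tmul a v => simp [cconj]

@[simp] theorem cim_cconj (z : ℂ ⊗[ℝ] V) : cim (cconj z) = -cim z := by
  induction z with
  | zero => simp
  | add x y hx hy => simp only [map_add, hx, hy]; abel
  | tmul a v => simp [cconj]

@[simp] theorem cre_baseChange (f : V →ₗ[ℝ] W) (z : ℂ ⊗[ℝ] V) :
    cre (f.baseChange ℂ z) = f (cre z) := by
  induction z with
  | zero => simp
  | add x y hx hy => simp only [map_add, hx, hy]
  | tmul a v => simp

@[simp] theorem cim_baseChange (f : V →ₗ[ℝ] W) (z : ℂ ⊗[ℝ] V) :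
    cim (f.baseChange ℂ z) = f (cim z) := by
  induction z with
  | zero => simp
  | add x y hx hy => simp only [map_add, hx, hy]
  | tmul a v => simp

theorem mem_cplxSub {S : Submodule ℝ V} {z : ℂ ⊗[ℝ] V} :
    z ∈ cplxSub S ↔ cre z ∈ S ∧ cim z ∈ S := by
  constructor
  · intro h
    rw [cplxSub, Submodule.baseChange_eq_span] at h
    induction h using Submodule.span_induction with
    | mem x hx =>
      obtain ⟨v, hv, rfl⟩ := hx
      simpa using hv
    | zero => simp
    | add x y _ _ hx hy =>
      simpa using ⟨S.add_mem hx.1 hy.1, S.add_mem hx.2 hy.2⟩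
    | smul c x _ hx =>
      simp only [cre_smul, cim_smul]
      exact ⟨S.sub_mem (S.smul_mem _ hx.1) (S.smul_mem _ hx.2),
        S.add_mem (S.smul_mem _ hx.2) (S.smul_mem _ hx.1)⟩
  · rintro ⟨h₁, h₂⟩
    rw [← cvec_cre_cim z]
    exact add_mem (Submodule.tmul_mem_baseChange_of_mem _ h₁)
      (Submodule.tmul_mem_baseChange_of_mem _ h₂)

/-- The span of the vectors `v + √-1 j(v)`, for an endomorphism `j` with square `-1` of a subspace,
consists of these vectors. -/
theorem mem_span_cvec {S : Submodule ℝ V} (j : S →ₗ[ℝ] S) (hj : ∀ v, j (j v) = -v)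
    {z : ℂ ⊗[ℝ] V} :
    z ∈ Submodule.span ℂ {z | ∃ v : S, z = cvec (v : V) (j v)} ↔
      ∃ v : S, z = cvec (v : V) (j v) := by
  refine ⟨fun h => ?_, fun h => Submodule.subset_span h⟩
  induction h using Submodule.span_induction with
  | mem x hx => exact hx
  | zero => exact ⟨0, by simp⟩
  | add x y _ _ hx hy =>
    obtain ⟨v, rfl⟩ := hx
    obtain ⟨w, rfl⟩ := hy
    exact ⟨v + w, by simp [cvec_add]⟩
  | smul c x _ hx =>
    obtain ⟨v, rfl⟩ := hx
    -- Multiplication by `√-1` turns the vector given by `v` into the one given by `-j v`.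
    refine ⟨c.re • v - c.im • j v, ctensor_ext (by simp) ?_⟩
    simp [hj]

end Complexification

/-- The complex bilinear alternating extension of a real alternating bilinear map with values in a
complex vector space. -/
def complexExtension {V A : Type*} [AddCommGroup V] [Module ℝ V] [AddCommGroup A] [Module ℂ A]
    (B : V → V → A) (hadd : ∀ a b c, B (a + b) c = B a c + B b c)
    (hsmul : ∀ (r : ℝ) a c, B (r • a) c = (r : ℂ) • B a c)
    (hswap : ∀ a b, B a b = -B b a) : (ℂ ⊗[ℝ] V) [⋀^Fin 2]→ₗ[ℂ] A :=
  let Q : ℂ ⊗[ℝ] V → ℂ ⊗[ℝ] V → A := fun z w =>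
    (B (cre z) (cre w) - B (cim z) (cim w)) + Complex.I • (B (cre z) (cim w) + B (cim z) (cre w))
  have hsub : ∀ a b c, B (a - b) c = B a c - B b c := fun a b c => by
    rw [eq_sub_iff_add_eq, ← hadd, sub_add_cancel]
  have qswap : ∀ z w, Q z w = -Q w z := fun z w => by
    simp only [Q]
    rw [hswap (cre z) (cre w), hswap (cim z) (cim w), hswap (cre z) (cim w),
      hswap (cim z) (cre w)]
    module
  have qadd : ∀ z w t, Q (z + w) t = Q z t + Q w t := fun z w t => by
    simp only [Q, map_add, hadd]
    module
  have qsmul : ∀ (c : ℂ) z t, Q (c • z) t = c • Q z t := fun c z t => by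
    simp only [Q, cre_smul, cim_smul, hadd, hsub, hsmul]
    conv_rhs => rw [← Complex.re_add_im c]
    match_scalars <;> ring_nf <;> simp [Complex.I_sq]
  { toFun := fun m => Q (m 0) (m 1)
    map_update_add' := by
      intro inst m i x y
      obtain rfl : inst = instDecidableEqFin 2 := Subsingleton.elim _ _
      fin_cases i
      · simpa using qadd _ _ _
      -- Linearity in the second slot is carried over from the first by antisymmetry.
      · simp only [Fin.mk_one, ne_eq, zero_ne_one, not_false_eq_true, Function.update_of_ne,
          Function.update_self]
        rw [qswap, qadd, qswap x, qswap y]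
        abel
    map_update_smul' := by
      intro inst m i c x
      obtain rfl : inst = instDecidableEqFin 2 := Subsingleton.elim _ _
      fin_cases i
      · simpa using qsmul _ _ _
      · simp only [Fin.mk_one, ne_eq, zero_ne_one, not_false_eq_true, Function.update_of_ne,
          Function.update_self]
        rw [qswap, qsmul, qswap x, smul_neg, neg_neg]
    map_eq_zero_of_eq' := by
      intro m i j hij hne
      have h0 : m 0 = m 1 := by
        fin_cases i <;> fin_cases j <;>
          first | exact absurd rfl hne | exact hij | exact hij.symm
      have h1 : ∀ a, B a a = 0 := fun a => by
        have h2 : (2 : ℂ) • B a a = 0 := by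
          rw [two_smul]
          exact eq_neg_iff_add_eq_zero.1 (hswap a a)
        exact (smul_eq_zero.1 h2).resolve_left two_ne_zero
      simp only [Q, h0, h1]
      rw [hswap (cim (m 1))]
      module }

/-! ### Smoothness of vector fields tested in one fixed chart. -/

section Calculus

variable {EM : Type*} [NormedAddCommGroup EM] [NormedSpace ℝ EM]
  {M : Type*} [TopologicalSpace M] [ChartedSpace EM M] [IsManifold 𝓘(ℝ, EM) ∞ M]
  {G : Type*} [NormedAddCommGroup G] [NormedSpace ℝ G]

/-- The vector field `V` is `C^∞` at `x`. -/
def SmoothFieldAt (V : ∀ x : M, Tan EM x) (x : M) : Prop :=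
  ContMDiffAt 𝓘(ℝ, EM) 𝓘(ℝ, EM).tangent ∞
    (fun x => (⟨x, V x⟩ : TangentBundle 𝓘(ℝ, EM) M)) x

/-- The vector field `V` is differentiable at `x`. -/
def DiffFieldAt (V : ∀ x : M, Tan EM x) (x : M) : Prop :=
  MDifferentiableAt 𝓘(ℝ, EM) 𝓘(ℝ, EM).tangent
    (fun x => (⟨x, V x⟩ : TangentBundle 𝓘(ℝ, EM) M)) x

theorem SmoothFieldAt.diff {V : ∀ x : M, Tan EM x} {x : M} (h : SmoothFieldAt V x) :
    DiffFieldAt V x := ContMDiffAt.mdifferentiableAt h (by simp)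

theorem SmoothFieldOn.at {V : ∀ x : M, Tan EM x} {U : Set M} (h : SmoothFieldOn V U)
    (hU : IsOpen U) {x : M} (hx : x ∈ U) : SmoothFieldAt V x :=
  ContMDiffOn.contMDiffAt h (hU.mem_nhds hx)

theorem smoothFieldOn_of_at {V : ∀ x : M, Tan EM x} {U : Set M}
    (h : ∀ x ∈ U, SmoothFieldAt V x) : SmoothFieldOn V U :=
  fun x hx => ContMDiffAt.contMDiffWithinAt (h x hx)

theorem trivializationAt_snd {x₀ x : M} (hx : x ∈ (chartAt EM x₀).source) (v : Tan EM x) :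
    (trivializationAt EM (TangentSpace 𝓘(ℝ, EM)) x₀ ⟨x, v⟩).2
      = mvfderiv 𝓘(ℝ, EM) (extChartAt 𝓘(ℝ, EM) x₀) x v := by
  have h := TangentBundle.continuousLinearMapAt_trivializationAt (I := 𝓘(ℝ, EM)) hx
  have hx' : x ∈ (trivializationAt EM (TangentSpace 𝓘(ℝ, EM) : M → Type _) x₀).baseSet := by
    simpa using hx
  have := congr($h v)
  rw [Bundle.Trivialization.continuousLinearMapAt_apply_of_mem ℝ _ hx'] at this
  exact this

/-- The trivialization of `TM` at `x₀` is the derivative of the chart at `x₀`. A smooth section thus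
becomes a smooth function into a fixed vector space, where coefficients can be solved for. -/
theorem smoothFieldAt_iff {V : ∀ x : M, Tan EM x} {x₀ : M} :
    SmoothFieldAt V x₀ ↔ ContMDiffAt 𝓘(ℝ, EM) 𝓘(ℝ, EM) ∞
      (fun y => mvfderiv 𝓘(ℝ, EM) (extChartAt 𝓘(ℝ, EM) x₀) y (V y)) x₀ := by
  have : (fun y => (trivializationAt EM (TangentSpace 𝓘(ℝ, EM)) x₀ ⟨y, V y⟩).2) =ᶠ[𝓝 x₀]
      fun y => mvfderiv 𝓘(ℝ, EM) (extChartAt 𝓘(ℝ, EM) x₀) y (V y) := by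
    filter_upwards [(chartAt EM x₀).open_source.mem_nhds (mem_chart_source EM x₀)] with y hy
    exact trivializationAt_snd hy _
  rw [← this.contMDiffAt_iff]
  exact Bundle.contMDiffAt_section x₀

theorem diffFieldAt_iff {V : ∀ x : M, Tan EM x} {x₀ : M} :
    DiffFieldAt V x₀ ↔ MDifferentiableAt 𝓘(ℝ, EM) 𝓘(ℝ, EM)
      (fun y => mvfderiv 𝓘(ℝ, EM) (extChartAt 𝓘(ℝ, EM) x₀) y (V y)) x₀ := by
  have : (fun y => (trivializationAt EM (TangentSpace 𝓘(ℝ, EM)) x₀ ⟨y, V y⟩).2) =ᶠ[𝓝 x₀]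
      fun y => mvfderiv 𝓘(ℝ, EM) (extChartAt 𝓘(ℝ, EM) x₀) y (V y) := by
    filter_upwards [(chartAt EM x₀).open_source.mem_nhds (mem_chart_source EM x₀)] with y hy
    exact trivializationAt_snd hy _
  rw [← this.mdifferentiableAt_iff]
  exact mdifferentiableAt_section ..

theorem mvfderiv_eq_fderiv_comp {f : M → G} {x₀ x : M} (hx : x ∈ (chartAt EM x₀).source)
    (hf : ContMDiffAt 𝓘(ℝ, EM) 𝓘(ℝ, G) ∞ f x) (v : Tan EM x) :
    mvfderiv 𝓘(ℝ, EM) f x v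
      = fderiv ℝ (f ∘ (extChartAt 𝓘(ℝ, EM) x₀).symm) (extChartAt 𝓘(ℝ, EM) x₀ x)
        (mvfderiv 𝓘(ℝ, EM) (extChartAt 𝓘(ℝ, EM) x₀) x v) := by
  have hxs : x ∈ (extChartAt 𝓘(ℝ, EM) x₀).source := by simpa using hx
  have h1 : MDifferentiableAt 𝓘(ℝ, EM) 𝓘(ℝ, EM) (extChartAt 𝓘(ℝ, EM) x₀) x :=
    mdifferentiableAt_extChartAt hx
  have h2 : MDifferentiableAt 𝓘(ℝ, EM) 𝓘(ℝ, G) (f ∘ (extChartAt 𝓘(ℝ, EM) x₀).symm)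
      (extChartAt 𝓘(ℝ, EM) x₀ x) := by
    refine MDifferentiableAt.comp (I' := 𝓘(ℝ, EM)) _ ?_ ?_
    · rw [(extChartAt 𝓘(ℝ, EM) x₀).left_inv hxs]
      exact hf.mdifferentiableAt (by simp)
    · have := (contMDiffOn_extChartAt_symm (I := 𝓘(ℝ, EM)) (n := ∞) x₀).contMDiffAt
        ((isOpen_extChartAt_target x₀).mem_nhds ((extChartAt 𝓘(ℝ, EM) x₀).map_source hxs))
      exact this.mdifferentiableAt (by simp)
  have h3 : f =ᶠ[𝓝 x] (f ∘ (extChartAt 𝓘(ℝ, EM) x₀).symm) ∘ extChartAt 𝓘(ℝ, EM) x₀ := by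
    filter_upwards [(isOpen_extChartAt_source x₀).mem_nhds hxs] with y hy
    simp only [Function.comp_apply]
    rw [(extChartAt 𝓘(ℝ, EM) x₀).left_inv hy]
  have h4 := h3.mfderiv_eq (I := 𝓘(ℝ, EM)) (I' := 𝓘(ℝ, G))
  rw [mfderiv_comp x h2 h1, mfderiv_eq_fderiv] at h4
  exact congrArg (fun L : EM →L[ℝ] G => L v) h4

theorem contDiffAt_comp_extChartAt_symm {f : M → G} {x : M}
    (hf : ContMDiffAt 𝓘(ℝ, EM) 𝓘(ℝ, G) ∞ f x) :
    ContDiffAt ℝ ∞ (f ∘ (extChartAt 𝓘(ℝ, EM) x).symm) (extChartAt 𝓘(ℝ, EM) x x) := by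
  refine ContMDiffAt.contDiffAt (ContMDiffAt.comp _ (I' := 𝓘(ℝ, EM)) ?_ ?_)
  · simpa using hf
  · exact (contMDiffOn_extChartAt_symm (I := 𝓘(ℝ, EM)) (n := ∞) x).contMDiffAt
      ((isOpen_extChartAt_target x).mem_nhds (mem_extChartAt_target x))

/-- In the chart at `x` the directional derivative is the `fderiv` of a smooth function applied to
the coordinate expression of `V`; both factors are smooth. -/
theorem SmoothFieldAt.mvfderiv_apply {V : ∀ x : M, Tan EM x} {x : M} (hV : SmoothFieldAt V x)
    {f : M → G} (hf : ∀ᶠ y in 𝓝 x, ContMDiffAt 𝓘(ℝ, EM) 𝓘(ℝ, G) ∞ f y) :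
    ContMDiffAt 𝓘(ℝ, EM) 𝓘(ℝ, G) ∞ (fun y => mvfderiv 𝓘(ℝ, EM) f y (V y)) x := by
  have h1 : ContMDiffAt 𝓘(ℝ, EM) 𝓘(ℝ, G) ∞
      (fun y => fderiv ℝ (f ∘ (extChartAt 𝓘(ℝ, EM) x).symm) (extChartAt 𝓘(ℝ, EM) x y)
        (mvfderiv 𝓘(ℝ, EM) (extChartAt 𝓘(ℝ, EM) x) y (V y))) x := by
    refine ContMDiffAt.clm_apply ?_ (smoothFieldAt_iff.1 hV)
    refine ContMDiffAt.comp (I' := 𝓘(ℝ, EM)) x ?_ contMDiffAt_extChartAt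
    exact ((contDiffAt_comp_extChartAt_symm hf.self_of_nhds).fderiv_right
      (m := ∞) (by simp)).contMDiffAt
  refine h1.congr_of_eventuallyEq ?_
  filter_upwards [hf, (chartAt EM x).open_source.mem_nhds (mem_chart_source EM x)] with y hy hy'
  exact mvfderiv_eq_fderiv_comp hy' hy _

theorem injective_mvfderiv_extChartAt (x : M) :
    Function.Injective (mvfderiv 𝓘(ℝ, EM) (extChartAt 𝓘(ℝ, EM) x) x) := by
  obtain ⟨e, he⟩ := isInvertible_mfderiv_extChartAt (I := 𝓘(ℝ, EM)) (mem_extChartAt_source x)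
  have : Function.Injective (mfderiv 𝓘(ℝ, EM) 𝓘(ℝ, EM) (extChartAt 𝓘(ℝ, EM) x) x) := by
    rw [← he]
    exact e.injective
  exact this

/-- The coefficients of a smooth vector function with respect to smooth linearly independent vector
functions are smooth. -/
theorem contMDiffAt_coeff [FiniteDimensional ℝ G] {ι : Type*} [Fintype ι] [DecidableEq ι]
    {w : ι → M → G} {v : M → G} {c : ι → M → ℝ} {x : M}
    (hw : ∀ i, ContMDiffAt 𝓘(ℝ, EM) 𝓘(ℝ, G) ∞ (w i) x)
    (hv : ContMDiffAt 𝓘(ℝ, EM) 𝓘(ℝ, G) ∞ v x)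
    (hli : LinearIndependent ℝ fun i => w i x)
    (hc : ∀ᶠ y in 𝓝 x, v y = ∑ i, c i y • w i y) (i : ι) :
    ContMDiffAt 𝓘(ℝ, EM) 𝓘(ℝ, ℝ) ∞ (c i) x := by
  obtain ⟨L₀, hL₀⟩ := (Fintype.linearCombination ℝ fun i => w i x).exists_leftInverse_of_injective
    (LinearMap.ker_eq_bot.2 (linearIndependent_iff_injective_fintypeLinearCombination.1 hli))
  let L : G →L[ℝ] (ι → ℝ) := L₀.toContinuousLinearMap
  -- `T y` is the family `w y` seen through a left inverse `L` of the family at `x`. It is the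
  -- identity at `x`, hence invertible nearby, and `c y = (T y)⁻¹ (L (v y))`. Inversion is smooth,
  -- so nothing need be assumed about `c`.
  let T : M → ((ι → ℝ) →L[ℝ] (ι → ℝ)) := fun y =>
    ∑ j, (ContinuousLinearMap.proj j : (ι → ℝ) →L[ℝ] ℝ).smulRight (L (w j y))
  have hTapp : ∀ y a, T y a = L (∑ j, a j • w j y) := fun y a => by
    simp [T, map_sum]
  have hT : ContMDiffAt 𝓘(ℝ, EM) 𝓘(ℝ, (ι → ℝ) →L[ℝ] (ι → ℝ)) ∞ T x := by
    refine ContMDiffAt.sum fun j _ => ?_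
    exact (((ContinuousLinearMap.smulRightL ℝ (ι → ℝ) (ι → ℝ)
      (ContinuousLinearMap.proj j)).comp L).contMDiff.contMDiffAt).comp x (hw j)
  have hTx : T x = 1 := by
    ext a
    have := LinearMap.congr_fun hL₀ a
    rw [hTapp]
    exact congrFun this _
  have hinv : ContMDiffAt 𝓘(ℝ, EM) 𝓘(ℝ, (ι → ℝ) →L[ℝ] (ι → ℝ)) ∞
      (fun y => Ring.inverse (T y)) x := by
    refine ContMDiffAt.comp (I' := 𝓘(ℝ, (ι → ℝ) →L[ℝ] (ι → ℝ))) x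
      (g := Ring.inverse) (ContDiffAt.contMDiffAt ?_) hT
    rw [hTx]
    exact contDiffAt_ringInverse ℝ (1 : ((ι → ℝ) →L[ℝ] (ι → ℝ))ˣ)
  have hfin : ContMDiffAt 𝓘(ℝ, EM) 𝓘(ℝ, ι → ℝ) ∞
      (fun y => Ring.inverse (T y) (L (v y))) x :=
    hinv.clm_apply (L.contMDiff.contMDiffAt.comp x hv)
  have hunit : ∀ᶠ y in 𝓝 x, IsUnit (T y) :=
    hT.continuousAt (Units.isOpen.mem_nhds (by rw [Set.mem_ofPred_eq, hTx]; exact isUnit_one))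
  have heq : (fun y => Ring.inverse (T y) (L (v y))) =ᶠ[𝓝 x] fun y j => c j y := by
    filter_upwards [hc, hunit] with y hy hu
    rw [hy, ← hTapp y fun j => c j y]
    exact congr($(Ring.inverse_mul_cancel _ hu) fun j => c j y)
  exact contMDiffAt_pi_space.1 (hfin.congr_of_eventuallyEq heq.symm) i

end Calculus

/-! ### Invariant fields commute with infinitesimal generators. -/

section Commutator

open VectorField

/-- On the product, `(Z, 0)` and the constant field `(0, a)` commute. Symmetry of the second
derivative of `f` turns this into the equality of the derivative of `f_*(Z, 0) = Z ∘ f` along `(0,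
a)` and that of `f_*(0, a)` along `(Z, 0)`. At `(y₀, t₀)` these are the two terms of `[W, Z]`. The
field `W` is known only on the slice `t = t₀`, which suffices because `(Z, 0)` is tangent to that
slice. -/
theorem lieBracket_eq_zero_of_invariant {E₁ K : Type*} [NormedAddCommGroup E₁] [NormedSpace ℝ E₁]
    [NormedAddCommGroup K] [NormedSpace ℝ K] {f : E₁ × K → E₁} {y₀ : E₁} {t₀ a : K}
    {Z W : E₁ → E₁} (hf : ContDiffAt ℝ ∞ f (y₀, t₀)) (hf0 : f (y₀, t₀) = y₀)
    (hZd : DifferentiableAt ℝ Z y₀)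
    (hZ : ∀ᶠ z in 𝓝 (y₀, t₀), fderiv ℝ f z (Z z.1, 0) = Z (f z))
    (hW : ∀ᶠ y in 𝓝 y₀, W y = fderiv ℝ f (y, t₀) (0, a)) :
    lieBracket ℝ W Z y₀ = 0 := by
  let V₁ : E₁ × K → E₁ × K := fun _ => (0, a)
  let V₂ : E₁ × K → E₁ × K := fun z => (Z z.1, 0)
  have hZf : HasFDerivAt Z (fderiv ℝ Z y₀) y₀ := hZd.hasFDerivAt
  have hV₂ : HasFDerivAt V₂
      (((fderiv ℝ Z y₀).comp (ContinuousLinearMap.fst ℝ E₁ K)).prod 0) (y₀, t₀) :=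
    (HasFDerivAt.comp (y₀, t₀) hZf hasFDerivAt_fst).prodMk (hasFDerivAt_const 0 _)
  have h0 := fderiv_apply_lieBracket (𝕜 := ℝ) hf
    (by rw [minSmoothness_of_isRCLikeNormedField]; exact WithTop.coe_le_coe.2 le_top) (hV₂.differentiableAt)
    (differentiableAt_const _ : DifferentiableAt ℝ V₁ (y₀, t₀))
  have hbr : lieBracket ℝ V₁ V₂ (y₀, t₀) = 0 := by
    simp [lieBracket, hV₂.fderiv, V₁]
  rw [hbr, map_zero] at h0
  have h1 : fderiv ℝ (fun z => fderiv ℝ f z (V₂ z)) (y₀, t₀) (V₁ (y₀, t₀))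
      = fderiv ℝ Z y₀ (W y₀) := by
    have : (fun z => fderiv ℝ f z (V₂ z)) =ᶠ[𝓝 (y₀, t₀)] Z ∘ f := hZ
    rw [this.fderiv_eq, fderiv_comp _ (by rwa [hf0]) (hf.differentiableAt (by simp)), hf0,
      hW.self_of_nhds]
    rfl
  have h2 : fderiv ℝ (fun z => fderiv ℝ f z (V₁ z)) (y₀, t₀) (V₂ (y₀, t₀))
      = fderiv ℝ W y₀ (Z y₀) := by
    have hg : DifferentiableAt ℝ (fun z => fderiv ℝ f z (V₁ z)) (y₀, t₀) :=
      ((hf.fderiv_right (m := 1) (by norm_cast)).differentiableAt (by simp)).clm_apply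
        (differentiableAt_const _)
    have hi : HasFDerivAt (fun y : E₁ => (y, t₀)) (ContinuousLinearMap.inl ℝ E₁ K) y₀ :=
      (hasFDerivAt_id y₀).prodMk (hasFDerivAt_const t₀ y₀)
    have hWe : W =ᶠ[𝓝 y₀] (fun z => fderiv ℝ f z (V₁ z)) ∘ fun y => (y, t₀) := hW
    rw [hWe.fderiv_eq, (HasFDerivAt.comp y₀ hg.hasFDerivAt hi).fderiv]
    rfl
  rw [h1, h2] at h0
  exact h0.symm

variable {EM : Type*} [NormedAddCommGroup EM] [NormedSpace ℝ EM]
  {M : Type*} [TopologicalSpace M] [ChartedSpace EM M] [IsManifold 𝓘(ℝ, EM) ∞ M]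

theorem mvfderiv_comp_vector {E₁ E₂ E₃ : Type*} [NormedAddCommGroup E₁] [NormedSpace ℝ E₁]
    [NormedAddCommGroup E₂] [NormedSpace ℝ E₂] [NormedAddCommGroup E₃] [NormedSpace ℝ E₃]
    {M₁ M₂ : Type*} [TopologicalSpace M₁] [ChartedSpace E₁ M₁] [TopologicalSpace M₂]
    [ChartedSpace E₂ M₂] {g : M₂ → E₃} {f : M₁ → M₂} (x : M₁)
    (hg : MDifferentiableAt 𝓘(ℝ, E₂) 𝓘(ℝ, E₃) g (f x))
    (hf : MDifferentiableAt 𝓘(ℝ, E₁) 𝓘(ℝ, E₂) f x) (v : Tan E₁ x) :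
    mvfderiv 𝓘(ℝ, E₁) (g ∘ f) x v
      = mvfderiv 𝓘(ℝ, E₂) g (f x) (mfderiv 𝓘(ℝ, E₁) 𝓘(ℝ, E₂) f x v) :=
  mfderiv_comp_apply x hg hf v

/-- A vector field read in the chart at `x₀`. -/
def chartField (x₀ : M) (V : ∀ x : M, Tan EM x) (y : EM) : EM :=
  mvfderiv 𝓘(ℝ, EM) (extChartAt 𝓘(ℝ, EM) x₀) ((extChartAt 𝓘(ℝ, EM) x₀).symm y)
    (V ((extChartAt 𝓘(ℝ, EM) x₀).symm y))

/-- The bracket on a manifold is defined by pulling back along the inverse chart. The inverse of the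
derivative of the inverse chart is the derivative of the chart, so the pulled-back fields are
`chartField`. -/
theorem mvfderiv_mlieBracket (V W : ∀ x : M, Tan EM x) (x₀ : M) :
    mvfderiv 𝓘(ℝ, EM) (extChartAt 𝓘(ℝ, EM) x₀) x₀ (mlieBracket 𝓘(ℝ, EM) V W x₀)
      = lieBracket ℝ (chartField x₀ V) (chartField x₀ W) (extChartAt 𝓘(ℝ, EM) x₀ x₀) := by
  have key : ∀ V : ∀ x : M, Tan EM x,
      mpullbackWithin 𝓘(ℝ, EM) 𝓘(ℝ, EM) (extChartAt 𝓘(ℝ, EM) x₀).symm V (Set.range 𝓘(ℝ, EM))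
        =ᶠ[𝓝 (extChartAt 𝓘(ℝ, EM) x₀ x₀)] chartField x₀ V := by
    intro V
    filter_upwards [(isOpen_extChartAt_target (I := 𝓘(ℝ, EM)) x₀).mem_nhds
      (mem_extChartAt_target x₀)] with y hy
    have h1 := mfderivWithin_extChartAt_symm_comp_mfderiv_extChartAt (I := 𝓘(ℝ, EM)) hy
    have h2 := mfderiv_extChartAt_comp_mfderivWithin_extChartAt_symm (I := 𝓘(ℝ, EM)) hy
    rw [mpullbackWithin_apply, ContinuousLinearMap.inverse_eq h1 h2]
    rfl
  rw [← mlieBracketWithin_univ, mlieBracketWithin_apply]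
  have h3 := isInvertible_mfderiv_extChartAt (I := 𝓘(ℝ, EM)) (mem_extChartAt_source x₀)
  have h4 : ∀ v, mvfderiv 𝓘(ℝ, EM) (extChartAt 𝓘(ℝ, EM) x₀) x₀
      ((mfderiv 𝓘(ℝ, EM) 𝓘(ℝ, EM) (extChartAt 𝓘(ℝ, EM) x₀) x₀).inverse v) = v := by
    intro v
    obtain ⟨e, he⟩ := h3
    change mfderiv 𝓘(ℝ, EM) 𝓘(ℝ, EM) (extChartAt 𝓘(ℝ, EM) x₀) x₀
      ((mfderiv 𝓘(ℝ, EM) 𝓘(ℝ, EM) (extChartAt 𝓘(ℝ, EM) x₀) x₀).inverse v) = v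
    rw [← he, ContinuousLinearMap.inverse_equiv]
    exact e.apply_symm_apply v
  refine (h4 _).trans ?_
  have hs : (extChartAt 𝓘(ℝ, EM) x₀).symm ⁻¹' Set.univ ∩ Set.range 𝓘(ℝ, EM) = Set.univ := by simp
  rw [hs]
  refine (congrFun lieBracketWithin_univ _).trans ?_
  exact (key V).lieBracket_vectorField_eq (key W)

theorem differentiableAt_chartField {V : ∀ x : M, Tan EM x} {x₀ : M} (hV : DiffFieldAt V x₀) :
    DifferentiableAt ℝ (chartField x₀ V) (extChartAt 𝓘(ℝ, EM) x₀ x₀) := by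
  refine MDifferentiableAt.differentiableAt ?_
  refine MDifferentiableAt.comp (I' := 𝓘(ℝ, EM)) (extChartAt 𝓘(ℝ, EM) x₀ x₀)
    (g := fun y => mvfderiv 𝓘(ℝ, EM) (extChartAt 𝓘(ℝ, EM) x₀) y (V y))
    (f := (extChartAt 𝓘(ℝ, EM) x₀).symm) ?_ ?_
  · simpa using diffFieldAt_iff.1 hV
  · exact ((contMDiffOn_extChartAt_symm (I := 𝓘(ℝ, EM)) (n := ∞) x₀).contMDiffAt
      ((isOpen_extChartAt_target x₀).mem_nhds (mem_extChartAt_target x₀))).mdifferentiableAt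
      (by simp)

/-- A vector field that is invariant under a family `A t` of maps commutes with the
infinitesimal generators of the family. -/
theorem mlieBracket_eq_zero_of_invariant {K : Type*} [NormedAddCommGroup K] [NormedSpace ℝ K]
    {A : M → K → M} {x₀ : M} {t₀ a : K} {Z W : ∀ x : M, Tan EM x}
    (hA : ∀ᶠ z : M × K in 𝓝 (x₀, t₀), ContMDiffAt (𝓘(ℝ, EM).prod 𝓘(ℝ, K)) 𝓘(ℝ, EM) ∞
      (fun z : M × K => A z.1 z.2) z)
    (hA0 : ∀ x, A x t₀ = x) (hZd : DiffFieldAt Z x₀)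
    (hZ : ∀ x t, (Z (A x t) : EM) = mfderiv 𝓘(ℝ, EM) 𝓘(ℝ, EM) (fun x => A x t) x (Z x))
    (hW : ∀ x, (W x : EM) = mfderiv 𝓘(ℝ, K) 𝓘(ℝ, EM) (A x) t₀ a) :
    mlieBracket 𝓘(ℝ, EM) W Z x₀ = 0 := by
  refine injective_mvfderiv_extChartAt x₀ ?_
  rw [mvfderiv_mlieBracket, map_zero]
  let χ := extChartAt 𝓘(ℝ, EM) x₀
  have hsymm : ∀ y ∈ χ.target, ContMDiffAt 𝓘(ℝ, EM) 𝓘(ℝ, EM) ∞ χ.symm y := fun y hy =>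
    (contMDiffOn_extChartAt_symm (I := 𝓘(ℝ, EM)) (n := ∞) x₀).contMDiffAt
      ((isOpen_extChartAt_target x₀).mem_nhds hy)
  have htgt : ∀ᶠ y in 𝓝 (χ x₀), y ∈ χ.target :=
    (isOpen_extChartAt_target x₀).mem_nhds (mem_extChartAt_target x₀)
  have hx0 : χ.symm (χ x₀) = x₀ := extChartAt_to_inv x₀
  have hcont : ContinuousAt (fun z : EM × K => (χ.symm z.1, z.2)) (χ x₀, t₀) :=
    ContinuousAt.prodMk (ContinuousAt.comp (x := (χ x₀, t₀)) (f := Prod.fst)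
      (hsymm _ (mem_extChartAt_target x₀)).continuousAt continuousAt_fst) continuousAt_snd
  have hlim : Filter.Tendsto (fun z : EM × K => (χ.symm z.1, z.2)) (𝓝 (χ x₀, t₀))
      (𝓝 (x₀, t₀)) := by
    have := hcont.tendsto
    simpa only [hx0] using this
  have hAsrc : ∀ᶠ z in 𝓝 (x₀, t₀), A z.1 z.2 ∈ χ.source :=
    hA.self_of_nhds.continuousAt (by
      simp only [hA0]
      exact extChartAt_source_mem_nhds (I := 𝓘(ℝ, EM)) x₀)
  have htgt2 : ∀ᶠ z : EM × K in 𝓝 (χ x₀, t₀), z.1 ∈ χ.target := continuousAt_fst.eventually htgt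
  -- The family `A` read in the chart at `x₀`, in the source and in the target. The points where it
  -- is smooth and stays in the chart form a neighbourhood (`hall`).
  let f : EM × K → EM := fun z => χ (A (χ.symm z.1) z.2)
  have hall : ∀ᶠ z in 𝓝 (χ x₀, t₀), z.1 ∈ χ.target ∧ A (χ.symm z.1) z.2 ∈ χ.source ∧
      ContMDiffAt (𝓘(ℝ, EM).prod 𝓘(ℝ, K)) 𝓘(ℝ, EM) ∞
        (fun z : M × K => A z.1 z.2) (χ.symm z.1, z.2) :=
    htgt2.and ((hlim.eventually hAsrc).and (hlim.eventually hA))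
  have hfsm : ∀ z : EM × K, z.1 ∈ χ.target → A (χ.symm z.1) z.2 ∈ χ.source →
      ContMDiffAt (𝓘(ℝ, EM).prod 𝓘(ℝ, K)) 𝓘(ℝ, EM) ∞
        (fun z : M × K => A z.1 z.2) (χ.symm z.1, z.2) → ContDiffAt ℝ ∞ f z := by
    intro z h1 h2 h3
    have hz : ContMDiffAt 𝓘(ℝ, EM × K) (𝓘(ℝ, EM).prod 𝓘(ℝ, K)) ∞
        (fun z : EM × K => (χ.symm z.1, z.2)) z := by
      refine ContMDiffAt.prodMk ?_ ?_
      · exact (hsymm _ h1).comp z (contDiff_fst.contMDiff.contMDiffAt)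
      · exact contDiff_snd.contMDiff.contMDiffAt
    have h4 : ContMDiffAt 𝓘(ℝ, EM) 𝓘(ℝ, EM) ∞ χ (A (χ.symm z.1) z.2) :=
      contMDiffAt_extChartAt' (by simpa [χ] using h2)
    exact (h4.comp z (h3.comp z hz)).contDiffAt
  refine lieBracket_eq_zero_of_invariant (f := f) (t₀ := t₀) (a := a) ?_ ?_
    (differentiableAt_chartField hZd) ?_ ?_
  · exact hfsm _ hall.self_of_nhds.1 hall.self_of_nhds.2.1 hall.self_of_nhds.2.2
  · simp only [f, hA0]
    exact χ.right_inv (mem_extChartAt_target x₀)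
  · filter_upwards [hall] with z ⟨h1, h2, h3⟩
    have hd : DifferentiableAt ℝ f z := (hfsm z h1 h2 h3).differentiableAt (by simp)
    have hxs : χ.symm z.1 ∈ (chartAt EM x₀).source := by simpa [χ] using χ.map_target h1
    have hAt : ContMDiffAt 𝓘(ℝ, EM) 𝓘(ℝ, EM) ∞ (fun x => A x z.2) (χ.symm z.1) :=
      ContMDiffAt.comp (I' := 𝓘(ℝ, EM).prod 𝓘(ℝ, K)) (χ.symm z.1)
        (g := fun z : M × K => A z.1 z.2) (f := fun x => (x, z.2)) h3
        (contMDiffAt_id.prodMk contMDiffAt_const)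
    have hχ : ContMDiffAt 𝓘(ℝ, EM) 𝓘(ℝ, EM) ∞ χ (A (χ.symm z.1) z.2) :=
      contMDiffAt_extChartAt' (by simpa [χ] using h2)
    have e1 := mvfderiv_eq_fderiv_comp (f := χ ∘ fun x => A x z.2) hxs
      (ContMDiffAt.comp (χ.symm z.1) (g := χ) (f := fun x => A x z.2) hχ hAt)
      (Z (χ.symm z.1))
    have e0 := mvfderiv_comp_vector (g := χ)
      (f := fun x => A x z.2) (χ.symm z.1) (hχ.mdifferentiableAt (by simp))
      (hAt.mdifferentiableAt (by simp)) (Z (χ.symm z.1))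
    have e7 : fderiv ℝ ((χ ∘ fun x => A x z.2) ∘ χ.symm) (χ (χ.symm z.1)) (chartField x₀ Z z.1)
        = fderiv ℝ ((χ ∘ fun x => A x z.2) ∘ χ.symm) z.1 (chartField x₀ Z z.1) := by
      rw [χ.right_inv h1]
    have hi : HasFDerivAt (fun y : EM => (y, z.2)) (ContinuousLinearMap.inl ℝ EM K) z.1 :=
      (hasFDerivAt_id z.1).prodMk (hasFDerivAt_const z.2 z.1)
    have e2 := (HasFDerivAt.comp z.1 (f := fun y : EM => (y, z.2)) hd.hasFDerivAt hi).fderiv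
    have e3 : fderiv ℝ f z (chartField x₀ Z z.1, 0)
        = fderiv ℝ ((χ ∘ fun x => A x z.2) ∘ χ.symm) z.1 (chartField x₀ Z z.1) :=
      congr($e2.symm (chartField x₀ Z z.1))
    have e4 : chartField x₀ Z (f z) = mvfderiv 𝓘(ℝ, EM) χ (A (χ.symm z.1) z.2)
        (Z (A (χ.symm z.1) z.2)) :=
      congrArg (fun q => mvfderiv 𝓘(ℝ, EM) χ q (Z q)) (χ.left_inv h2)
    rw [e3, e4]
    refine e7.symm.trans (e1.symm.trans (e0.trans ?_))
    exact congrArg (mvfderiv 𝓘(ℝ, EM) χ (A (χ.symm z.1) z.2)) (hZ _ _).symm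
  · have hlim2 : Filter.Tendsto (fun y : EM => (y, t₀)) (𝓝 (χ x₀)) (𝓝 (χ x₀, t₀)) :=
      (continuousAt_id.prodMk continuousAt_const)
    filter_upwards [hlim2.eventually hall] with y ⟨h1, h2, h3⟩
    have hd : DifferentiableAt ℝ f (y, t₀) := (hfsm _ h1 h2 h3).differentiableAt (by simp)
    have hAt : ContMDiffAt 𝓘(ℝ, K) 𝓘(ℝ, EM) ∞ (A (χ.symm y)) t₀ :=
      ContMDiffAt.comp (I' := 𝓘(ℝ, EM).prod 𝓘(ℝ, K)) t₀
        (g := fun z : M × K => A z.1 z.2) (f := fun t => (χ.symm y, t)) h3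
        (contMDiffAt_const.prodMk contMDiffAt_id)
    have hχ : ContMDiffAt 𝓘(ℝ, EM) 𝓘(ℝ, EM) ∞ χ (A (χ.symm y) t₀) :=
      contMDiffAt_extChartAt' (by simpa [χ] using h2)
    have hi : HasFDerivAt (fun t : K => (y, t)) (ContinuousLinearMap.inr ℝ EM K) t₀ :=
      (hasFDerivAt_const y t₀).prodMk (hasFDerivAt_id t₀)
    have e2 := (HasFDerivAt.comp t₀ (f := fun t : K => (y, t)) hd.hasFDerivAt hi).fderiv
    have e3 : fderiv ℝ f (y, t₀) (0, a) = fderiv ℝ (χ ∘ A (χ.symm y)) t₀ a :=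
      congr($e2.symm a)
    have e4 := mvfderiv_comp_vector (g := χ)
      (f := A (χ.symm y)) t₀ (hχ.mdifferentiableAt (by simp))
      (hAt.mdifferentiableAt (by simp)) a
    have e5 : fderiv ℝ (χ ∘ A (χ.symm y)) t₀ a
        = mvfderiv 𝓘(ℝ, K) (χ ∘ A (χ.symm y)) t₀ a := by
      rw [← mfderiv_eq_fderiv]
      rfl
    rw [e3, e5, e4]
    -- `A (χ.symm y) t₀` and `χ.symm y` are equal only propositionally, and tangent spaces depend on
    -- the point. Generalizing the point allows a substitution; the same device recurs for `act e 1`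
    -- and `e`.
    have e6 : ∀ p, p = χ.symm y → ∀ u : EM, mvfderiv 𝓘(ℝ, EM) χ (χ.symm y) u
        = mvfderiv 𝓘(ℝ, EM) χ p u := by
      rintro _ rfl u
      rfl
    refine Eq.trans ?_ (e6 _ (hA0 _) _)
    exact congrArg (mvfderiv 𝓘(ℝ, EM) χ (χ.symm y)) (hW _)

end Commutator

/-! ### Operations on smooth vector fields and local extensions. -/

section Fields

variable {EM : Type*} [NormedAddCommGroup EM] [NormedSpace ℝ EM]
  {M : Type*} [TopologicalSpace M] [ChartedSpace EM M] [IsManifold 𝓘(ℝ, EM) ∞ M]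
  {V W : ∀ x : M, Tan EM x} {U : Set M} {x : M}

theorem SmoothFieldAt.add (hV : SmoothFieldAt V x) (hW : SmoothFieldAt W x) :
    SmoothFieldAt (fun y => V y + W y) x := ContMDiffAt.add_section hV hW

theorem SmoothFieldAt.neg (hV : SmoothFieldAt V x) : SmoothFieldAt (fun y => -V y) x :=
  ContMDiffAt.neg_section hV

theorem SmoothFieldAt.sub (hV : SmoothFieldAt V x) (hW : SmoothFieldAt W x) :
    SmoothFieldAt (fun y => V y - W y) x := ContMDiffAt.sub_section hV hW

theorem SmoothFieldAt.smul {f : M → ℝ} (hf : ContMDiffAt 𝓘(ℝ, EM) 𝓘(ℝ, ℝ) ∞ f x)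
    (hV : SmoothFieldAt V x) : SmoothFieldAt (fun y => f y • V y) x :=
  ContMDiffAt.smul_section hf hV

theorem SmoothFieldAt.const_smul (r : ℝ) (hV : SmoothFieldAt V x) :
    SmoothFieldAt (fun y => r • V y) x := SmoothFieldAt.smul contMDiffAt_const hV

theorem SmoothFieldAt.sum {ι : Type*} {s : Finset ι} {V : ι → ∀ x : M, Tan EM x}
    (h : ∀ i ∈ s, SmoothFieldAt (V i) x) : SmoothFieldAt (fun y => ∑ i ∈ s, V i y) x :=
  ContMDiffAt.sum_section h

theorem SmoothFieldAt.congr (hV : SmoothFieldAt V x) (h : ∀ᶠ y in 𝓝 x, W y = V y) :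
    SmoothFieldAt W x := by
  refine ContMDiffAt.congr_of_eventuallyEq hV ?_
  filter_upwards [h] with y hy
  rw [hy]

theorem smoothFieldAt_zero : SmoothFieldAt (fun y : M => (0 : Tan EM y)) x :=
  (Bundle.contMDiff_zeroSection ℝ (TangentSpace 𝓘(ℝ, EM) : M → Type _)).contMDiffAt

/-- Every tangent vector extends to a smooth vector field on a neighbourhood. -/
theorem exists_smooth_extension (x : M) :
    ∃ U : Set M, IsOpen U ∧ x ∈ U ∧ ∀ v : Tan EM x, ∃ V : ∀ y : M, Tan EM y,
      SmoothFieldOn V U ∧ V x = v := by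
  let t := trivializationAt EM (TangentSpace 𝓘(ℝ, EM) : M → Type _) x
  -- The extension has constant coordinates in the trivialization at `x`, so one neighbourhood
  -- serves every `v`.
  refine ⟨t.baseSet, t.open_baseSet, FiberBundle.mem_baseSet_trivializationAt' x, fun v =>
    ⟨FiberBundle.extend (E := (TangentSpace 𝓘(ℝ, EM) : M → Type _)) EM v, fun y hy => ?_, FiberBundle.extend_apply_self _ v⟩⟩
  have h := (t.contMDiffWithinAt_section (IB := 𝓘(ℝ, EM)) (n := ∞)
    (s := FiberBundle.extend (E := (TangentSpace 𝓘(ℝ, EM) : M → Type _)) EM v) t.baseSet hy).2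
  refine h ?_
  have hc : ContMDiffOn 𝓘(ℝ, EM) 𝓘(ℝ, EM) ∞ (fun _ : M => (t ⟨x, v⟩).2) t.baseSet :=
    contMDiffOn_const
  exact hc.congr (fun z hz => (congrArg Prod.snd (t.apply_mk_symm hz (t ⟨x, v⟩).2) :)) y hy

end Fields

/-! ### Sasakian linear algebra: `Φ`, `F` and the splitting of `TX ⊗ ℂ`. -/

namespace SasakianStructure

variable {EX : Type*} [NormedAddCommGroup EX] [NormedSpace ℝ EX] [FiniteDimensional ℝ EX]
  {X : Type*} [TopologicalSpace X] [ChartedSpace EX X] [IsManifold 𝓘(ℝ, EX) ∞ X]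
  (S : SasakianStructure EX X)

/-- The contact form `g(ξ, ·)`. -/
def eta (x : X) : Tan EX x →L[ℝ] ℝ := S.g.inner x (S.xi x)

theorem eta_xi (x : X) : S.eta x (S.xi x) = 1 := S.xi_unit x

theorem mem_F {x : X} {v : Tan EX x} : v ∈ S.F x ↔ S.eta x v = 0 := Iff.rfl

theorem Phi_apply (x : X) (v : Tan EX x) : S.Phi x v = -(S.nabla S.xi x v) := rfl

/-- Differentiate `g(ξ, ξ) = 1` along `v`. -/
theorem eta_Phi (x : X) (v : Tan EX x) : S.eta x (S.Phi x v) = 0 := by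
  have h := S.isLeviCivita.metric Set.univ isOpen_univ S.xi S.xi S.xi_smooth S.xi_smooth x
    (Set.mem_univ x) v
  have hc : (fun y => S.g.inner y (S.xi y) (S.xi y)) = fun _ => (1 : ℝ) := funext S.xi_unit
  rw [hc, mvfderiv_const, S.g.symm x (S.nabla S.xi x v)] at h
  have h2 : S.g.inner x (S.xi x) (S.nabla S.xi x v) = 0 := by
    simp only [zero_apply] at h
    linarith
  rw [Phi_apply, map_neg]
  exact neg_eq_zero.2 h2

theorem eq_zero_of_inner {x : X} {v : Tan EX x} (h : ∀ w, S.g.inner x v w = 0) : v = 0 := by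
  by_contra hv
  exact (S.g.pos x v hv).ne' (h v)

/-- Killing's equation gives `g(∇_ξ ξ, w) = -g(ξ, ∇_w ξ)`, which is zero by `eta_Phi`. -/
theorem Phi_xi (x : X) : S.Phi x (S.xi x) = 0 := by
  rw [Phi_apply, neg_eq_zero]
  refine S.eq_zero_of_inner fun w => ?_
  have h := S.xi_killing x (S.xi x) w
  have h2 : S.g.inner x (S.xi x) (S.nabla S.xi x w) = 0 := by
    have := S.eta_Phi x w
    rw [Phi_apply, map_neg, neg_eq_zero] at this
    exact this
  rwa [h2, add_zero] at h

/-- Apply the Sasakian identity to the field `ξ` itself: `Φ ξ = 0` removes the first term, and what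
is left is `Φ² v = g(v, ξ) ξ - v`. -/
theorem Phi_Phi (x : X) (v : Tan EX x) : S.Phi x (S.Phi x v) = S.eta x v • S.xi x - v := by
  have h := S.sasaki Set.univ isOpen_univ S.xi S.xi_smooth x (Set.mem_univ x) v
  have hz : (fun y => -(S.nabla S.xi y (S.xi y))) = (0 : ∀ x : X, Tan EX x) :=
    funext fun y => S.Phi_xi y
  rw [hz, CovariantDerivative.zero, S.xi_unit, one_smul, S.g.symm x v] at h
  rw [Phi_apply, Phi_apply, map_neg]
  simpa using! h

/-- The orthogonal projection to `F`. -/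
def projF (x : X) : Tan EX x →ₗ[ℝ] Tan EX x :=
  LinearMap.id - (S.eta x).toLinearMap.smulRight (S.xi x)

theorem projF_apply (x : X) (v : Tan EX x) : S.projF x v = v - S.eta x v • S.xi x := rfl

theorem projF_mem (x : X) (v : Tan EX x) : S.projF x v ∈ S.F x := by
  rw [mem_F, projF_apply, map_sub, map_smul, eta_xi]
  simp

theorem projF_of_mem {x : X} {v : Tan EX x} (h : v ∈ S.F x) : S.projF x v = v := by
  rw [projF_apply, S.mem_F.1 h, zero_smul, sub_zero]

theorem Phi_mem (x : X) (v : Tan EX x) : S.Phi x v ∈ S.F x := S.eta_Phi x v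

theorem Phi_projF (x : X) (v : Tan EX x) : S.Phi x (S.projF x v) = S.Phi x v := by
  rw [projF_apply, map_sub, map_smul, Phi_xi, smul_zero, sub_zero]

theorem Phi_Phi_of_mem {x : X} {v : Tan EX x} (h : v ∈ S.F x) : S.Phi x (S.Phi x v) = -v := by
  rw [Phi_Phi, S.mem_F.1 h, zero_smul, zero_sub]

/-- `Φ` as an endomorphism of `F`. -/
def PhiF (x : X) : S.F x →ₗ[ℝ] S.F x :=
  ((S.Phi x).toLinearMap.domRestrict (S.F x)).codRestrict (S.F x) fun v => S.Phi_mem x v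

theorem mem_F01 {x : X} {z : CTan EX x} :
    z ∈ S.F01 x ↔ ∃ v ∈ S.F x, z = cvec v (S.Phi x v) := by
  have h := mem_span_cvec (S.PhiF x) (fun v => Subtype.ext (S.Phi_Phi_of_mem v.2)) (z := z)
  have e : ∀ z : CTan EX x, (∃ v : S.F x, z = cvec (v : Tan EX x) (S.PhiF x v)) ↔
      ∃ v ∈ S.F x, z = cvec v (S.Phi x v) := fun z =>
    ⟨fun ⟨v, hv⟩ => ⟨v, v.2, hv⟩, fun ⟨v, hv, hz⟩ => ⟨⟨v, hv⟩, hz⟩⟩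
  simp only [e] at h
  exact h

theorem mem_F10 {x : X} {z : CTan EX x} :
    z ∈ S.F10 x ↔ ∃ v ∈ S.F x, z = cvec v (-(S.Phi x v)) := by
  have h := mem_span_cvec (-S.PhiF x) (fun v => by
    have : S.PhiF x (S.PhiF x v) = -v := Subtype.ext (S.Phi_Phi_of_mem v.2)
    simp [this]) (z := z)
  have e : ∀ z : CTan EX x, (∃ v : S.F x, z = cvec (v : Tan EX x) ((-S.PhiF x) v : S.F x)) ↔
      ∃ v ∈ S.F x, z = cvec v (-(S.Phi x v)) := fun z =>
    ⟨fun ⟨v, hv⟩ => ⟨v, v.2, hv⟩, fun ⟨v, hv, hz⟩ => ⟨⟨v, hv⟩, hz⟩⟩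
  simp only [e] at h
  exact h

theorem mem_calF01 {x : X} {z : CTan EX x} :
    z ∈ S.calF01 x ↔ ∃ v ∈ S.F x, ∃ a b : ℝ,
      z = cvec v (S.Phi x v) + cvec (a • S.xi x) (b • S.xi x) := by
  rw [calF01, Submodule.mem_sup]
  constructor
  · rintro ⟨y, hy, t, ht, rfl⟩
    obtain ⟨v, hv, rfl⟩ := S.mem_F01.1 hy
    obtain ⟨h1, h2⟩ := mem_cplxSub.1 ht
    obtain ⟨a, ha⟩ := Submodule.mem_span_singleton.1 h1
    obtain ⟨b, hb⟩ := Submodule.mem_span_singleton.1 h2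
    exact ⟨v, hv, a, b, by rw [ha, hb, cvec_cre_cim]⟩
  · rintro ⟨v, hv, a, b, rfl⟩
    refine ⟨_, S.mem_F01.2 ⟨v, hv, rfl⟩, _, ?_, rfl⟩
    rw [mem_cplxSub, cre_cvec, cim_cvec]
    exact ⟨Submodule.smul_mem _ _ (Submodule.mem_span_singleton_self _),
      Submodule.smul_mem _ _ (Submodule.mem_span_singleton_self _)⟩

/-- The element `v - √-1 Φ(v)` of `F^{1,0}`, for the `F`-component `v` of a tangent vector. -/
def toF10 (x : X) : Tan EX x →ₗ[ℝ] S.F10 x where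
  toFun v := ⟨cvec (S.projF x v) (-(S.Phi x (S.projF x v))),
    S.mem_F10.2 ⟨_, S.projF_mem x v, rfl⟩⟩
  map_add' v w := Subtype.ext (ctensor_ext (by simp) (by simp; abel))
  map_smul' r v := Subtype.ext (ctensor_ext (by simp) (by simp))

theorem coe_toF10 (x : X) (v : Tan EX x) :
    (S.toF10 x v : CTan EX x) = cvec (S.projF x v) (-(S.Phi x v)) := by
  rw [← S.Phi_projF x v]
  rfl

/-- `Φ` acts as `√-1` on `F^{1,0}` and as `-√-1` on `F^{0,1}`, so the projection of `F ⊗ ℂ` to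
`F^{1,0}` is `(1 - √-1 Φ)/2`. The vector `v` is the real part of the projection of `z`. -/
theorem exists_sub_mem_calF01 (x : X) (z : CTan EX x) :
    ∃ u : S.F10 x, z - (u : CTan EX x) ∈ S.calF01 x := by
  let v := (2⁻¹ : ℝ) • (S.projF x (cre z) + S.Phi x (cim z))
  have hv : v ∈ S.F x :=
    Submodule.smul_mem _ _ (Submodule.add_mem _ (S.projF_mem _ _) (S.Phi_mem _ _))
  let t := cre z - S.eta x (cre z) • S.xi x - v
  have ht : t ∈ S.F x := Submodule.sub_mem _ (S.projF_mem _ _) hv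
  refine ⟨⟨cvec v (-(S.Phi x v)), S.mem_F10.2 ⟨v, hv, rfl⟩⟩, S.mem_calF01.2
    ⟨t, ht, S.eta x (cre z), S.eta x (cim z), ctensor_ext ?_ ?_⟩⟩
  · simp only [map_sub, map_add, cre_cvec, t]
    abel
  · simp only [map_sub, cim_cvec, map_add, map_smul, t, v, Phi_Phi, Phi_xi, projF_apply]
    module

theorem eta_smoothAt {V : ∀ x : X, Tan EX x} {x : X} (hV : SmoothFieldAt V x) :
    ContMDiffAt 𝓘(ℝ, EX) 𝓘(ℝ, ℝ) ∞ (fun y => S.eta y (V y)) x := by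
  have h : ContMDiffAt 𝓘(ℝ, EX) (𝓘(ℝ, EX).prod 𝓘(ℝ, ℝ)) ∞
      (fun m => Bundle.TotalSpace.mk' ℝ (E := Bundle.Trivial X ℝ) m
        (S.g.inner m (S.xi m) (V m))) x := by
    refine ContMDiffAt.clm_bundle_apply₂ (F₁ := EX) (F₂ := EX) S.g.contMDiff.contMDiffAt
      (S.xi_smooth.at isOpen_univ (Set.mem_univ x)) hV
  rw [Bundle.contMDiffAt_totalSpace] at h
  exact h.2

theorem projF_smoothAt {V : ∀ x : X, Tan EX x} {x : X} (hV : SmoothFieldAt V x) :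
    SmoothFieldAt (fun y => S.projF y (V y)) x :=
  hV.sub ((S.xi_smooth.at isOpen_univ (Set.mem_univ x)).smul (S.eta_smoothAt hV))

theorem projF_smoothOn {V : ∀ x : X, Tan EX x} {U : Set X} (hU : IsOpen U)
    (hV : SmoothFieldOn V U) : SmoothFieldOn (fun y => S.projF y (V y)) U :=
  smoothFieldOn_of_at fun _ hx => S.projF_smoothAt (hV.at hU hx)

theorem Phi_smoothOn {V : ∀ x : X, Tan EX x} {U : Set X} (hU : IsOpen U)
    (hV : SmoothFieldOn V U) : SmoothFieldOn (fun y => S.Phi y (V y)) U :=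
  smoothFieldOn_of_at fun _ hx => SmoothFieldAt.neg ((S.isLeviCivita.smooth U hU V S.xi hV
    (S.xi_smooth.mono (Set.subset_univ U))).at hU hx)

theorem toF10_smoothOn {V : ∀ x : X, Tan EX x} {U : Set X} (hU : IsOpen U)
    (hV : SmoothFieldOn V U) : CSmoothFieldOn (fun y => (S.toF10 y (V y) : CTan EX y)) U := by
  simp only [CSmoothFieldOn, coe_toF10, cre_cvec, cim_cvec]
  exact ⟨S.projF_smoothOn hU hV,
    smoothFieldOn_of_at fun _ hx => ((S.Phi_smoothOn hU hV).at hU hx).neg⟩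

end SasakianStructure

/-- The bundle calculus is real, whereas the structure group comes with a complex atlas. -/
theorem isManifold_restrictScalars {EH : Type*} [NormedAddCommGroup EH] [NormedSpace ℂ EH]
    (H : Type*) [TopologicalSpace H] [ChartedSpace EH H] [IsManifold 𝓘(ℂ, EH) ∞ H] :
    IsManifold 𝓘(ℝ, EH) ∞ H := by
  refine isManifold_of_contDiffOn _ _ _ fun e e' he he' => ?_
  have h := (contDiffGroupoid ∞ 𝓘(ℂ, EH)).compatible he he'
  rw [contDiffGroupoid, mem_groupoid_of_pregroupoid] at h
  exact ContDiffOn.restrict_scalars (𝕜 := ℝ) h.1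

/-! ### The Leibniz rule for brackets of frame expansions. -/

section Brackets

open VectorField

variable {EM : Type*} [NormedAddCommGroup EM] [NormedSpace ℝ EM] [CompleteSpace EM]
  {M : Type*} [TopologicalSpace M] [ChartedSpace EM M] [IsManifold 𝓘(ℝ, EM) ∞ M]

theorem isManifold_two (EM : Type*) [NormedAddCommGroup EM] [NormedSpace ℝ EM]
    (M : Type*) [TopologicalSpace M] [ChartedSpace EM M] [IsManifold 𝓘(ℝ, EM) ∞ M] :
    IsManifold 𝓘(ℝ, EM) 2 M := IsManifold.of_le (n := ∞) (WithTop.coe_le_coe.2 le_top)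

/-- Used twice. For horizontal frames the derivative terms are horizontal, which makes the curvature
tensorial. For fundamental frames and an invariant `Y` only the derivative terms survive. -/
theorem mlieBracket_sum_smul_left {ι : Type*} (s : Finset ι) {c : ι → M → ℝ}
    {V : ι → ∀ x : M, Tan EM x} {Y : ∀ x : M, Tan EM x} {x : M}
    (hc : ∀ i ∈ s, ContMDiffAt 𝓘(ℝ, EM) 𝓘(ℝ, ℝ) ∞ (c i) x)
    (hV : ∀ i ∈ s, SmoothFieldAt (V i) x) :
    mlieBracket 𝓘(ℝ, EM) (fun y => ∑ i ∈ s, c i y • V i y) Y x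
      = ∑ i ∈ s, (c i x • mlieBracket 𝓘(ℝ, EM) (V i) Y x
        - (mvfderiv 𝓘(ℝ, EM) (c i) x (Y x)) • V i x) := by
  classical
  have := isManifold_two EM M
  induction s using Finset.induction_on with
  | empty =>
    simp only [Finset.sum_empty]
    exact congrFun mlieBracket_zero_left x
  | insert i s hi ih =>
    have h1 : (fun y => ∑ j ∈ insert i s, c j y • V j y)
        = (c i • V i) + fun y => ∑ j ∈ s, c j y • V j y := by
      funext y
      rw [Finset.sum_insert hi]
      rfl
    have hi1 := hc i (Finset.mem_insert_self i s)
    have hi2 := hV i (Finset.mem_insert_self i s)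
    have hs1 := fun j (hj : j ∈ s) => hc j (Finset.mem_insert_of_mem hj)
    have hs2 := fun j (hj : j ∈ s) => hV j (Finset.mem_insert_of_mem hj)
    rw [h1]
    refine (mlieBracket_add_left (V := c i • V i) (V₁ := fun y => ∑ j ∈ s, c j y • V j y)
      (SmoothFieldAt.diff (hi2.smul hi1))
      (SmoothFieldAt.diff (SmoothFieldAt.sum fun j hj => (hs2 j hj).smul (hs1 j hj)))).trans ?_
    rw [mlieBracket_smul_left (hi1.mdifferentiableAt (by simp)) hi2.diff, ih hs1 hs2,
      Finset.sum_insert hi]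
    congr 1
    rw [neg_smul]
    abel

end Brackets

/-! ### The differential of the action and invariant vector fields. -/

namespace SmoothPrincipalBundle

open VectorField

variable {EX : Type*} [NormedAddCommGroup EX] [NormedSpace ℝ EX]
  {X : Type*} [TopologicalSpace X] [ChartedSpace EX X]
  {EH : Type*} [NormedAddCommGroup EH] [NormedSpace ℂ EH]
  {H : Type*} [TopologicalSpace H] [ChartedSpace EH H] [Group H]
  {EE : Type*} [NormedAddCommGroup EE] [NormedSpace ℝ EE]
  {E : Type*} [TopologicalSpace E] [ChartedSpace EE E]
  (P : SmoothPrincipalBundle EX X EH H EE E)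

theorem contMDiff_act_left (h : H) : ContMDiff 𝓘(ℝ, EE) 𝓘(ℝ, EE) ∞ fun e => P.act e h :=
  P.act_smooth.comp (contMDiff_id.prodMk contMDiff_const)

theorem contMDiff_act_right (e : E) : ContMDiff 𝓘(ℝ, EH) 𝓘(ℝ, EE) ∞ fun h => P.act e h :=
  P.act_smooth.comp (contMDiff_const.prodMk contMDiff_id)

theorem act_act_inv (e : E) (h : H) : P.act (P.act e h) h⁻¹ = e := by
  rw [← P.act_mul, mul_inv_cancel, P.act_one]

theorem dp_dR (h : H) (e : E) (v : Tan EE e) :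
    (P.dp (P.act e h) (P.dR h e v) : EX) = (P.dp e v : EX) := by
  have h1 : P.p ∘ (fun e' => P.act e' h) = P.p := funext fun e' => P.p_act e' h
  have h2 := mfderiv_comp_apply e (P.p_smooth.mdifferentiable (by simp) _)
    ((P.contMDiff_act_left h).mdifferentiable (by simp) e) v
  rw [h1] at h2
  exact h2.symm

theorem dR_dR_inv (h : H) (e : E) (v : Tan EE (P.act e h)) :
    (P.dR h e ((P.dR h⁻¹ (P.act e h) v : EE)) : EE) = v := by
  have h1 : (fun e' => P.act e' h) ∘ (fun e' => P.act e' h⁻¹) = id := funext fun e' => by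
    have := P.act_act_inv e' h⁻¹
    rwa [inv_inv] at this
  have h2 := mfderiv_comp_apply (P.act e h)
    ((P.contMDiff_act_left h).mdifferentiable (by simp) _)
    ((P.contMDiff_act_left h⁻¹).mdifferentiable (by simp) (P.act e h)) v
  rw [h1, mfderiv_id] at h2
  have h3 : ∀ e', e' = e → ∀ u : EE, (P.dR h e' u : EE) = P.dR h e u := by
    rintro _ rfl u
    rfl
  exact (h3 _ (P.act_act_inv e h) _).symm.trans h2.symm

theorem dR_inv_dR (h : H) (e : E) (v : Tan EE e) :
    (P.dR h⁻¹ (P.act e h) (P.dR h e v) : EE) = v := by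
  have h1 : (fun e' => P.act e' h⁻¹) ∘ (fun e' => P.act e' h) = id :=
    funext fun e' => P.act_act_inv e' h
  have h2 := mfderiv_comp_apply e
    ((P.contMDiff_act_left h⁻¹).mdifferentiable (by simp) _)
    ((P.contMDiff_act_left h).mdifferentiable (by simp) e) v
  rw [h1, mfderiv_id] at h2
  exact h2.symm

theorem isInvertible_mfderiv_act (h : H) (e : E) :
    (mfderiv 𝓘(ℝ, EE) 𝓘(ℝ, EE) (fun e' => P.act e' h) e).IsInvertible :=
  ⟨ContinuousLinearEquiv.equivOfInverse (M₁ := EE) (M₂ := EE)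
    (mfderiv 𝓘(ℝ, EE) 𝓘(ℝ, EE) (fun e' => P.act e' h) e)
    (mfderiv 𝓘(ℝ, EE) 𝓘(ℝ, EE) (fun e' => P.act e' h⁻¹) (P.act e h))
    (P.dR_inv_dR h e) (P.dR_dR_inv h e), rfl⟩

/-- A vector field on the total space is invariant under the structure group. -/
def Invariant (V : ∀ e : E, Tan EE e) : Prop := ∀ e h, V (P.act e h) = P.dR h e (V e)

/-- Invariance means that a field equals its pullback by the diffeomorphism `act · h`, and pullback
respects Lie brackets. -/
theorem mlieBracket_act [CompleteSpace EE] [IsManifold 𝓘(ℝ, EE) ∞ E] {V W : ∀ e : E, Tan EE e}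
    (hV : P.Invariant V)
    (hW : P.Invariant W) {e : E} {h : H} (hVd : DiffFieldAt V (P.act e h))
    (hWd : DiffFieldAt W (P.act e h)) :
    mlieBracket 𝓘(ℝ, EE) V W (P.act e h) = P.dR h e (mlieBracket 𝓘(ℝ, EE) V W e) := by
  have := isManifold_two EE E
  have : IsManifold 𝓘(ℝ, EE) (minSmoothness ℝ 3) E := by
    rw [minSmoothness_of_isRCLikeNormedField]
    exact IsManifold.of_le (n := ∞) (WithTop.coe_le_coe.2 le_top)
  have key : ∀ V : ∀ e : E, Tan EE e, P.Invariant V →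
      mpullback 𝓘(ℝ, EE) 𝓘(ℝ, EE) (fun e' => P.act e' h) V = V := by
    intro V hV
    funext e'
    rw [mpullback_apply, hV e' h]
    exact (P.isInvertible_mfderiv_act h e').inverse_apply_eq.2 rfl
  have h1 := mpullback_mlieBracket (f := fun e' => P.act e' h) (x₀ := e) (n := ∞) hVd hWd
    (P.contMDiff_act_left h e)
    (by rw [minSmoothness_of_isRCLikeNormedField]; exact WithTop.coe_le_coe.2 le_top)
  rw [key V hV, key W hW, mpullback_apply,
    (P.isInvertible_mfderiv_act h e).inverse_apply_eq] at h1
  exact h1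

end SmoothPrincipalBundle

/-! ### Fundamental vector fields and vertical brackets. -/

namespace SmoothPrincipalBundle

open VectorField

variable {EX : Type*} [NormedAddCommGroup EX] [NormedSpace ℝ EX]
  {X : Type*} [TopologicalSpace X] [ChartedSpace EX X]
  {EH : Type*} [NormedAddCommGroup EH] [NormedSpace ℂ EH]
  {H : Type*} [TopologicalSpace H] [ChartedSpace EH H] [Group H]
  {EE : Type*} [NormedAddCommGroup EE] [NormedSpace ℝ EE]
  {E : Type*} [TopologicalSpace E] [ChartedSpace EE E]
  (P : SmoothPrincipalBundle EX X EH H EE E)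

/-- The fundamental vector field of an element of the Lie algebra of the structure group. -/
def fund (a : EH) (e : E) : Tan EE e :=
  (mfderiv 𝓘(ℝ, EH) 𝓘(ℝ, EE) (fun h => P.act e h) (1 : H) a : EE)

theorem dp_dOrb (e : E) (h : H) (a : EH) : P.dp (P.act e h) (P.dOrb e h a) = 0 := by
  have h1 : P.p ∘ (fun h' => P.act e h') = fun _ => P.p e := funext fun h' => P.p_act e h'
  have h2 := mfderiv_comp_apply h (P.p_smooth.mdifferentiable (by simp) _)
    ((P.contMDiff_act_right e).mdifferentiable (by simp) h) a
  rw [h1, mfderiv_const] at h2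
  exact h2.symm

theorem fund_mem (a : EH) (e : E) : P.fund a e ∈ P.vert e := by
  have h : ∀ e', e' = e → ∀ u : EE, (P.dp e' u : EX) = 0 → (P.dp e u : EX) = 0 := by
    rintro _ rfl u h
    exact h
  exact h _ (P.act_one e) _ (P.dp_dOrb e 1 a)

/-- This is `holomorphic_right` at `h = 1`, transported from `act e 1` to `e`. It makes the
infinitesimal action complex linear. -/
theorem J_fund [IsManifold 𝓘(ℝ, EE) ∞ E] {J : ∀ e : E, P.vert e →ₗ[ℝ] P.vert e} (hJ : P.IsFiberComplexStructure J)
    (a : EH) (e : E) :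
    (J e ⟨P.fund a e, P.fund_mem a e⟩ : Tan EE e) = P.fund (Complex.I • a) e := by
  have h : ∀ e', e' = e → ∀ u w : EE, (∀ k : P.vert e', (k.1 : EE) = u → ((J e' k).1 : EE) = w) →
      ∀ k : P.vert e, (k.1 : EE) = u → ((J e k).1 : EE) = w := by
    rintro _ rfl u w h
    exact h
  exact h _ (P.act_one e) (P.dOrb e 1 a) (P.dOrb e 1 (Complex.I • a))
    (hJ.holomorphic_right e 1 a) ⟨P.fund a e, P.fund_mem a e⟩ rfl

/-- The action in the chart of the structure group at the unit. -/
def chartAct (e : E) (t : EH) : E := P.act e ((extChartAt 𝓘(ℝ, EH) (1 : H)).symm t)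

theorem chartAct_one (e : E) : P.chartAct e (extChartAt 𝓘(ℝ, EH) (1 : H) 1) = e := by
  rw [chartAct, extChartAt_to_inv, P.act_one]

section

variable [IsManifold 𝓘(ℝ, EH) ∞ H]

theorem contMDiffAt_chartAct (z : E × EH) (hz : z.2 ∈ (extChartAt 𝓘(ℝ, EH) (1 : H)).target) :
    ContMDiffAt (𝓘(ℝ, EE).prod 𝓘(ℝ, EH)) 𝓘(ℝ, EE) ∞
      (fun z : E × EH => P.chartAct z.1 z.2) z := by
  have h1 : ContMDiffAt 𝓘(ℝ, EH) 𝓘(ℝ, EH) ∞ (extChartAt 𝓘(ℝ, EH) (1 : H)).symm z.2 :=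
    (contMDiffOn_extChartAt_symm (I := 𝓘(ℝ, EH)) (n := ∞) (1 : H)).contMDiffAt
      ((isOpen_extChartAt_target (1 : H)).mem_nhds hz)
  exact (P.act_smooth.contMDiffAt).comp z
    (contMDiffAt_fst.prodMk (h1.comp z contMDiffAt_snd))

theorem eventually_contMDiffAt_chartAct (e : E) :
    ∀ᶠ z in 𝓝 (e, extChartAt 𝓘(ℝ, EH) (1 : H) 1),
      ContMDiffAt (𝓘(ℝ, EE).prod 𝓘(ℝ, EH)) 𝓘(ℝ, EE) ∞
        (fun z : E × EH => P.chartAct z.1 z.2) z := by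
  have h : ∀ᶠ z : E × EH in 𝓝 (e, extChartAt 𝓘(ℝ, EH) (1 : H) 1),
      z.2 ∈ (extChartAt 𝓘(ℝ, EH) (1 : H)).target :=
    continuousAt_snd ((isOpen_extChartAt_target (1 : H)).mem_nhds (mem_extChartAt_target (1 : H)))
  exact h.mono fun z hz => P.contMDiffAt_chartAct z hz

theorem fund_eq_chartAct (a : EH) (e : E) :
    (P.fund a e : EE) = mfderiv 𝓘(ℝ, EH) 𝓘(ℝ, EE) (P.chartAct e) (extChartAt 𝓘(ℝ, EH) (1 : H) 1)
      (mfderiv 𝓘(ℝ, EH) 𝓘(ℝ, EH) (extChartAt 𝓘(ℝ, EH) (1 : H)) (1 : H) a : EH) := by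
  have h1 : P.chartAct e ∘ extChartAt 𝓘(ℝ, EH) (1 : H) =ᶠ[𝓝 (1 : H)] fun h => P.act e h := by
    filter_upwards [(isOpen_extChartAt_source (I := 𝓘(ℝ, EH)) (1 : H)).mem_nhds
      (mem_extChartAt_source (1 : H))] with h hh
    simp only [Function.comp_apply, chartAct]
    rw [(extChartAt 𝓘(ℝ, EH) (1 : H)).left_inv hh]
  have h2 : MDifferentiableAt 𝓘(ℝ, EH) 𝓘(ℝ, EE) (P.chartAct e)
      (extChartAt 𝓘(ℝ, EH) (1 : H) 1) := by
    have := (P.contMDiffAt_chartAct (e, extChartAt 𝓘(ℝ, EH) (1 : H) 1)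
      (mem_extChartAt_target (1 : H))).comp (I := 𝓘(ℝ, EH)) (extChartAt 𝓘(ℝ, EH) (1 : H) 1)
      (contMDiffAt_const.prodMk contMDiffAt_id)
    exact this.mdifferentiableAt (by simp)
  have h3 := mfderiv_comp_apply (1 : H) h2
    (mdifferentiableAt_extChartAt (I := 𝓘(ℝ, EH)) (mem_chart_source EH (1 : H))) a
  rw [h1.mfderiv_eq] at h3
  exact h3

variable [IsManifold 𝓘(ℝ, EE) ∞ E]

/-- A fundamental field is a partial derivative of the action in the group variable, hence smooth in
`e`. The group variable is taken in a chart, so that this derivative is a map between fixed vector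
spaces. -/
theorem smoothFieldAt_fund (a : EH) (e : E) : SmoothFieldAt (P.fund a) e := by
  rw [smoothFieldAt_iff]
  let t₀ := extChartAt 𝓘(ℝ, EH) (1 : H) 1
  let b : EH := mfderiv 𝓘(ℝ, EH) 𝓘(ℝ, EH) (extChartAt 𝓘(ℝ, EH) (1 : H)) (1 : H) a
  have h1 : ContMDiffAt (𝓘(ℝ, EE).prod 𝓘(ℝ, EH)) 𝓘(ℝ, EE) ∞
      (Function.uncurry fun y t => extChartAt 𝓘(ℝ, EE) e (P.chartAct y t)) (e, t₀) := by
    refine ContMDiffAt.comp (I' := 𝓘(ℝ, EE)) (e, t₀) (g := extChartAt 𝓘(ℝ, EE) e)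
      (f := fun z : E × EH => P.chartAct z.1 z.2) ?_
      (P.contMDiffAt_chartAct (e, t₀) (mem_extChartAt_target (1 : H)))
    rw [P.chartAct_one]
    exact contMDiffAt_extChartAt
  have h2 := ContMDiffAt.mfderiv (m := ∞) (fun y t => extChartAt 𝓘(ℝ, EE) e (P.chartAct y t))
    (fun _ => t₀) h1 contMDiffAt_const (by simp)
  let Dy : E → EH →L[ℝ] EE := fun y =>
    mfderiv 𝓘(ℝ, EH) 𝓘(ℝ, EE) (fun t => extChartAt 𝓘(ℝ, EE) e (P.chartAct y t)) t₀
  have h2' : ContMDiffAt 𝓘(ℝ, EE) 𝓘(ℝ, EH →L[ℝ] EE) ∞ Dy e :=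
    (inTangentCoordinates_model_space (I := 𝓘(ℝ, EH)) (I' := 𝓘(ℝ, EE)) (fun _ : E => t₀)
      (fun y => extChartAt 𝓘(ℝ, EE) e (P.chartAct y t₀)) Dy e) ▸ h2
  have h3 := ContMDiffAt.clm_apply h2' (contMDiffAt_const (c := b))
  refine h3.congr_of_eventuallyEq ?_
  filter_upwards [(chartAt EE e).open_source.mem_nhds (mem_chart_source EE e)] with y hy
  have h4 : MDifferentiableAt 𝓘(ℝ, EH) 𝓘(ℝ, EE) (P.chartAct y) t₀ := by
    have := (P.contMDiffAt_chartAct (y, t₀)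
      (mem_extChartAt_target (1 : H))).comp (I := 𝓘(ℝ, EH)) t₀
      (contMDiffAt_const.prodMk contMDiffAt_id)
    exact this.mdifferentiableAt (by simp)
  have h5 := mfderiv_comp_apply (I' := 𝓘(ℝ, EE)) t₀ (g := extChartAt 𝓘(ℝ, EE) e)
    (by rw [P.chartAct_one]; exact mdifferentiableAt_extChartAt hy) h4 b
  have h6 : ∀ y', y' = y → ∀ u : EE, (mfderiv 𝓘(ℝ, EE) 𝓘(ℝ, EE) (extChartAt 𝓘(ℝ, EE) e) y' u : EE)
      = mfderiv 𝓘(ℝ, EE) 𝓘(ℝ, EE) (extChartAt 𝓘(ℝ, EE) e) y u := by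
    rintro _ rfl u
    rfl
  have h7 := h6 _ (P.chartAct_one y) (mfderiv 𝓘(ℝ, EH) 𝓘(ℝ, EE) (P.chartAct y) t₀ b)
  refine Eq.trans ?_ (h7.symm.trans h5.symm)
  exact congrArg (fun u : EE => (mfderiv 𝓘(ℝ, EE) 𝓘(ℝ, EE) (extChartAt 𝓘(ℝ, EE) e) y u : EE))
    (P.fund_eq_chartAct a y)

/-- The fundamental fields generate the right translations, under which `Y` is invariant. -/
theorem mlieBracket_fund (a : EH) {Y : ∀ e : E, Tan EE e} (hY : P.Invariant Y) {e : E}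
    (hYd : DiffFieldAt Y e) : mlieBracket 𝓘(ℝ, EE) (P.fund a) Y e = 0 :=
  mlieBracket_eq_zero_of_invariant (A := P.chartAct) (P.eventually_contMDiffAt_chartAct e)
    P.chartAct_one hYd (fun x _ => hY x _) fun x => P.fund_eq_chartAct a x

end

/-- Near each point, every element of the total space is the translate of a point of a local
section by a smooth function with values in the structure group. -/
theorem exists_retraction (e : E) : ∃ (U : Set E) (r : E → H) (σ : X → E), IsOpen U ∧ e ∈ U ∧
    (∀ e' ∈ U, ∀ h, P.act e' h ∈ U) ∧ ContMDiffOn 𝓘(ℝ, EE) 𝓘(ℝ, EH) ∞ r U ∧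
    ContMDiffAt 𝓘(ℝ, EX) 𝓘(ℝ, EE) ∞ σ (P.p e) ∧ r e = 1 ∧
    (∀ h, r (P.act e h) = h) ∧ ∀ e' ∈ U, P.act (σ (P.p e')) (r e') = e' := by
  obtain ⟨U, hU, hx, φ, hs, ht, hφ, hφs, h⟩ := P.locally_trivial (P.p e)
  have he : e ∈ φ.source := by rw [hs]; exact hx
  have htgt : ∀ x ∈ U, ∀ k : H, (x, k) ∈ φ.target := fun x hx k => by
    rw [ht]
    exact ⟨hx, trivial⟩
  have hsrc : ∀ x ∈ U, ∀ k : H, φ.symm (x, k) ∈ φ.source := fun x hx k =>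
    φ.map_target (htgt x hx k)
  have hact : ∀ e' ∈ φ.source, ∀ k, P.act e' k ∈ φ.source := fun e' he' k => by
    rw [hs, Set.mem_preimage, P.p_act]
    rwa [hs] at he'
  have hsymm : ∀ e' ∈ φ.source, ∀ k l, (φ e').2 = k * l →
      P.act (φ.symm (P.p e', k)) l = e' := by
    intro e' he' k l hkl
    have hpe : P.p e' ∈ U := by rwa [hs] at he'
    refine φ.injOn (hact _ (hsrc _ hpe k) l) he' ?_
    rw [(h _ (hsrc _ hpe k)).2, φ.right_inv (htgt _ hpe k)]
    exact Prod.ext (h e' he').1.symm hkl.symm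
  -- The group coordinate is to be normalized to `1` at `e` by left multiplication with `h₀⁻¹`.
  -- Smoothness of multiplication in `H` is not among the assumptions here, so this left
  -- multiplication is performed by the smooth action on the bundle, through the point with
  -- coordinates `(p e', h₀⁻¹)`.
  let h₀ := (φ e).2
  have hq : ∀ e' ∈ φ.source, (φ (P.act (φ.symm (P.p e', h₀⁻¹)) (φ e').2)).2 = h₀⁻¹ * (φ e').2 := by
    intro e' he'
    have hpe : P.p e' ∈ U := by rwa [hs] at he'
    rw [(h _ (hsrc _ hpe _)).2, φ.right_inv (htgt _ hpe _)]
  refine ⟨φ.source, fun e' => (φ (P.act (φ.symm (P.p e', h₀⁻¹)) (φ e').2)).2,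
    fun x => φ.symm (x, h₀), φ.open_source, he, hact, ?_, ?_, ?_, ?_, ?_⟩
  · have hc : ContMDiffOn 𝓘(ℝ, EE) 𝓘(ℝ, EE) ∞ (fun e' => φ.symm (P.p e', h₀⁻¹)) φ.source := by
      refine hφs.comp (P.p_smooth.contMDiffOn.prodMk contMDiffOn_const) fun e' he' => ?_
      exact htgt _ (by rwa [hs] at he') _
    have hc2 : ContMDiffOn 𝓘(ℝ, EE) 𝓘(ℝ, EE) ∞
        (fun e' => P.act (φ.symm (P.p e', h₀⁻¹)) (φ e').2) φ.source :=
      P.act_smooth.comp_contMDiffOn (hc.prodMk (contMDiff_snd.comp_contMDiffOn hφ))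
    refine contMDiff_snd.comp_contMDiffOn (hφ.comp hc2 fun e' he' => ?_)
    exact hact _ (hsrc _ (by rwa [hs] at he') _) _
  · refine ContMDiffAt.comp (P.p e) (I' := 𝓘(ℝ, EX).prod 𝓘(ℝ, EH))
      (hφs.contMDiffAt (φ.open_target.mem_nhds (htgt _ hx _)))
      (contMDiffAt_id.prodMk contMDiffAt_const)
  · simp only [hq e he]
    exact inv_mul_cancel _
  · intro k
    refine (hq _ (hact e he k)).trans ?_
    rw [(h e he).2]
    exact inv_mul_cancel_left _ _
  · intro e' he'
    exact hsymm e' he' _ _ (((congrArg (h₀ * ·) (hq e' he')).trans (mul_inv_cancel_left _ _)).symm)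

/-- Differentiate `σ(p(e')) · r(e') = e'` along `k`. The first factor contributes nothing because
`dp k = 0`, and the second contributes the fundamental vector of `dr(k)`. -/
theorem exists_fund_eq (e : E) (k : Tan EE e) (hk : k ∈ P.vert e) : ∃ a : EH, P.fund a e = k := by
  obtain ⟨U, r, σ, hU, he, hact, hr, hσ, hre, -, hrec⟩ := P.exists_retraction e
  have hr' := (hr.contMDiffAt (hU.mem_nhds he)).mdifferentiableAt (by simp)
  have hσe : σ (P.p e) = e := by
    have := hrec e he
    rwa [hre, P.act_one] at this
  have hσp := (hσ.comp e P.p_smooth.contMDiffAt).mdifferentiableAt (by simp)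
  have h1 : (fun z : E × H => P.act z.1 z.2) ∘ (fun e' => ((σ ∘ P.p) e', r e')) =ᶠ[𝓝 e] id := by
    filter_upwards [hU.mem_nhds he] with e' he'
    exact hrec e' he'
  have h2 := mfderiv_comp_apply (I' := 𝓘(ℝ, EE).prod 𝓘(ℝ, EH)) e
    (P.act_smooth.mdifferentiable (by simp) _) (hσp.prodMk hr') k
  have h3 := mfderiv_comp_apply e (hσ.mdifferentiableAt (by simp))
    (P.p_smooth.mdifferentiable (by simp) e) k
  have hk' : mfderiv 𝓘(ℝ, EE) 𝓘(ℝ, EX) P.p e k = 0 := hk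
  rw [hk', map_zero] at h3
  have h4 : ∀ z : E × H, z = (e, 1) → ∀ b : EH,
      (mfderiv (𝓘(ℝ, EE).prod 𝓘(ℝ, EH)) 𝓘(ℝ, EE) (fun z : E × H => P.act z.1 z.2) z
        ((0, b) : EE × EH) : EE) = P.fund b e := by
    rintro _ rfl b
    refine (mfderiv_prod_eq_add_apply (P.act_smooth.mdifferentiable (by simp) _)).trans ?_
    let w : EE := P.fund b e
    exact (congrArg (fun u : EE => u + w)
      (map_zero (mfderiv 𝓘(ℝ, EE) 𝓘(ℝ, EE) (fun z => P.act z 1) e))).trans (zero_add _)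
  rw [h1.mfderiv_eq, mfderiv_id, mfderiv_prodMk hσp hr'] at h2
  refine ⟨mfderiv 𝓘(ℝ, EE) 𝓘(ℝ, EH) r e k, ?_⟩
  refine (h4 _ (Prod.ext hσe hre) _).symm.trans (Eq.trans ?_ h2.symm)
  exact congrArg (fun v : EE => (mfderiv (𝓘(ℝ, EE).prod 𝓘(ℝ, EH)) 𝓘(ℝ, EE)
    (fun z : E × H => P.act z.1 z.2) ((σ ∘ P.p) e, r e)
    ((v, mfderiv 𝓘(ℝ, EE) 𝓘(ℝ, EH) r e k) : EE × EH) : EE)) h3.symm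

/-- The retraction `r` is a left inverse of the orbit map of `e`, so the derivative of that map is
injective. -/
theorem fund_injective (e : E) (a : EH) (h : P.fund a e = 0) : a = 0 := by
  obtain ⟨U, r, σ, hU, he, hact, hr, hσ, hre, hinv, hrec⟩ := P.exists_retraction e
  have h1 : r ∘ (fun h => P.act e h) = id := funext hinv
  have hr' : ContMDiffAt 𝓘(ℝ, EE) 𝓘(ℝ, EH) ∞ r (P.act e 1) :=
    hr.contMDiffAt (hU.mem_nhds (hact e he 1))
  have h2 := mfderiv_comp_apply (1 : H) (hr'.mdifferentiableAt (by simp))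
    ((P.contMDiff_act_right e).mdifferentiable (by simp) 1) a
  rw [h1, mfderiv_id] at h2
  have h3 : (mfderiv 𝓘(ℝ, EH) 𝓘(ℝ, EE) (fun h => P.act e h) (1 : H)) a = 0 := h
  rw [h3, map_zero] at h2
  exact h2

/-- The infinitesimal action. -/
def fundL (e : E) : EH →ₗ[ℝ] Tan EE e where
  toFun a := P.fund a e
  map_add' a b := map_add (mfderiv 𝓘(ℝ, EH) 𝓘(ℝ, EE) (fun h => P.act e h) (1 : H)) a b
  map_smul' c a := map_smul (mfderiv 𝓘(ℝ, EH) 𝓘(ℝ, EE) (fun h => P.act e h) (1 : H)) c a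

theorem fundL_apply (e : E) (a : EH) : P.fundL e a = P.fund a e := rfl

theorem fundL_injective (e : E) : Function.Injective (P.fundL e) :=
  (injective_iff_map_eq_zero _).2 fun a ha => P.fund_injective e a ha

/-- The Lie bracket with an invariant vector field maps vertical fields to vertical fields, in a
complex linear way. -/
theorem mlieBracket_vert [FiniteDimensional ℂ EH] [FiniteDimensional ℝ EE]
    [IsManifold 𝓘(ℝ, EH) ∞ H] [IsManifold 𝓘(ℝ, EE) ∞ E] {J : ∀ e : E, P.vert e →ₗ[ℝ] P.vert e}
    (hJ : P.IsFiberComplexStructure J) {k jk Y : ∀ e : E, Tan EE e} {e₀ : E}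
    (hk : SmoothFieldAt k e₀) (hkv : ∀ᶠ e in 𝓝 e₀, ∃ k' : P.vert e, k e = k' ∧ jk e = J e k')
    (hY : P.Invariant Y) (hYd : DiffFieldAt Y e₀) :
    ∃ q : P.vert e₀, mlieBracket 𝓘(ℝ, EE) k Y e₀ = q ∧ mlieBracket 𝓘(ℝ, EE) jk Y e₀ = J e₀ q := by
  classical
  have : FiniteDimensional ℝ EH := FiniteDimensional.complexToReal EH
  let b := Module.finBasis ℝ EH
  have h0 : ∀ e, ∃ a : EH, (∃ k' : P.vert e, k e = k' ∧ jk e = J e k') →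
      k e = P.fundL e a ∧ jk e = P.fundL e (Complex.I • a) := fun e => by
    by_cases h : ∃ k' : P.vert e, k e = k' ∧ jk e = J e k'
    · obtain ⟨⟨k', hk'⟩, h1, h2⟩ := h
      obtain ⟨a, rfl⟩ := P.exists_fund_eq e k' hk'
      exact ⟨a, fun _ => ⟨h1, h2.trans (P.J_fund hJ a e)⟩⟩
    -- Away from the neighbourhood where `k` and `jk` are related the coefficient is irrelevant and
    -- set to zero.
    · exact ⟨0, fun h' => absurd h' h⟩
  choose a ha using h0
  have hsum : ∀ e, a e = ∑ i, b.repr (a e) i • b i := fun e => (b.sum_repr (a e)).symm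
  have h1 : ∀ᶠ e in 𝓝 e₀, k e = ∑ i, b.repr (a e) i • P.fund (b i) e := hkv.mono fun e he => by
    have h := (ha e he).1
    rw [hsum e, map_sum] at h
    simpa only [map_smul, fundL_apply] using h
  have h2 : ∀ᶠ e in 𝓝 e₀, jk e = ∑ i, b.repr (a e) i • P.fund (Complex.I • b i) e :=
    hkv.mono fun e he => by
      have h := (ha e he).2
      rw [hsum e, Finset.smul_sum, map_sum] at h
      simpa only [smul_comm Complex.I, map_smul, fundL_apply] using h
  have hc : ∀ i, ContMDiffAt 𝓘(ℝ, EE) 𝓘(ℝ, ℝ) ∞ (fun e => b.repr (a e) i) e₀ := by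
    refine contMDiffAt_coeff (G := EE)
      (w := fun i e => mvfderiv 𝓘(ℝ, EE) (extChartAt 𝓘(ℝ, EE) e₀) e (P.fund (b i) e))
      (v := fun e => mvfderiv 𝓘(ℝ, EE) (extChartAt 𝓘(ℝ, EE) e₀) e (k e))
      (fun i => smoothFieldAt_iff.1 (P.smoothFieldAt_fund (b i) e₀)) (smoothFieldAt_iff.1 hk)
      ?_ ?_
    · exact (b.linearIndependent.map' (P.fundL e₀)
        (LinearMap.ker_eq_bot.2 (P.fundL_injective e₀))).map'
        (mvfderiv 𝓘(ℝ, EE) (extChartAt 𝓘(ℝ, EE) e₀) e₀).toLinearMap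
        (LinearMap.ker_eq_bot.2 (injective_mvfderiv_extChartAt e₀))
    · filter_upwards [h1] with e he
      rw [he, map_sum]
      simp only [map_smul]
  -- The terms `[fund, Y]` vanish, so the bracket is minus the derivative along `Y` of the Lie
  -- algebra valued coefficient of `k`. The coefficient of `jk` is `√-1` times that of `k`, so its
  -- bracket is the fundamental vector of `√-1 q`, that is, `J` of the first.
  let q : EH := -∑ i, mvfderiv 𝓘(ℝ, EE) (fun e => b.repr (a e) i) e₀ (Y e₀) • b i
  refine ⟨⟨P.fund q e₀, P.fund_mem q e₀⟩, ?_, ?_⟩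
  · refine (Filter.EventuallyEq.mlieBracket_vectorField_eq h1 Filter.EventuallyEq.rfl).trans ?_
    rw [mlieBracket_sum_smul_left _
      (fun i _ => hc i) (fun i _ => P.smoothFieldAt_fund _ e₀)]
    change _ = P.fundL e₀ q
    rw [map_neg, map_sum, ← Finset.sum_neg_distrib]
    refine Finset.sum_congr rfl fun i _ => ?_
    rw [P.mlieBracket_fund _ hY hYd, smul_zero, zero_sub, map_smul, fundL_apply]
  · refine (Filter.EventuallyEq.mlieBracket_vectorField_eq h2 Filter.EventuallyEq.rfl).trans ?_
    rw [mlieBracket_sum_smul_left _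
      (fun i _ => hc i) (fun i _ => P.smoothFieldAt_fund _ e₀), P.J_fund hJ]
    rw [← fundL_apply, smul_neg, Finset.smul_sum, map_neg, map_sum, ← Finset.sum_neg_distrib]
    refine Finset.sum_congr rfl fun i _ => ?_
    rw [P.mlieBracket_fund _ hY hYd, smul_zero, zero_sub, smul_comm Complex.I, map_smul,
      fundL_apply]

end SmoothPrincipalBundle

/-! ### Smoothness of lifts to a complex partial connection. -/

section

variable {EX : Type*} [NormedAddCommGroup EX] [NormedSpace ℝ EX]
  {X : Type*} [TopologicalSpace X] [ChartedSpace EX X]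
  {EH : Type*} [NormedAddCommGroup EH] [NormedSpace ℂ EH]
  {H : Type*} [TopologicalSpace H] [ChartedSpace EH H] [Group H]
  {EE : Type*} [NormedAddCommGroup EE] [NormedSpace ℝ EE]
  {E : Type*} [TopologicalSpace E] [ChartedSpace EE E]

theorem SmoothPrincipalBundle.cre_cdp (P : SmoothPrincipalBundle EX X EH H EE E) {e : E}
    (z : CTan EE e) : cre (P.cdp e z) = P.dp e (cre z) := cre_baseChange _ _

theorem SmoothPrincipalBundle.cim_cdp (P : SmoothPrincipalBundle EX X EH H EE E) {e : E}
    (z : CTan EE e) : cim (P.cdp e z) = P.dp e (cim z) := cim_baseChange _ _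

theorem SmoothPrincipalBundle.cre_cdR (P : SmoothPrincipalBundle EX X EH H EE E) {e : E} {h : H}
    (z : CTan EE e) : cre (P.cdR h e z) = P.dR h e (cre z) := cre_baseChange _ _

theorem SmoothPrincipalBundle.cim_cdR (P : SmoothPrincipalBundle EX X EH H EE E) {e : E} {h : H}
    (z : CTan EE e) : cim (P.cdR h e z) = P.dR h e (cim z) := cim_baseChange _ _

/-- Lifts of smooth complex vector fields to a complex partial connection are smooth. -/
theorem SmoothPrincipalBundle.IsCPartialConnection.smoothFieldAt_lift [FiniteDimensional ℝ EX]
    [IsManifold 𝓘(ℝ, EX) ∞ X] [IsManifold 𝓘(ℝ, EE) ∞ E] {P : SmoothPrincipalBundle EX X EH H EE E}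
    {S : ∀ x : X, Submodule ℂ (CTan EX x)} {r : ℕ} {T : ∀ e : E, Submodule ℂ (CTan EE e)}
    (hT : P.IsCPartialConnection S r T) {V : ∀ e : E, CTan EE e} {u : ∀ x : X, CTan EX x} {e : E}
    (hV : ∀ᶠ y in 𝓝 e, V y ∈ T y ∧ P.cdp y (V y) = u (P.p y))
    (hu : SmoothFieldAt (fun x => cre (u x)) (P.p e))
    (hu' : SmoothFieldAt (fun x => cim (u x)) (P.p e)) :
    SmoothFieldAt (fun y => cre (V y)) e ∧ SmoothFieldAt (fun y => cim (V y)) e := by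
  classical
  obtain ⟨U, hU, heU, W, hW, hspan⟩ := hT.isCDistribution e
  have hex : ∀ y, ∃ c : Fin r → ℂ, V y ∈ T y → y ∈ U → V y = ∑ i, c i • W i y := fun y => by
    by_cases h : V y ∈ T y ∧ y ∈ U
    · obtain ⟨c, hc⟩ := Submodule.mem_span_range_iff_exists_fun ℂ |>.1 ((hspan y h.2).2 ▸ h.1)
      exact ⟨c, fun _ _ => hc.symm⟩
    · exact ⟨0, fun h1 h2 => absurd ⟨h1, h2⟩ h⟩
  choose c hc using hex
  let χ := extChartAt 𝓘(ℝ, EX) (P.p e)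
  have hp : ∀ᶠ y in 𝓝 e, P.p y ∈ (chartAt EX (P.p e)).source :=
    P.p_smooth.continuous.continuousAt
      ((chartAt EX (P.p e)).open_source.mem_nhds (mem_chart_source EX (P.p e)))
  have hχ : ∀ y, P.p y ∈ (chartAt EX (P.p e)).source →
      ContMDiffAt 𝓘(ℝ, EX) 𝓘(ℝ, EX) ∞ χ (P.p y) := fun y hy => contMDiffAt_extChartAt' hy
  have hf : ∀ᶠ y in 𝓝 e, ContMDiffAt 𝓘(ℝ, EE) 𝓘(ℝ, EX) ∞ (χ ∘ P.p) y :=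
    hp.mono fun y hy => (hχ y hy).comp y P.p_smooth.contMDiffAt
  -- `G` reads the image of a complex vector in the base, in the fixed chart `χ`. It is injective on
  -- `T e`, and on `V` it gives the coordinates of `u`. Thus the coefficients of `V` can be found
  -- from smooth data although `V` is not yet known to be smooth.
  let G : ∀ y : E, CTan EE y →ₗ[ℝ] EX × EX := fun y =>
    ((mvfderiv 𝓘(ℝ, EE) (χ ∘ P.p) y).toLinearMap ∘ₗ cre).prod
      ((mvfderiv 𝓘(ℝ, EE) (χ ∘ P.p) y).toLinearMap ∘ₗ cim)
  have hGv : ∀ y, P.p y ∈ (chartAt EX (P.p e)).source → ∀ v : Tan EE y,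
      mvfderiv 𝓘(ℝ, EE) (χ ∘ P.p) y v = mvfderiv 𝓘(ℝ, EX) χ (P.p y) (P.dp y v) := fun y hy v =>
    mfderiv_comp_apply y ((hχ y hy).mdifferentiableAt (by simp))
      (P.p_smooth.mdifferentiable (by simp) y) v
  have hGs : ∀ Z : ∀ e : E, CTan EE e, SmoothFieldAt (fun y => cre (Z y)) e →
      SmoothFieldAt (fun y => cim (Z y)) e →
      ContMDiffAt 𝓘(ℝ, EE) 𝓘(ℝ, EX × EX) ∞ (fun y => G y (Z y)) e := fun Z h1 h2 =>
    (h1.mvfderiv_apply hf).prodMk_space (h2.mvfderiv_apply hf)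
  have hG0 : ∀ z ∈ T e, G e z = 0 → z = 0 := by
    intro z hz h
    obtain ⟨h1, h2⟩ := Prod.ext_iff.1 h
    have hpe := mem_chart_source EX (P.p e)
    have h1' := (hGv e hpe (cre z)).symm.trans h1
    have h2' := (hGv e hpe (cim z)).symm.trans h2
    refine hT.injective e z hz (ctensor_ext ?_ ?_)
    · rw [P.cre_cdp, map_zero]
      exact (injective_iff_map_eq_zero _).1 (injective_mvfderiv_extChartAt (P.p e)) _ h1'
    · rw [P.cim_cdp, map_zero]
      exact (injective_iff_map_eq_zero _).1 (injective_mvfderiv_extChartAt (P.p e)) _ h2'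
  have hIs : ∀ i, SmoothFieldAt (fun y => cre (Complex.I • W i y)) e ∧
      SmoothFieldAt (fun y => cim (Complex.I • W i y)) e := fun i => by
    simp only [cre_smul, cim_smul, Complex.I_re, Complex.I_im, zero_smul, one_smul, zero_sub,
      zero_add]
    exact ⟨((hW i).2.at hU heU).neg, (hW i).1.at hU heU⟩
  have hsplit : ∀ (y : E) (a b : Fin r → ℝ),
      ∑ i, ((a i : ℂ) + b i * Complex.I) • W i y
        = ∑ i, a i • W i y + ∑ i, b i • (Complex.I • W i y) := fun y a b => by
    rw [← Finset.sum_add_distrib]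
    refine Finset.sum_congr rfl fun i _ => ?_
    exact ctensor_ext (by simp; abel) (by simp)
  -- `contMDiffAt_coeff` solves for real coefficients, so the complex frame `W i` is doubled to the
  -- real frame `W i`, `√-1 W i`.
  have hcoef : ∀ j : Fin r ⊕ Fin r, ContMDiffAt 𝓘(ℝ, EE) 𝓘(ℝ, ℝ) ∞
      (fun y => Sum.elim (fun i => (c y i).re) (fun i => (c y i).im) j) e := by
    refine contMDiffAt_coeff (G := EX × EX)
      (w := fun j y => G y (Sum.elim (fun i => W i y) (fun i => Complex.I • W i y) j))
      (v := fun y => G y (V y)) ?_ ?_ ?_ ?_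
    · rintro (i | i)
      · exact hGs _ ((hW i).1.at hU heU) ((hW i).2.at hU heU)
      · exact hGs _ (hIs i).1 (hIs i).2
    · have h1 : ContMDiffAt 𝓘(ℝ, EE) 𝓘(ℝ, EX × EX) ∞
          (fun y => ((mvfderiv 𝓘(ℝ, EX) χ (P.p y) (cre (u (P.p y))),
            mvfderiv 𝓘(ℝ, EX) χ (P.p y) (cim (u (P.p y)))) : EX × EX)) e :=
        ((smoothFieldAt_iff.1 hu).comp e P.p_smooth.contMDiffAt).prodMk_space
          ((smoothFieldAt_iff.1 hu').comp e P.p_smooth.contMDiffAt)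
      refine h1.congr_of_eventuallyEq ?_
      filter_upwards [hV, hp] with y hy hpy
      refine Prod.ext ((hGv y hpy _).trans ?_) ((hGv y hpy _).trans ?_)
      · rw [← P.cre_cdp, hy.2]
      · rw [← P.cim_cdp, hy.2]
    · rw [Fintype.linearIndependent_iff]
      intro g hg
      have h1 : ∑ i, ((g (Sum.inl i) : ℂ) + g (Sum.inr i) * Complex.I) • W i e = 0 := by
        refine hG0 _ (Submodule.sum_mem _ fun i _ => Submodule.smul_mem _ _ ?_) ?_
        · rw [← (hspan e heU).2]
          exact Submodule.subset_span ⟨i, rfl⟩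
        · rw [hsplit e, map_add, map_sum, map_sum, ← hg, Fintype.sum_sum_type]
          simp only [map_smul, Sum.elim_inl, Sum.elim_inr]
      have h2 := Fintype.linearIndependent_iff.1 (hspan e heU).1 _ h1
      rintro (i | i)
      · simpa using congrArg Complex.re (h2 i)
      · simpa using congrArg Complex.im (h2 i)
    · filter_upwards [hV, hU.mem_nhds heU] with y hy hyU
      have h1 := hc y hy.1 hyU
      have h2 : ∀ i, c y i = ((c y i).re : ℂ) + (c y i).im * Complex.I := fun i =>
        (Complex.re_add_im _).symm
      rw [Finset.sum_congr rfl fun i _ => congrArg (· • W i y) (h2 i), hsplit y] at h1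
      rw [h1, Fintype.sum_sum_type, map_add, map_sum, map_sum]
      simp only [map_smul, Sum.elim_inl, Sum.elim_inr]
  constructor
  · refine SmoothFieldAt.congr (V := fun y => ∑ i, ((c y i).re • cre (W i y)
      - (c y i).im • cim (W i y))) (SmoothFieldAt.sum fun i _ => ?_) ?_
    · exact (((hW i).1.at hU heU).smul (hcoef (Sum.inl i))).sub
        (((hW i).2.at hU heU).smul (hcoef (Sum.inr i)))
    · filter_upwards [hV, hU.mem_nhds heU] with y hy hyU
      rw [hc y hy.1 hyU, map_sum]
      simp only [cre_smul]
  · refine SmoothFieldAt.congr (V := fun y => ∑ i, ((c y i).re • cim (W i y)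
      + (c y i).im • cre (W i y))) (SmoothFieldAt.sum fun i _ => ?_) ?_
    · exact (((hW i).2.at hU heU).smul (hcoef (Sum.inl i))).add
        (((hW i).1.at hU heU).smul (hcoef (Sum.inr i)))
    · filter_upwards [hV, hU.mem_nhds heU] with y hy hyU
      rw [hc y hy.1 hyU, map_sum]
      simp only [cim_smul]

end

/-- Local frames of the tangent bundle. -/
theorem isDistribution_top (EM : Type*) [NormedAddCommGroup EM] [NormedSpace ℝ EM]
    [FiniteDimensional ℝ EM] (M : Type*) [TopologicalSpace M] [ChartedSpace EM M]
    [IsManifold 𝓘(ℝ, EM) ∞ M] :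
    IsDistribution (fun x : M => (⊤ : Submodule ℝ (Tan EM x))) (Module.finrank ℝ EM) := by
  intro x
  let t := trivializationAt EM (TangentSpace 𝓘(ℝ, EM) : M → Type _) x
  let b := Module.finBasis ℝ EM
  refine ⟨t.baseSet, t.open_baseSet, FiberBundle.mem_baseSet_trivializationAt' x,
    t.localFrame b, fun i => t.contMDiffOn_localFrame_baseSet (I := 𝓘(ℝ, EM)) ∞ b i,
    fun y hy => ?_⟩
  have h := t.isLocalFrameOn_localFrame_baseSet 𝓘(ℝ, EM) ∞ b
  exact ⟨h.linearIndependent hy, top_le_iff.1 (h.generating hy)⟩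

/-! ### The connection defined by `D` and the lift of `ξ`. -/

namespace HolomorphicPrincipalBundle

open VectorField

variable {EX : Type*} [NormedAddCommGroup EX] [NormedSpace ℝ EX] [FiniteDimensional ℝ EX]
  {X : Type*} [TopologicalSpace X] [ChartedSpace EX X] [IsManifold 𝓘(ℝ, EX) ∞ X]
  {S : SasakianStructure EX X}
  {EH : Type*} [NormedAddCommGroup EH] [NormedSpace ℂ EH]
  {H : Type*} [TopologicalSpace H] [ChartedSpace EH H] [Group H]
  {EE : Type*} [NormedAddCommGroup EE] [NormedSpace ℝ EE]
  {E : Type*} [TopologicalSpace E] [ChartedSpace EE E] [IsManifold 𝓘(ℝ, EE) ∞ E]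
  {m : ℕ} (P : HolomorphicPrincipalBundle EH H EE E m S)

theorem exists_xiHat (e : E) : ∃ v ∈ P.xiT e, P.dp e v = S.xi (P.p e) := by
  have h : S.xi (P.p e) ∈ (P.xiT e).map (P.dp e) := by
    rw [P.isPartialConnection_xiT.map_eq e]
    exact Submodule.mem_span_singleton_self _
  exact h

/-- The lift of the Reeb vector field. -/
def xiHat (e : E) : Tan EE e := (P.exists_xiHat e).choose

theorem xiHat_mem (e : E) : P.xiHat e ∈ P.xiT e := (P.exists_xiHat e).choose_spec.1

theorem dp_xiHat (e : E) : P.dp e (P.xiHat e) = S.xi (P.p e) := (P.exists_xiHat e).choose_spec.2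

theorem xiHat_invariant : P.Invariant P.xiHat := fun e h => by
  rw [← sub_eq_zero]
  refine P.isPartialConnection_xiT.injective _ _ (Submodule.sub_mem _ (P.xiHat_mem _) ?_) ?_
  · rw [← P.isPartialConnection_xiT.invariant e h]
    exact ⟨_, P.xiHat_mem e, rfl⟩
  · rw [map_sub, P.dp_xiHat, sub_eq_zero]
    have h1 : (S.xi (P.p (P.act e h)) : EX) = S.xi (P.p e) :=
      congrArg (fun x => (S.xi x : EX)) (P.p_act e h)
    exact h1.trans ((P.dp_xiHat e).symm.trans (P.dp_dR h e _).symm)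

theorem cvec_xiHat_mem (e : E) (a b : ℝ) : cvec (a • P.xiHat e) (b • P.xiHat e) ∈ P.FT e := by
  refine P.xiT_le e (mem_cplxSub.2 ?_)
  rw [cre_cvec, cim_cvec]
  exact ⟨Submodule.smul_mem _ _ (P.xiHat_mem e), Submodule.smul_mem _ _ (P.xiHat_mem e)⟩

/-- The field is viewed as the lift of `ξ` to `FT`, which contains the complexification of `xiT`, so
that the smoothness result for complex lifts applies. -/
theorem xiHat_smoothAt (e : E) : SmoothFieldAt P.xiHat e := by
  have h := (P.isCPartialConnection_FT.smoothFieldAt_lift (V := fun e => cvec (P.xiHat e) 0)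
    (u := fun x => cvec (S.xi x) 0) (e := e) (Filter.Eventually.of_forall fun y => ⟨?_, ?_⟩)
    ?_ ?_).1
  · simpa only [cre_cvec] using h
  · simpa using P.cvec_xiHat_mem y 1 0
  · refine ctensor_ext ?_ ?_
    · rw [P.cre_cdp, cre_cvec, cre_cvec, P.dp_xiHat]
    · rw [P.cim_cdp, cim_cvec, cim_cvec, map_zero]
  · simp only [cre_cvec]
    exact S.xi_smooth.at isOpen_univ (Set.mem_univ _)
  · simp only [cim_cvec]
    exact smoothFieldAt_zero

namespace HolomorphicConnection

variable {P} (D : P.HolomorphicConnection)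

/-- The horizontal lift at a point of the fiber over `x`. -/
def horAt (x : X) (e : {e : E // P.p e = x}) : Tan EX x →ₗ[ℝ] Tan EE e.1 where
  toFun v := cre ((D.D x (S.toF10 x v)).1 e) + S.eta x v • P.xiHat e.1
  map_add' v w := by
    simp only [map_add, Submodule.coe_add, Pi.add_apply, add_smul]
    abel
  map_smul' r v := by
    have h : S.toF10 x (r • v) = (r : ℂ) • S.toF10 x v := by
      rw [map_smul]
      rfl
    simp only [h, map_smul, Submodule.coe_smul, Pi.smul_apply, cre_smul]
    simp [mul_smul]

/-- The horizontal lift of tangent vectors for the connection defined by `D` and the partial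
connection along the Reeb vector field. -/
def hor (e : E) : Tan EX (P.p e) →ₗ[ℝ] Tan EE e := D.horAt (P.p e) ⟨e, rfl⟩

theorem hor_apply (e : E) (v : Tan EX (P.p e)) : D.hor e v =
    cre ((D.D (P.p e) (S.toF10 (P.p e) v)).1 ⟨e, rfl⟩) + S.eta (P.p e) v • P.xiHat e := rfl

/-- The base point is kept as a separate variable so that the lift at `act e h`, whose projection is
only propositionally `p e`, can be compared with the lift at `e`. -/
theorem horAt_congr {x x' : X} (hx : x = x') (e : E) (h : P.p e = x) (h' : P.p e = x') (v : EX) :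
    (D.horAt x ⟨e, h⟩ v : EE) = D.horAt x' ⟨e, h'⟩ v := by
  subst hx
  rfl

theorem hor_act (e : E) (h : H) (v : EX) :
    (D.hor (P.act e h) v : EE) = P.dR h e (D.hor e v) := by
  have h1 := D.horAt_congr (P.p_act e h) (P.act e h) rfl (P.p_act e h) v
  refine h1.trans ?_
  have h2 := (D.D (P.p e) (S.toF10 (P.p e) v)).2.2 ⟨e, rfl⟩ h
  have h3 : D.horAt (P.p e) ⟨P.act e h, P.p_act e h⟩ v =
    cre ((D.D (P.p e) (S.toF10 (P.p e) v)).1 ⟨P.act e h, P.p_act e h⟩)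
      + S.eta (P.p e) v • P.xiHat (P.act e h) := rfl
  refine h3.trans ?_
  have h4 := congrArg (P.dR h e) (D.hor_apply e v)
  rw [map_add, map_smul] at h4
  rw [h2, P.cre_cdR, P.xiHat_invariant]
  exact h4.symm

/-- The splitting property recovers the `F`-component of `v`, and the `ξ̂` term restores its
component along `ξ`. -/
theorem dp_hor (e : E) (v : Tan EX (P.p e)) : P.dp e (D.hor e v) = v := by
  rw [hor_apply, map_add, map_smul, ← P.cre_cdp, D.split, P.dp_xiHat, S.coe_toF10, cre_cvec,
    S.projF_apply, sub_add_cancel]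

theorem hor_invariant (u : ∀ x : X, Tan EX x) : P.Invariant fun e => D.hor e (u (P.p e)) :=
  fun e h => by
  refine Eq.trans ?_ (D.hor_act e h (u (P.p e)))
  exact congrArg (fun v : EX => (D.hor (P.act e h) v : EE))
    (congrArg (fun x => (u x : EX)) (P.p_act e h))

/-- The complexified horizontal lift. -/
def horC (e : E) : CTan EX (P.p e) →ₗ[ℂ] CTan EE e := (D.hor e).baseChange ℂ

theorem cre_horC {e : E} (z : CTan EX (P.p e)) : cre (D.horC e z) = D.hor e (cre z) :=
  cre_baseChange _ _

theorem cim_horC {e : E} (z : CTan EX (P.p e)) : cim (D.horC e z) = D.hor e (cim z) :=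
  cim_baseChange _ _

theorem cdp_horC (e : E) (z : CTan EX (P.p e)) : P.cdp e (D.horC e z) = z :=
  ctensor_ext (by rw [P.cre_cdp, cre_horC, dp_hor]) (by rw [P.cim_cdp, cim_horC, dp_hor])

/-- The real parts agree by construction. For the imaginary parts, `√-1 (v - √-1 Φ v) = Φ v - √-1
Φ(Φ v)` on `F`, so complex linearity of `D` gives imaginary part `-hor(Φ v)`. -/
theorem D_eq_horC (e : E) (z : S.F10 (P.p e)) :
    (D.D (P.p e) z).1 ⟨e, rfl⟩ = D.horC e (z : CTan EX (P.p e)) := by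
  obtain ⟨z, hz⟩ := z
  obtain ⟨v, hv, rfl⟩ := S.mem_F10.1 hz
  have h0 : ∀ w ∈ S.F (P.p e),
      cre ((D.D (P.p e) (S.toF10 (P.p e) w)).1 ⟨e, rfl⟩) = D.hor e w := fun w hw => by
    rw [hor_apply, S.mem_F.1 hw, zero_smul, add_zero]
  have h1 : (⟨_, hz⟩ : S.F10 (P.p e)) = S.toF10 (P.p e) v :=
    Subtype.ext (by rw [S.coe_toF10, S.projF_of_mem hv])
  have h2 : Complex.I • S.toF10 (P.p e) v = S.toF10 (P.p e) (S.Phi _ v) := by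
    refine Subtype.ext ?_
    rw [Submodule.coe_smul, S.coe_toF10, S.coe_toF10, S.projF_of_mem hv,
      S.projF_of_mem (S.Phi_mem _ v), S.Phi_Phi_of_mem hv]
    exact ctensor_ext (by simp) (by simp)
  refine ctensor_ext ?_ ?_
  · rw [h1, h0 v hv, cre_horC, S.coe_toF10, cre_cvec, S.projF_of_mem hv]
  · have h3 := h0 _ (S.Phi_mem (P.p e) v)
    rw [← h2, map_smul, Submodule.coe_smul, Pi.smul_apply, cre_smul] at h3
    simp only [Complex.I_re, zero_smul, Complex.I_im, one_smul, zero_sub] at h3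
    rw [h1, cim_horC, S.coe_toF10, cim_cvec, map_neg, ← h3, neg_neg]

theorem hor_smoothOn {u : ∀ x : X, Tan EX x} {U : Set X} (hU : IsOpen U)
    (hu : SmoothFieldOn u U) : SmoothFieldOn (fun e => D.hor e (u (P.p e))) (P.p ⁻¹' U) := by
  have hU' : IsOpen (P.p ⁻¹' U) := hU.preimage P.p_smooth.continuous
  refine smoothFieldOn_of_at fun e he => ?_
  have h1 := (D.smooth U hU (fun x => S.toF10 x (u x)) (S.toF10_smoothOn hU hu)).1.at hU' he
  exact h1.add (SmoothFieldAt.smul ((S.eta_smoothAt (hu.at hU he)).comp e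
    P.p_smooth.contMDiffAt) (P.xiHat_smoothAt e))

/-- The connection, as a distribution on the total space. -/
def horSub (e : E) : Submodule ℝ (Tan EE e) := LinearMap.range (D.hor e)

theorem hor_mem (e : E) (v : Tan EX (P.p e)) : D.hor e v ∈ D.horSub e := ⟨v, rfl⟩

theorem hor_dp_of_mem {e : E} {v : Tan EE e} (h : v ∈ D.horSub e) : D.hor e (P.dp e v) = v := by
  obtain ⟨w, rfl⟩ := h
  rw [dp_hor]

theorem horSub_isConnection : P.IsConnection D.horSub where
  isDistribution e := by
    obtain ⟨U, hU, hx, V, hV, h⟩ := isDistribution_top EX X (P.p e)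
    refine ⟨P.p ⁻¹' U, hU.preimage P.p_smooth.continuous, hx,
      fun i e => D.hor e (V i (P.p e)), fun i => D.hor_smoothOn hU (hV i), fun e he => ?_⟩
    obtain ⟨h1, h2⟩ := h _ he
    change _ = (⊤ : Submodule ℝ (Tan EX (P.p e))) at h2
    constructor
    · refine h1.map' (D.hor e) (LinearMap.ker_eq_bot.2 ?_)
      exact Function.LeftInverse.injective (g := P.dp e) (D.dp_hor e)
    · rw [horSub, LinearMap.range_eq_map, ← h2, Submodule.map_span, ← Set.range_comp]
      rfl
  invariant e h := by
    refine le_antisymm ?_ ?_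
    · rintro _ ⟨_, ⟨v, rfl⟩, rfl⟩
      rw [← D.hor_act e h v]
      exact D.hor_mem _ _
    · rintro _ ⟨v, rfl⟩
      exact ⟨D.hor e v, D.hor_mem e _, (D.hor_act e h v).symm⟩
  map_eq e := top_le_iff.1 fun v _ => ⟨D.hor e v, D.hor_mem e v, D.dp_hor e v⟩
  injective e v hv h := by
    rw [← D.hor_dp_of_mem hv, h, map_zero]

theorem hor_xi (e : E) : D.hor e (S.xi (P.p e)) = P.xiHat e := by
  have h : S.toF10 (P.p e) (S.xi (P.p e)) = 0 := by
    refine Subtype.ext ?_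
    rw [S.coe_toF10, S.Phi_xi, S.projF_apply, S.eta_xi, one_smul, sub_self]
    simp
  rw [hor_apply, h, map_zero, S.eta_xi, one_smul]
  simp

theorem horSub_isInducedConnection : P.IsInducedConnection D D.horSub where
  isConnection := D.horSub_isConnection
  xiT_le e v hv := by
    have h : P.dp e v ∈ Submodule.span ℝ {S.xi (P.p e)} := by
      rw [← P.isPartialConnection_xiT.map_eq e]
      exact ⟨v, hv, rfl⟩
    obtain ⟨a, ha⟩ := Submodule.mem_span_singleton.1 h
    have h2 : v = a • P.xiHat e := by
      rw [← sub_eq_zero]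
      refine P.isPartialConnection_xiT.injective e _
        (Submodule.sub_mem _ hv (Submodule.smul_mem _ _ (P.xiHat_mem e))) ?_
      rw [map_sub, map_smul, P.dp_xiHat, ha, sub_self]
    rw [h2, ← D.hor_xi]
    exact Submodule.smul_mem _ _ (D.hor_mem _ _)
  D_mem e v := by
    rw [D.D_eq_horC, mem_cplxSub, cre_horC, cim_horC]
    exact ⟨D.hor_mem _ _, D.hor_mem _ _⟩

/-- The two conditions put every `hor e v` in `T e`. As `dp` is injective on `T e`, each of its
vectors is the horizontal lift of its own projection. -/
theorem eq_horSub {T : ∀ e : E, Submodule ℝ (Tan EE e)} (hT : P.IsInducedConnection D T) :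
    T = D.horSub := by
  funext e
  have h1 : D.horSub e ≤ T e := by
    rintro _ ⟨v, rfl⟩
    rw [hor_apply]
    exact Submodule.add_mem _ (mem_cplxSub.1 (hT.D_mem e _)).1
      (Submodule.smul_mem _ _ (hT.xiT_le e (P.xiHat_mem e)))
  refine le_antisymm (fun v hv => ?_) h1
  have h2 : v = D.hor e (P.dp e v) := by
    rw [← sub_eq_zero]
    refine hT.isConnection.injective e _ (Submodule.sub_mem _ hv (h1 (D.hor_mem _ _))) ?_
    rw [map_sub, dp_hor, sub_self]
  rw [h2]
  exact D.hor_mem _ _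

end HolomorphicConnection
end HolomorphicPrincipalBundle

section

variable {EM : Type*} [NormedAddCommGroup EM] [NormedSpace ℝ EM]
  {M : Type*} [TopologicalSpace M] [ChartedSpace EM M] [IsManifold 𝓘(ℝ, EM) ∞ M]

/-- A vector field with a given value at a point, smooth near that point. -/
def extField (x : M) (v : Tan EM x) : ∀ y : M, Tan EM y :=
  ((exists_smooth_extension (EM := EM) x).choose_spec.2.2 v).choose

theorem extField_self (x : M) (v : Tan EM x) : extField x v x = v :=
  ((exists_smooth_extension (EM := EM) x).choose_spec.2.2 v).choose_spec.2

theorem exists_extField_smoothOn (EM : Type*) [NormedAddCommGroup EM] [NormedSpace ℝ EM]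
    {M : Type*} [TopologicalSpace M] [ChartedSpace EM M] [IsManifold 𝓘(ℝ, EM) ∞ M] (x : M) :
    ∃ U : Set M, IsOpen U ∧ x ∈ U ∧ ∀ v : Tan EM x, SmoothFieldOn (extField x v) U :=
  ⟨_, (exists_smooth_extension (EM := EM) x).choose_spec.1,
    (exists_smooth_extension (EM := EM) x).choose_spec.2.1, fun v =>
    ((exists_smooth_extension (EM := EM) x).choose_spec.2.2 v).choose_spec.1⟩

end

/-! ### The curvature form: tensoriality, equivariance, smoothness. -/

namespace HolomorphicPrincipalBundle

open VectorField

variable {EX : Type*} [NormedAddCommGroup EX] [NormedSpace ℝ EX] [FiniteDimensional ℝ EX]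
  {X : Type*} [TopologicalSpace X] [ChartedSpace EX X] [IsManifold 𝓘(ℝ, EX) ∞ X]
  {S : SasakianStructure EX X}
  {EH : Type*} [NormedAddCommGroup EH] [NormedSpace ℂ EH]
  {H : Type*} [TopologicalSpace H] [ChartedSpace EH H] [Group H]
  {EE : Type*} [NormedAddCommGroup EE] [NormedSpace ℝ EE]
  {E : Type*} [TopologicalSpace E] [ChartedSpace EE E] [IsManifold 𝓘(ℝ, EE) ∞ E]
  {m : ℕ} {P : HolomorphicPrincipalBundle EH H EE E m S}

section toK10

theorem cre_toK10 {e : E} (k : P.vert e) : cre (P.toK10 e k) = (1 / 2 : ℝ) • (k : Tan EE e) := by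
  simp [toK10]

theorem cim_toK10 {e : E} (k : P.vert e) :
    cim (P.toK10 e k) = -((1 / 2 : ℝ) • (P.J e k : Tan EE e)) := by
  simp [toK10]

theorem toK10_mem {e : E} (k : P.vert e) : P.toK10 e k ∈ P.K10 P.J e :=
  Submodule.smul_mem _ _ (Submodule.subset_span ⟨k, rfl⟩)

theorem toK10_zero (e : E) : P.toK10 e 0 = 0 := ctensor_ext (by simp [toK10]) (by simp [toK10])

theorem toK10_add {e : E} (k l : P.vert e) : P.toK10 e (k + l) = P.toK10 e k + P.toK10 e l :=
  ctensor_ext (by simp [cre_toK10]) (by simp [cim_toK10]; abel)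

theorem toK10_neg {e : E} (k : P.vert e) : P.toK10 e (-k) = -P.toK10 e k :=
  ctensor_ext (by simp [cre_toK10]) (by simp [cim_toK10])

theorem toK10_smul {e : E} (r : ℝ) (k : P.vert e) : P.toK10 e (r • k) = (r : ℂ) • P.toK10 e k :=
  ctensor_ext (by rw [cre_toK10, cre_smul, cre_toK10]; simp [smul_comm r])
    (by rw [cim_toK10, cim_smul, cim_toK10]; simp [smul_comm r])

theorem I_smul_toK10 {e : E} (k : P.vert e) : Complex.I • P.toK10 e k = P.toK10 e (P.J e k) :=
  ctensor_ext (by simp [cre_toK10, cim_toK10])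
    (by simp [cre_toK10, cim_toK10, P.isFiberComplex.sq])

theorem toK10_act {e : E} {h : H} {k : P.vert e} {k' : P.vert (P.act e h)}
    (hk : (k' : Tan EE (P.act e h)) = P.dR h e k) :
    P.toK10 (P.act e h) k' = P.cdR h e (P.toK10 e k) := by
  refine ctensor_ext ?_ ?_
  · rw [P.cre_cdR, cre_toK10, cre_toK10, hk, map_smul]
  · rw [P.cim_cdR, cim_toK10, cim_toK10, P.isFiberComplex.holomorphic_left e h k k' hk, map_neg,
      map_smul]

end toK10

namespace HolomorphicConnection

variable (D : P.HolomorphicConnection)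

/-- The projection to the vertical bundle along the connection. -/
def vproj (e : E) : Tan EE e →ₗ[ℝ] P.vert e :=
  (LinearMap.id - D.hor e ∘ₗ P.dp e).codRestrict (P.vert e) fun w => by
    change P.dp e (w - D.hor e (P.dp e w)) = 0
    rw [map_sub, dp_hor, sub_self]

theorem coe_vproj {e : E} (w : Tan EE e) : (D.vproj e w : Tan EE e) = w - D.hor e (P.dp e w) := rfl

theorem vproj_hor (e : E) (v : Tan EX (P.p e)) : D.vproj e (D.hor e v) = 0 :=
  Subtype.ext (by rw [coe_vproj, dp_hor, sub_self, Submodule.coe_zero])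

theorem vproj_vert {e : E} (k : P.vert e) : D.vproj e k = k :=
  Subtype.ext (by
    have h : P.dp e k = 0 := k.2
    rw [coe_vproj, h, map_zero, sub_zero])

theorem coe_vproj_act (e : E) (h : H) (w : Tan EE e) :
    (D.vproj (P.act e h) (P.dR h e w) : Tan EE (P.act e h)) = P.dR h e (D.vproj e w) := by
  rw [coe_vproj, coe_vproj, map_sub]
  congr 1
  refine (D.hor_act e h _).trans ?_
  exact congrArg (fun v : EX => P.dR h e (D.hor e v)) (P.dp_dR h e w)

/-- The horizontal part of a smooth vector field is smooth. -/
theorem hor_dp_smoothAt {w : ∀ e : E, Tan EE e} {e : E} (hw : SmoothFieldAt w e) :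
    SmoothFieldAt (fun y => D.hor y (P.dp y (w y))) e := by
  classical
  obtain ⟨U, hU, hx, V, hV, hfr⟩ := isDistribution_top EX X (P.p e)
  -- The coefficients are functions on the total space, since `dp (w y)` need not depend only on `p
  -- y`.
  have hex : ∀ y : E, ∃ c : Fin (Module.finrank ℝ EX) → ℝ, P.p y ∈ U →
      P.dp y (w y) = ∑ i, c i • V i (P.p y) := fun y => by
    by_cases h : P.p y ∈ U
    · obtain ⟨c, hc⟩ := (Submodule.mem_span_range_iff_exists_fun ℝ).1
        ((hfr _ h).2.ge (Submodule.mem_top : P.dp y (w y) ∈ (⊤ : Submodule ℝ (Tan EX (P.p y)))))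
      exact ⟨c, fun _ => hc.symm⟩
    · exact ⟨0, fun h' => absurd h' h⟩
  choose c hc using hex
  let χ := extChartAt 𝓘(ℝ, EX) (P.p e)
  have hp : ∀ᶠ y in 𝓝 e, P.p y ∈ (chartAt EX (P.p e)).source :=
    P.p_smooth.continuous.continuousAt
      ((chartAt EX (P.p e)).open_source.mem_nhds (mem_chart_source EX (P.p e)))
  have hχ : ∀ y, P.p y ∈ (chartAt EX (P.p e)).source →
      ContMDiffAt 𝓘(ℝ, EX) 𝓘(ℝ, EX) ∞ χ (P.p y) := fun y hy => contMDiffAt_extChartAt' hy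
  have hf : ∀ᶠ y in 𝓝 e, ContMDiffAt 𝓘(ℝ, EE) 𝓘(ℝ, EX) ∞ (χ ∘ P.p) y :=
    hp.mono fun y hy => (hχ y hy).comp y P.p_smooth.contMDiffAt
  have hpU : ∀ᶠ y in 𝓝 e, P.p y ∈ U := P.p_smooth.continuous.continuousAt (hU.mem_nhds hx)
  have hcoef : ∀ i, ContMDiffAt 𝓘(ℝ, EE) 𝓘(ℝ, ℝ) ∞ (fun y => c y i) e := by
    refine contMDiffAt_coeff (G := EX)
      (w := fun i y => mvfderiv 𝓘(ℝ, EX) χ (P.p y) (V i (P.p y)))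
      (v := fun y => mvfderiv 𝓘(ℝ, EE) (χ ∘ P.p) y (w y)) (fun i => ?_) (hw.mvfderiv_apply hf)
      ?_ ?_
    · exact (smoothFieldAt_iff.1 ((hV i).at hU hx)).comp e P.p_smooth.contMDiffAt
    · exact (hfr _ hx).1.map' (mvfderiv 𝓘(ℝ, EX) χ (P.p e)).toLinearMap
        (LinearMap.ker_eq_bot.2 (injective_mvfderiv_extChartAt (P.p e)))
    · filter_upwards [hp, hpU] with y hy hyU
      have h1 : mvfderiv 𝓘(ℝ, EE) (χ ∘ P.p) y (w y)
          = mvfderiv 𝓘(ℝ, EX) χ (P.p y) (P.dp y (w y)) :=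
        mfderiv_comp_apply y ((hχ y hy).mdifferentiableAt (by simp))
          (P.p_smooth.mdifferentiable (by simp) y) _
      rw [h1, hc y hyU, map_sum]
      simp only [map_smul]
  refine SmoothFieldAt.congr (V := fun y => ∑ i, c y i • D.hor y (V i (P.p y)))
    (SmoothFieldAt.sum fun i _ => SmoothFieldAt.smul (hcoef i)
      ((D.hor_smoothOn hU (hV i)).at (hU.preimage P.p_smooth.continuous) hx)) ?_
  filter_upwards [hpU] with y hy
  rw [hc y hy, map_sum]
  simp only [map_smul]

theorem vproj_smoothAt {w : ∀ e : E, Tan EE e} {e : E} (hw : SmoothFieldAt w e) :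
    SmoothFieldAt (fun y => (D.vproj y (w y) : Tan EE y)) e :=
  hw.sub (D.hor_dp_smoothAt hw)

/-- The curvature, as a vertical vector at each point of the fiber. -/
def curvAt (x : X) (e : {e : E // P.p e = x}) (u v : Tan EX x) : P.vert e.1 :=
  -(D.vproj e.1 (mlieBracket 𝓘(ℝ, EE) (fun y => D.hor y (extField x u (P.p y)))
    (fun y => D.hor y (extField x v (P.p y))) e.1))

theorem curvAt_swap (x : X) (e : {e : E // P.p e = x}) (u v : Tan EX x) :
    D.curvAt x e u v = -D.curvAt x e v u := by
  rw [curvAt, mlieBracket_swap_apply, map_neg, curvAt]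

variable [CompleteSpace EE]

/-- The vertical component of the bracket of a horizontal lift with a given field depends linearly
on the value of the lifted field. -/
theorem exists_linear_vproj_mlieBracket (e : E) (Y : ∀ e : E, Tan EE e) :
    ∃ L : Tan EX (P.p e) →ₗ[ℝ] P.vert e, ∀ (U : Set X), IsOpen U → P.p e ∈ U →
      ∀ u : ∀ x : X, Tan EX x, SmoothFieldOn u U →
        D.vproj e (mlieBracket 𝓘(ℝ, EE) (fun y => D.hor y (u (P.p y))) Y e) = L (u (P.p e)) := by
  classical
  obtain ⟨U, hU, hx, V, hV, hfr⟩ := isDistribution_top EX X (P.p e)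
  have hli := (hfr _ hx).1
  have hsp : ⊤ ≤ Submodule.span ℝ (Set.range fun i => V i (P.p e)) := (hfr _ hx).2.ge
  let B := Module.Basis.mk hli hsp
  refine ⟨B.constr ℝ fun i =>
    D.vproj e (mlieBracket 𝓘(ℝ, EE) (fun y => D.hor y (V i (P.p y))) Y e), ?_⟩
  intro U' hU' hx' u hu
  have hex : ∀ y : X, ∃ c : Fin (Module.finrank ℝ EX) → ℝ, y ∈ U →
      u y = ∑ i, c i • V i y := fun y => by
    by_cases h : y ∈ U
    · obtain ⟨c, hc⟩ := (Submodule.mem_span_range_iff_exists_fun ℝ).1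
        ((hfr _ h).2.ge (Submodule.mem_top : u y ∈ (⊤ : Submodule ℝ (Tan EX y))))
      exact ⟨c, fun _ => hc.symm⟩
    · exact ⟨0, fun h' => absurd h' h⟩
  choose c hc using hex
  have hcoef : ∀ i, ContMDiffAt 𝓘(ℝ, EX) 𝓘(ℝ, ℝ) ∞ (fun y => c y i) (P.p e) := by
    refine contMDiffAt_coeff (G := EX)
      (w := fun i y => mvfderiv 𝓘(ℝ, EX) (extChartAt 𝓘(ℝ, EX) (P.p e)) y (V i y))
      (v := fun y => mvfderiv 𝓘(ℝ, EX) (extChartAt 𝓘(ℝ, EX) (P.p e)) y (u y))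
      (fun i => smoothFieldAt_iff.1 ((hV i).at hU hx)) (smoothFieldAt_iff.1 (hu.at hU' hx'))
      ?_ ?_
    · exact (hfr _ hx).1.map' (mvfderiv 𝓘(ℝ, EX) _ (P.p e)).toLinearMap
        (LinearMap.ker_eq_bot.2 (injective_mvfderiv_extChartAt (P.p e)))
    · filter_upwards [hU.mem_nhds hx] with y hy
      rw [hc y hy, map_sum]
      simp only [map_smul]
  have h1 : (fun y => D.hor y (u (P.p y))) =ᶠ[𝓝 e]
      fun y => ∑ i, c (P.p y) i • (D.hor y (V i (P.p y)) : Tan EE y) := by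
    filter_upwards [P.p_smooth.continuous.continuousAt (hU.mem_nhds hx)] with y hy
    rw [hc _ hy, map_sum]
    simp only [map_smul]
    rfl
  have h2 := (Filter.EventuallyEq.mlieBracket_vectorField_eq (I := 𝓘(ℝ, EE)) h1
    (Filter.EventuallyEq.refl _ Y)).trans (mlieBracket_sum_smul_left Finset.univ
    (c := fun i y => c (P.p y) i) (V := fun i y => D.hor y (V i (P.p y)))
    (fun i _ => (hcoef i).comp e P.p_smooth.contMDiffAt)
    (fun i _ => (D.hor_smoothOn hU (hV i)).at (hU.preimage P.p_smooth.continuous) hx))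
  rw [h2, hc _ hx, map_sum, map_sum]
  refine Finset.sum_congr rfl fun i _ => ?_
  -- The derivative terms of the Leibniz rule are multiples of horizontal vectors, so `vproj` kills
  -- them.
  rw [map_sub, map_smul, map_smul, vproj_hor, smul_zero, sub_zero, map_smul]
  have h3 : V i (P.p e) = B i := (Module.Basis.mk_apply hli hsp i).symm
  rw [h3, Module.Basis.constr_basis]

/-- Independence of the extensions chosen in `curvAt`: the given fields are exchanged for these
extensions one slot at a time, and antisymmetry carries the first-slot result to the second. -/
theorem vproj_mlieBracket_hor {U : Set X} (hU : IsOpen U) {u v : ∀ x : X, Tan EX x}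
    (hu : SmoothFieldOn u U) (hv : SmoothFieldOn v U) {e : E} (he : P.p e ∈ U) :
    D.vproj e (mlieBracket 𝓘(ℝ, EE) (fun y => D.hor y (u (P.p y)))
      (fun y => D.hor y (v (P.p y))) e) = -D.curvAt (P.p e) ⟨e, rfl⟩ (u (P.p e)) (v (P.p e)) := by
  obtain ⟨U', hU', hx', hs⟩ := exists_extField_smoothOn EX (P.p e)
  obtain ⟨L, hL⟩ := D.exists_linear_vproj_mlieBracket e fun y => D.hor y (v (P.p y))
  obtain ⟨L', hL'⟩ := D.exists_linear_vproj_mlieBracket e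
    fun y => D.hor y (extField (P.p e) (u (P.p e)) (P.p y))
  rw [curvAt, neg_neg, hL U hU he u hu]
  have h1 := hL U' hU' hx' _ (hs (u (P.p e)))
  rw [extField_self] at h1
  rw [← h1, mlieBracket_swap_apply, map_neg, hL' U hU he v hv, mlieBracket_swap_apply, map_neg,
    hL' U' hU' hx' _ (hs (v (P.p e))), extField_self]

theorem curvAt_linear (x : X) (e : {e : E // P.p e = x}) (v : Tan EX x) :
    ∃ L : Tan EX x →ₗ[ℝ] P.vert e.1, ∀ u, D.curvAt x e u v = L u := by
  obtain ⟨e, rfl⟩ := e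
  obtain ⟨U', hU', hx', hs⟩ := exists_extField_smoothOn EX (P.p e)
  obtain ⟨L, hL⟩ := D.exists_linear_vproj_mlieBracket e
    fun y => D.hor y (extField (P.p e) v (P.p y))
  refine ⟨-L, fun u => ?_⟩
  rw [curvAt, hL U' hU' hx' _ (hs u), extField_self, LinearMap.neg_apply]

theorem curvAt_act (x : X) (e : {e : E // P.p e = x}) (h : H) (u v : Tan EX x) :
    (D.curvAt x ⟨P.act e.1 h, (P.p_act e.1 h).trans e.2⟩ u v : Tan EE (P.act e.1 h))
      = P.dR h e.1 (D.curvAt x e u v) := by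
  obtain ⟨e, rfl⟩ := e
  obtain ⟨U, hU, hx, hs⟩ := exists_extField_smoothOn EX (P.p e)
  have hd : ∀ u, DiffFieldAt (fun y => D.hor y (extField (P.p e) u (P.p y))) (P.act e h) :=
    fun u => ((D.hor_smoothOn hU (hs u)).at (hU.preimage P.p_smooth.continuous)
      (by rwa [Set.mem_preimage, P.p_act])).diff
  simp only [curvAt, Submodule.coe_neg, map_neg]
  rw [P.mlieBracket_act (D.hor_invariant _) (D.hor_invariant _) (hd u) (hd v), coe_vproj_act]

/-- The curvature as an element of the adjoint bundle. -/
def curvAd (x : X) (u v : Tan EX x) : P.Ad x :=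
  ⟨fun e => P.toK10 e.1 (D.curvAt x e u v), fun _ => toK10_mem _,
    fun e h => toK10_act (D.curvAt_act x e h u v)⟩

theorem curvAd_apply (x : X) (u v : Tan EX x) (e : {e : E // P.p e = x}) :
    (D.curvAd x u v).1 e = P.toK10 e.1 (D.curvAt x e u v) := rfl

/-- The curvature form. -/
def curvForm (x : X) : CTan EX x [⋀^Fin 2]→ₗ[ℂ] P.Ad x :=
  complexExtension (D.curvAd x)
    (fun a b c => Subtype.ext (funext fun e => by
      obtain ⟨L, hL⟩ := D.curvAt_linear x e c
      rw [Submodule.coe_add, Pi.add_apply, curvAd_apply, curvAd_apply, curvAd_apply, hL, hL, hL,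
        map_add, toK10_add]))
    (fun r a c => Subtype.ext (funext fun e => by
      obtain ⟨L, hL⟩ := D.curvAt_linear x e c
      rw [Submodule.coe_smul, Pi.smul_apply, curvAd_apply, curvAd_apply, hL, hL, map_smul,
        toK10_smul]))
    (fun a b => Subtype.ext (funext fun e => by
      rw [Submodule.coe_neg, Pi.neg_apply, curvAd_apply, curvAd_apply, curvAt_swap, toK10_neg]))

theorem curvForm_apply (e : E) (z w : CTan EX (P.p e)) :
    (D.curvForm (P.p e) ![z, w]).1 ⟨e, rfl⟩
      = (P.toK10 e (D.curvAt (P.p e) ⟨e, rfl⟩ (cre z) (cre w))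
          - P.toK10 e (D.curvAt (P.p e) ⟨e, rfl⟩ (cim z) (cim w)))
        + Complex.I • (P.toK10 e (D.curvAt (P.p e) ⟨e, rfl⟩ (cre z) (cim w))
          + P.toK10 e (D.curvAt (P.p e) ⟨e, rfl⟩ (cim z) (cre w))) := rfl

theorem curvAt_zero_left (x : X) (e : {e : E // P.p e = x}) (v : Tan EX x) :
    D.curvAt x e 0 v = 0 := by
  obtain ⟨L, hL⟩ := D.curvAt_linear x e v
  rw [hL, map_zero]

theorem curvAt_zero_right (x : X) (e : {e : E // P.p e = x}) (v : Tan EX x) :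
    D.curvAt x e v 0 = 0 := by
  rw [curvAt_swap, curvAt_zero_left, neg_zero]

/-- Horizontal lifts are unique, so `uT` and `vT` agree with the lifts by `hor` near `e`. Applying
`vproj` to the hypothesis on `k` then isolates `k`. -/
theorem curvForm_isCurvature : P.IsCurvature D.horSub D.curvForm := by
  intro U hU u v hu hv uT vT _ _ huT hvT e he k hk
  have hU' : IsOpen (P.p ⁻¹' U) := hU.preimage P.p_smooth.continuous
  have h1 : ∀ (w : ∀ x : X, Tan EX x) (wT : ∀ e : E, Tan EE e),
      (∀ e ∈ P.p ⁻¹' U, wT e ∈ D.horSub e ∧ P.dp e (wT e) = w (P.p e)) →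
      wT =ᶠ[𝓝 e] fun y => D.hor y (w (P.p y)) := fun w wT h => by
    filter_upwards [hU'.mem_nhds he] with y hy
    rw [← (h y hy).2, D.hor_dp_of_mem (h y hy).1]
  rw [Filter.EventuallyEq.mlieBracket_vectorField_eq (h1 u uT huT) (h1 v vT hvT)] at hk
  obtain ⟨w, hw⟩ := hk
  have h2 := congrArg (D.vproj e) hw
  rw [vproj_hor, map_add, vproj_vert, D.vproj_mlieBracket_hor hU hu hv he] at h2
  have h3 : D.curvAt (P.p e) ⟨e, rfl⟩ (u (P.p e)) (v (P.p e)) = k :=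
    (neg_add_eq_zero.1 h2.symm)
  rw [curvForm_apply]
  simp only [cre_cvec, cim_cvec, curvAt_zero_left, curvAt_zero_right, toK10_zero, h3]
  simp

/-- `curvAt` uses a different extension at each point. By tensoriality it is computed by the bracket
of the two fixed fields, which is smooth. -/
theorem curvAt_smoothOn {U : Set X} (hU : IsOpen U) {u v : ∀ x : X, Tan EX x}
    (hu : SmoothFieldOn u U) (hv : SmoothFieldOn v U) :
    CSmoothFieldOn (fun e => P.toK10 e (D.curvAt (P.p e) ⟨e, rfl⟩ (u (P.p e)) (v (P.p e))))
      (P.p ⁻¹' U) := by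
  have hU' : IsOpen (P.p ⁻¹' U) := hU.preimage P.p_smooth.continuous
  have h1 : SmoothFieldOn (fun e =>
      (D.curvAt (P.p e) ⟨e, rfl⟩ (u (P.p e)) (v (P.p e)) : Tan EE e)) (P.p ⁻¹' U) := by
    refine smoothFieldOn_of_at fun e he => ?_
    have h2 : SmoothFieldAt (mlieBracket 𝓘(ℝ, EE) (fun y => D.hor y (u (P.p y)))
        (fun y => D.hor y (v (P.p y)))) e := by
      have : IsManifold 𝓘(ℝ, EE) (minSmoothness ℝ 2) E := by
        rw [minSmoothness_of_isRCLikeNormedField]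
        exact isManifold_two EE E
      have hle : ((⊤ : ℕ∞) : ℕ∞ω) + 1 ≤ ∞ := by simp
      have : IsManifold 𝓘(ℝ, EE) (((⊤ : ℕ∞) : ℕ∞ω) + 1) E := IsManifold.of_le hle
      refine ContMDiffAt.mlieBracket_vectorField (n := (⊤ : ℕ∞)) (m := (⊤ : ℕ∞))
        ((D.hor_smoothOn hU hu).at hU' he) ((D.hor_smoothOn hU hv).at hU' he) ?_
      rw [minSmoothness_of_isRCLikeNormedField]
      exact hle
    refine (D.vproj_smoothAt h2).neg.congr ?_
    filter_upwards [hU'.mem_nhds he] with y hy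
    rw [D.vproj_mlieBracket_hor hU hu hv hy, Submodule.coe_neg, neg_neg]
  have h3 := P.isFiberComplex.smooth _ hU' _ h1
  constructor
  · simp only [cre_toK10]
    exact smoothFieldOn_of_at fun e he => (h1.at hU' he).const_smul _
  · simp only [cim_toK10]
    exact smoothFieldOn_of_at fun e he => ((h3.at hU' he).const_smul _).neg

theorem curvForm_isSmoothForm : P.IsSmoothForm D.curvForm := by
  intro U hU v w hv hw
  have hU' : IsOpen (P.p ⁻¹' U) := hU.preimage P.p_smooth.continuous
  have h1 := D.curvAt_smoothOn hU hv.1 hw.1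
  have h2 := D.curvAt_smoothOn hU hv.2 hw.2
  have h3 := D.curvAt_smoothOn hU hv.1 hw.2
  have h4 := D.curvAt_smoothOn hU hv.2 hw.1
  have h5 : (P.field fun x => D.curvForm x ![v x, w x]) = fun e => _ :=
    funext fun e => D.curvForm_apply e (v (P.p e)) (w (P.p e))
  rw [h5]
  constructor
  · simp only [map_add, map_sub, cre_smul, Complex.I_re, Complex.I_im, zero_smul, one_smul,
      zero_sub]
    exact smoothFieldOn_of_at fun e he => (((h1.1.at hU' he).sub (h2.1.at hU' he))).add
      ((h3.2.at hU' he).add (h4.2.at hU' he)).neg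
  · simp only [map_add, map_sub, cim_smul, Complex.I_re, Complex.I_im, zero_smul, one_smul,
      zero_add]
    exact smoothFieldOn_of_at fun e he => (((h1.2.at hU' he).sub (h2.2.at hU' he))).add
      ((h3.1.at hU' he).add (h4.1.at hU' he))

end HolomorphicConnection
end HolomorphicPrincipalBundle

/-! ### The type of the curvature. -/

namespace HolomorphicPrincipalBundle

open VectorField

variable {EX : Type*} [NormedAddCommGroup EX] [NormedSpace ℝ EX] [FiniteDimensional ℝ EX]
  {X : Type*} [TopologicalSpace X] [ChartedSpace EX X] [IsManifold 𝓘(ℝ, EX) ∞ X]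
  {S : SasakianStructure EX X}
  {EH : Type*} [NormedAddCommGroup EH] [NormedSpace ℂ EH]
  {H : Type*} [TopologicalSpace H] [ChartedSpace EH H] [Group H]
  {EE : Type*} [NormedAddCommGroup EE] [NormedSpace ℝ EE]
  {E : Type*} [TopologicalSpace E] [ChartedSpace EE E] [IsManifold 𝓘(ℝ, EE) ∞ E]
  {m : ℕ} {P : HolomorphicPrincipalBundle EH H EE E m S}

theorem mem_K01 {e : E} {z : CTan EE e} :
    z ∈ P.K01 P.J e ↔ ∃ k : P.vert e, z = cvec (k : Tan EE e) (P.J e k) :=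
  mem_span_cvec (P.J e) (P.isFiberComplex.sq e)

theorem mem_K10 {e : E} {z : CTan EE e} :
    z ∈ P.K10 P.J e ↔ ∃ k : P.vert e, z = cvec (k : Tan EE e) (-(P.J e k)) :=
  mem_span_cvec (-P.J e) (fun v => by simp [P.isFiberComplex.sq e v])

theorem exists_lift_FT (e : E) {z : CTan EX (P.p e)} (hz : z ∈ S.calF01 (P.p e)) :
    ∃ f ∈ P.FT e, P.cdp e f = z := by
  rw [← P.isCPartialConnection_FT.map_eq e] at hz
  exact hz

namespace HolomorphicConnection

variable (D : P.HolomorphicConnection)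

theorem cconj_horC {e : E} (z : CTan EX (P.p e)) : D.horC e (cconj z) = cconj (D.horC e z) :=
  ctensor_ext (by rw [cre_horC, cre_cconj, cre_cconj, cre_horC])
    (by rw [cim_horC, cim_cconj, cim_cconj, cim_horC, map_neg])

/-- The horizontal lift differs from the lift to `FT` by an element of `K^{0,1}`. -/
theorem horC_cdp_of_mem_FT {e : E} {f : CTan EE e} (hf : f ∈ P.FT e) :
    ∃ k : P.vert e, D.horC e (P.cdp e f) = f + cvec (k : Tan EE e) (P.J e k) := by
  have h0 : P.cdp e f ∈ S.calF01 (P.p e) := by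
    rw [← P.isCPartialConnection_FT.map_eq e]
    exact ⟨f, hf, rfl⟩
  obtain ⟨v, hv, a, b, hz⟩ := S.mem_calF01.1 h0
  have hx : D.horC e (cvec (a • S.xi (P.p e)) (b • S.xi (P.p e)))
      = cvec (a • P.xiHat e) (b • P.xiHat e) := by
    refine ctensor_ext ?_ ?_
    · rw [cre_horC, cre_cvec, cre_cvec, map_smul, hor_xi]
    · rw [cim_horC, cim_cvec, cim_cvec, map_smul, hor_xi]
  have hf' : f - cvec (a • P.xiHat e) (b • P.xiHat e) ∈ P.FT e :=
    Submodule.sub_mem _ hf (P.cvec_xiHat_mem e a b)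
  have hdp : P.cdp e (f - cvec (a • P.xiHat e) (b • P.xiHat e)) = cvec v (S.Phi _ v) := by
    rw [map_sub, ← hx, cdp_horC, hz, add_sub_cancel_right]
  let w : S.F10 (P.p e) := ⟨cvec v (-(S.Phi _ v)), S.mem_F10.2 ⟨v, hv, rfl⟩⟩
  -- `D(w)` decomposes in `K^{1,0}` plus the conjugate of `FF`. Conjugating places the lift of the
  -- `F^{0,1}` part in `K^{0,1} + FT`.
  have hD := (D.D (P.p e) w).2.1 ⟨e, rfl⟩
  rw [D.D_eq_horC] at hD
  obtain ⟨κ, hκ, g, hg, hsum⟩ := Submodule.mem_sup.1 hD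
  obtain ⟨k, rfl⟩ := mem_K10.1 hκ
  have hg' : cconj g ∈ P.FT e := hg.1
  have hw : cvec v (S.Phi (P.p e) v) = cconj (w : CTan EX (P.p e)) :=
    ctensor_ext (by simp [w]) (by simp [w])
  have hconj : D.horC e (cvec v (S.Phi (P.p e) v))
      = cvec (k : Tan EE e) (P.J e k) + cconj g := by
    rw [hw, cconj_horC, ← hsum, map_add]
    congr 1
    exact ctensor_ext (by simp) (by simp)
  have hk0 : P.cdp e (cvec (k : Tan EE e) (P.J e k)) = 0 := by
    refine ctensor_ext ?_ ?_
    · rw [P.cre_cdp, cre_cvec, map_zero]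
      exact k.2
    · rw [P.cim_cdp, cim_cvec, map_zero]
      exact (P.J e k).2
  -- Both sides lie in `FT` and have the same image in the base, and `dp` is injective on `FT`.
  have heq : cconj g = f - cvec (a • P.xiHat e) (b • P.xiHat e) := by
    rw [← sub_eq_zero]
    refine P.isCPartialConnection_FT.injective e _ (Submodule.sub_mem _ hg' hf') ?_
    rw [map_sub, hdp, sub_eq_zero, ← D.cdp_horC e (cvec v (S.Phi (P.p e) v)), hconj, map_add, hk0,
      zero_add]
  refine ⟨k, ?_⟩
  rw [hz, map_add, hx, hconj, heq]
  abel

theorem horC_mem {e : E} {z : CTan EX (P.p e)} (hz : z ∈ S.calF01 (P.p e)) :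
    D.horC e z ∈ P.FT e ⊔ P.K01 P.J e := by
  obtain ⟨f, hf, rfl⟩ := exists_lift_FT e hz
  obtain ⟨k, hk⟩ := D.horC_cdp_of_mem_FT hf
  rw [hk]
  exact Submodule.add_mem_sup hf (mem_K01.2 ⟨k, rfl⟩)

/-- The `K^{1,0}`-component of the vertical part of a complex tangent vector. -/
def prK10 (e : E) (z : CTan EE e) : CTan EE e :=
  P.toK10 e (D.vproj e (cre z)) + Complex.I • P.toK10 e (D.vproj e (cim z))

theorem prK10_add {e : E} (z w : CTan EE e) :
    D.prK10 e (z + w) = D.prK10 e z + D.prK10 e w := by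
  simp only [prK10, map_add, toK10_add, smul_add]
  abel

theorem prK10_horC {e : E} (z : CTan EX (P.p e)) : D.prK10 e (D.horC e z) = 0 := by
  rw [prK10, cre_horC, cim_horC, vproj_hor, vproj_hor, toK10_zero, smul_zero, add_zero]

/-- `toK10` is complex linear for `J`, so the two terms are `toK10 k` and `toK10 (J² k) = -toK10 k`.
-/
theorem prK10_K01 {e : E} (k : P.vert e) : D.prK10 e (cvec (k : Tan EE e) (P.J e k)) = 0 := by
  rw [prK10, cre_cvec, cim_cvec, vproj_vert, vproj_vert, I_smul_toK10, P.isFiberComplex.sq,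
    toK10_neg, add_neg_cancel]

/-- An element of `FT` is a horizontal vector minus an element of `K^{0,1}`, and `prK10` kills both.
-/
theorem prK10_of_mem {e : E} {z : CTan EE e} (hz : z ∈ P.FT e ⊔ P.K01 P.J e) :
    D.prK10 e z = 0 := by
  obtain ⟨f, hf, κ, hκ, rfl⟩ := Submodule.mem_sup.1 hz
  obtain ⟨l, rfl⟩ := mem_K01.1 hκ
  obtain ⟨k, hk⟩ := D.horC_cdp_of_mem_FT hf
  have h := D.prK10_horC (P.cdp e f)
  rw [hk, prK10_add, prK10_K01, add_zero] at h
  rw [prK10_add, prK10_K01, h, add_zero]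

theorem horC_smoothOn {u : ∀ x : X, CTan EX x} {U : Set X} (hU : IsOpen U)
    (hu : CSmoothFieldOn u U) : CSmoothFieldOn (fun e => D.horC e (u (P.p e))) (P.p ⁻¹' U) := by
  simp only [CSmoothFieldOn, cre_horC, cim_horC]
  exact ⟨D.hor_smoothOn (u := fun x => cre (u x)) hU hu.1,
    D.hor_smoothOn (u := fun x => cim (u x)) hU hu.2⟩

variable [CompleteSpace EE]

/-- Both sides are complex bilinear extensions of the real formula `vproj_mlieBracket_hor`.
Vanishing of the curvature thereby becomes a question about which distribution contains a bracket.
-/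
theorem prK10_cBracket {U : Set X} (hU : IsOpen U) {u v : ∀ x : X, CTan EX x}
    (hu : CSmoothFieldOn u U) (hv : CSmoothFieldOn v U) {e : E} (he : P.p e ∈ U) :
    D.prK10 e (cBracket (fun y => D.horC y (u (P.p y))) (fun y => D.horC y (v (P.p y))) e)
      = -(D.curvForm (P.p e) ![u (P.p e), v (P.p e)]).1 ⟨e, rfl⟩ := by
  rw [curvForm_apply, prK10, cBracket]
  simp only [cre_horC, cim_horC, cre_cvec, cim_cvec, map_add, map_sub]
  rw [D.vproj_mlieBracket_hor hU hu.1 hv.1 he, D.vproj_mlieBracket_hor hU hu.2 hv.2 he,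
    D.vproj_mlieBracket_hor hU hu.1 hv.2 he, D.vproj_mlieBracket_hor hU hu.2 hv.1 he]
  simp only [sub_eq_add_neg, neg_neg, toK10_add, toK10_neg, smul_add, smul_neg]
  abel

/-- A smooth section of `𝓕^{0,1}` with a given value. -/
theorem exists_calF01_extension {x : X} {z : CTan EX x} (hz : z ∈ S.calF01 x) :
    ∃ u : ∀ y : X, CTan EX y, (∀ y, u y ∈ S.calF01 y) ∧ u x = z ∧
      ∀ U : Set X, IsOpen U → (∀ v : Tan EX x, SmoothFieldOn (extField x v) U) →
        CSmoothFieldOn u U := by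
  obtain ⟨v, hv, a, b, rfl⟩ := S.mem_calF01.1 hz
  refine ⟨fun y => cvec (S.projF y (extField x v y)) (S.Phi y (extField x v y))
    + cvec (a • S.xi y) (b • S.xi y), fun y => S.mem_calF01.2
      ⟨S.projF y (extField x v y), S.projF_mem _ _, a, b, by rw [S.Phi_projF]⟩, ?_, ?_⟩
  · simp only [extField_self]
    rw [S.projF_of_mem hv]
  · intro U hU h
    have hxi : ∀ y : X, SmoothFieldAt S.xi y := fun y =>
      S.xi_smooth.at isOpen_univ (Set.mem_univ _)
    simp only [CSmoothFieldOn, map_add, cre_cvec, cim_cvec]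
    exact ⟨smoothFieldOn_of_at fun y hy => ((S.projF_smoothOn hU (h v)).at hU hy).add
      ((hxi y).const_smul a), smoothFieldOn_of_at fun y hy =>
        ((S.Phi_smoothOn hU (h v)).at hU hy).add ((hxi y).const_smul b)⟩

/-- The horizontal lifts of sections of `𝓕^{0,1}` are sections of the integrable distribution `FT ⊕
K^{0,1}`, on which `prK10` vanishes. -/
theorem curvForm_calF01_calF01 (e : E) {v w : CTan EX (P.p e)} (hv : v ∈ S.calF01 (P.p e))
    (hw : w ∈ S.calF01 (P.p e)) : (D.curvForm (P.p e) ![v, w]).1 ⟨e, rfl⟩ = 0 := by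
  obtain ⟨U, hU, hx, hs⟩ := exists_extField_smoothOn EX (P.p e)
  obtain ⟨v', hv', rfl, hvs⟩ := exists_calF01_extension hv
  obtain ⟨w', hw', rfl, hws⟩ := exists_calF01_extension hw
  have hv₁ := hvs U hU hs
  have hw₁ := hws U hU hs
  have h := D.prK10_cBracket hU hv₁ hw₁ hx
  rw [prK10_of_mem] at h
  · exact neg_eq_zero.1 h.symm
  · exact P.integrable_FT_K01 _ (hU.preimage P.p_smooth.continuous) _ _ (D.horC_smoothOn hU hv₁)
      (D.horC_smoothOn hU hw₁) (fun y _ => D.horC_mem (hv' _)) (fun y _ => D.horC_mem (hw' _)) e hx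

theorem cBracket_add_left {V V' W : ∀ e : E, CTan EE e} {e : E}
    (h₁ : DiffFieldAt (fun y => cre (V y)) e) (h₂ : DiffFieldAt (fun y => cim (V y)) e)
    (h₁' : DiffFieldAt (fun y => cre (V' y)) e) (h₂' : DiffFieldAt (fun y => cim (V' y)) e) :
    cBracket (fun y => V y + V' y) W e = cBracket V W e + cBracket V' W e := by
  have h : ∀ W : ∀ e : E, Tan EE e,
      mlieBracket 𝓘(ℝ, EE) (fun y => cre (V y) + cre (V' y)) W e
        = mlieBracket 𝓘(ℝ, EE) (fun y => cre (V y)) W e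
          + mlieBracket 𝓘(ℝ, EE) (fun y => cre (V' y)) W e ∧
      mlieBracket 𝓘(ℝ, EE) (fun y => cim (V y) + cim (V' y)) W e
        = mlieBracket 𝓘(ℝ, EE) (fun y => cim (V y)) W e
          + mlieBracket 𝓘(ℝ, EE) (fun y => cim (V' y)) W e := fun W => by
    have := isManifold_two EE E
    exact ⟨mlieBracket_add_left h₁ h₁', mlieBracket_add_left h₂ h₂'⟩
  simp only [cBracket, map_add, (h _).1, (h _).2, cvec_add]
  congr 1 <;> abel

/-- Split the lift of `v` as `ṽ + κ`, with `ṽ` in `FT` and `κ` in `K^{0,1}`. Holomorphicity of `D`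
controls `[ṽ, D w]`, and invariance of `D w` keeps `[κ, D w]` in `K^{0,1}`. -/
theorem curvForm_calF01_F10 [FiniteDimensional ℝ EE] [FiniteDimensional ℂ EH]
    [IsManifold 𝓘(ℝ, EH) ∞ H] (e : E) {v w : CTan EX (P.p e)} (hv : v ∈ S.calF01 (P.p e))
    (hw : w ∈ S.F10 (P.p e)) : (D.curvForm (P.p e) ![v, w]).1 ⟨e, rfl⟩ = 0 := by
  obtain ⟨U, hU, hx, hs⟩ := exists_extField_smoothOn EX (P.p e)
  have hU' : IsOpen (P.p ⁻¹' U) := hU.preimage P.p_smooth.continuous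
  obtain ⟨v', hv', rfl, hvs⟩ := exists_calF01_extension hv
  obtain ⟨w₀, hw₀, rfl⟩ := S.mem_F10.1 hw
  let w' : ∀ y : X, S.F10 y := fun y => S.toF10 y (extField (P.p e) w₀ y)
  have hw' : (w' (P.p e) : CTan EX (P.p e)) = cvec w₀ (-(S.Phi (P.p e) w₀)) := by
    simp only [w']
    rw [extField_self, S.coe_toF10, S.projF_of_mem hw₀]
  have hv₁ := hvs U hU hs
  have hw₁ : CSmoothFieldOn (fun y => (w' y : CTan EX y)) U := S.toF10_smoothOn hU (hs w₀)
  -- `u'` is `∂̄_v w`, chosen point by point; `holomorphic` requires no smoothness of it.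
  choose u' hu' using fun y => S.exists_sub_mem_calF01 y
    (cBracket v' (fun y => (w' y : CTan EX y)) y)
  choose vT hvT hvT' using fun y : E => exists_lift_FT y (hv' (P.p y))
  have hvTs : ∀ y ∈ P.p ⁻¹' U, SmoothFieldAt (fun y => cre (vT y)) y ∧
      SmoothFieldAt (fun y => cim (vT y)) y := fun y hy =>
    P.isCPartialConnection_FT.smoothFieldAt_lift (Filter.Eventually.of_forall fun y =>
      ⟨hvT y, hvT' y⟩) (hv₁.1.at hU hy) (hv₁.2.at hU hy)
  have hhol := D.holomorphic U hU v' hv₁ (fun y _ => hv' y) w' u' hw₁ (fun y _ => hu' y) vT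
    ⟨smoothFieldOn_of_at fun y hy => (hvTs y hy).1,
      smoothFieldOn_of_at fun y hy => (hvTs y hy).2⟩ (fun y _ => ⟨hvT y, hvT' y⟩) e hx
  have hfield : ∀ s : ∀ y : X, S.F10 y, (P.field fun y => D.D y (s y))
      = fun y => D.horC y (s (P.p y) : CTan EX (P.p y)) := fun s =>
    funext fun y => D.D_eq_horC y (s (P.p y))
  rw [hfield, hfield] at hhol
  have h1 : D.prK10 e (cBracket vT (fun y => D.horC y (w' (P.p y) : CTan EX (P.p y))) e) = 0 := by
    have h := D.prK10_of_mem hhol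
    have h' := D.prK10_add (cBracket vT (fun y => D.horC y (w' (P.p y) : CTan EX (P.p y))) e
      - D.horC e (u' (P.p e) : CTan EX (P.p e))) (D.horC e (u' (P.p e) : CTan EX (P.p e)))
    rwa [sub_add_cancel, h, prK10_horC, add_zero] at h'
  choose k hk using fun y => D.horC_cdp_of_mem_FT (hvT y)
  simp only [hvT'] at hk
  -- `k` is the real part of the difference of two smooth lifts, the horizontal one and the one to
  -- `FT`.
  have hks : ∀ y ∈ P.p ⁻¹' U, SmoothFieldAt (fun y => (k y : Tan EE y)) y := fun y hy => by
    refine ((((D.horC_smoothOn hU hv₁).1.at hU' hy).sub (hvTs y hy).1)).congr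
      (Filter.Eventually.of_forall fun z => ?_)
    change _ = cre (D.horC z (v' (P.p z))) - cre (vT z)
    rw [hk z, map_add, cre_cvec, add_sub_cancel_left]
  have hJks := P.isFiberComplex.smooth _ hU' k (smoothFieldOn_of_at hks)
  have hvert := fun (Y : ∀ y : E, Tan EE y) (hY : P.Invariant Y) (hYd : DiffFieldAt Y e) =>
    P.mlieBracket_vert P.isFiberComplex (jk := fun y => (P.J y (k y) : Tan EE y)) (hks e hx)
      (Filter.Eventually.of_forall fun y => ⟨k y, rfl, rfl⟩) hY hYd
  obtain ⟨q₁, hq₁, hq₁'⟩ := hvert _ (D.hor_invariant fun y => cre (w' y : CTan EX y))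
    ((D.hor_smoothOn hU hw₁.1).at hU' hx).diff
  obtain ⟨q₂, hq₂, hq₂'⟩ := hvert _ (D.hor_invariant fun y => cim (w' y : CTan EX y))
    ((D.hor_smoothOn hU hw₁.2).at hU' hx).diff
  -- With `q₁`, `q₂` the brackets of `k` with the real and imaginary parts of the lift of `w`, the
  -- bracket has real part `q₁ - J q₂` and imaginary part `q₂ + J q₁ = J (q₁ - J q₂)`, so it lies in
  -- `K^{0,1}`.
  have h2 : cBracket (fun y => cvec (k y : Tan EE y) (P.J y (k y)))
      (fun y => D.horC y (w' (P.p y) : CTan EX (P.p y))) e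
      = cvec ((q₁ - P.J e q₂ : P.vert e) : Tan EE e) (P.J e (q₁ - P.J e q₂)) := by
    simp only [cBracket, cre_cvec, cim_cvec, cre_horC, cim_horC, hq₁, hq₁', hq₂, hq₂', map_sub,
      P.isFiberComplex.sq]
    simp [add_comm]
  have h3 := D.prK10_cBracket hU hv₁ hw₁ hx
  simp only [hk] at h3
  rw [cBracket_add_left (hvTs e hx).1.diff (hvTs e hx).2.diff
    (by simpa only [cre_cvec] using (hks e hx).diff)
    (by simpa only [cim_cvec] using (hJks.at hU' hx).diff), prK10_add, h1, h2, prK10_K01,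
    add_zero, hw'] at h3
  exact neg_eq_zero.1 h3.symm

/-- Split the second argument into its `F^{1,0}` and `𝓕^{0,1}` components; each of the two preceding
vanishing results handles one. -/
theorem curvForm_isTwoZero [FiniteDimensional ℝ EE] [FiniteDimensional ℂ EH]
    [IsManifold 𝓘(ℝ, EH) ∞ H] : P.IsTwoZero D.curvForm := by
  intro x v w hv
  refine Subtype.ext (funext fun e => ?_)
  obtain ⟨e, rfl⟩ := e
  obtain ⟨u, hu⟩ := S.exists_sub_mem_calF01 (P.p e) w
  have h1 : D.curvForm (P.p e) ![v, w] = D.curvForm (P.p e) ![v, (u : CTan EX (P.p e))]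
      + D.curvForm (P.p e) ![v, w - (u : CTan EX (P.p e))] := by
    have h := (D.curvForm (P.p e)).map_update_add ![v, w] 1 (u : CTan EX (P.p e))
      (w - (u : CTan EX (P.p e)))
    have hup : ∀ t : CTan EX (P.p e), Function.update ![v, w] 1 t = ![v, t] := fun t => by
      funext i
      fin_cases i <;> rfl
    rwa [add_sub_cancel, hup, hup, hup] at h
  rw [h1, Submodule.coe_add, Pi.add_apply, D.curvForm_calF01_F10 e hv u.2,
    D.curvForm_calF01_calF01 e hv hu, add_zero]
  rfl

end HolomorphicConnection
end HolomorphicPrincipalBundle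

end Sasaki

end

theorem lemma3p1 (m : ℕ) (_hm : 0 < m)
    {EX : Type*} [NormedAddCommGroup EX] [NormedSpace ℝ EX] [FiniteDimensional ℝ EX]
    (hdim : Module.finrank ℝ EX = 2 * m + 1)
    {X : Type*} [TopologicalSpace X] [ChartedSpace EX X] [IsManifold 𝓘(ℝ, EX) ∞ X]
    [T2Space X] [SecondCountableTopology X] [ConnectedSpace X]
    (S : Sasaki.SasakianStructure EX X)
    {EH : Type*} [NormedAddCommGroup EH] [NormedSpace ℂ EH] [FiniteDimensional ℂ EH]
    {H : Type*} [TopologicalSpace H] [ChartedSpace EH H] [Group H] [T2Space H]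
    [LieGroup 𝓘(ℂ, EH) ∞ H]
    {EE : Type*} [NormedAddCommGroup EE] [NormedSpace ℝ EE] [FiniteDimensional ℝ EE]
    {E : Type*} [TopologicalSpace E] [ChartedSpace EE E] [IsManifold 𝓘(ℝ, EE) ∞ E]
    (P : Sasaki.HolomorphicPrincipalBundle EH H EE E m S)
    (D : P.HolomorphicConnection) :
    ∃ T : ∀ e : E, Submodule ℝ (Sasaki.Tan EE e),
      P.IsInducedConnection D T ∧
      (∀ T' : ∀ e : E, Submodule ℝ (Sasaki.Tan EE e),
        P.IsInducedConnection D T' → T' = T) ∧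
      ∃ Om : ∀ x : X, Sasaki.CTan EX x [⋀^Fin 2]→ₗ[ℂ] P.Ad x,
        P.IsCurvature T Om ∧ P.IsSmoothForm Om ∧ P.IsTwoZero Om := by
  have : IsManifold 𝓘(ℂ, EH) ∞ H :=
    (LieGroup.toContMDiffMul : ContMDiffMul 𝓘(ℂ, EH) ∞ H).toIsManifold
  have := Sasaki.isManifold_restrictScalars (EH := EH) H
  have : CompleteSpace EE := FiniteDimensional.complete ℝ EE
  exact ⟨D.horSub, D.horSub_isInducedConnection, fun _ hT => D.eq_horSub hT, D.curvForm,
    D.curvForm_isCurvature, D.curvForm_isSmoothForm, D.curvForm_isTwoZero⟩
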